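/- Let $k$ be a field of characteristic $2$ and $G=Q_8=\langle g,h\mid g^2=h^2,\ ghg=h\rangle$. For a complete projective resolution $P$ of the trivial $kG$-module $k$ let $\mathcal A=\operatorname{Hom}^*_{kG}(P,P)$ be its endomorphism differential graded algebra and $\hat H^*(G)=H^*\mathcal A$ the Tate cohomology ring. The canonical class $\gamma_G\in HH^{3,-1}\hat H^*(G)$ is the class of the Hochschild cocycle $(a,b,c)\mapsto[f_2(a,b)f_1(c)-f_2(a,bc)+f_2(ab,c)-(-1)^{|a|}f_1(a)f_2(b,c)]$, where $f_1:H^*\mathcal A\to\mathcal A$ is a $k$-linear degree $0$ choice of representing cocycles and $f_2:H^*\mathcal A\otimes H^*\mathcal A\to\mathcal A$ has degree $-1$ and satisfies $df_2(a,b)=f_1(ab)-f_1(a)f_1(b)$; it does not depend on the choices. Complete projective resolutions of $k$ exist, and for each of them the following holds. Let $x,y\in\hat H^1(G)=\operatorname{Hom}(G,k)$ be given by $x(g)=1$, $x(h)=0$, $y(g)=0$, $y(h)=1$. There is an invertible $s\in\hat H^4(G)$ such that $$\hat H^*(G)=k[x,y,s^{\pm1}]/(x^2+y^2=xy,\ y^3=0),$$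 with $k$-basis $\{bs^i : b\in\mathcal B,\ i\in\mathbb Z\}$, where $\mathcal B=\{1,x,y,x^2,y^2,x^2y\}$. Define $C(b,c)\in\hat H^*(G)$ for $b,c\in\mathcal B$ by $$C(x,y)=C(y,x)=x+y,\quad C(x,x^2)=C(x^2,x)=x^2,\quad C(x,y^2)=C(y^2,x)=x^2+y^2,$$ $$C(x,x^2y)=C(x^2y,x)=x^2y,\quad C(y,y^2)=C(y^2,y)=y^2,$$ and $C(b,c)=0$ for all other $b,c\in\mathcal B$. Then there is exactly one $k$-trilinear map $m$ on $\hat H^*(G)$ with - $m(x,y,x)=xy$, $m(x,y,x^2)=x^2y$, $m(x^2,y,x)=x^2y$, and $m(a,b,c)=0$ for all other $a,b,c\in\mathcal B$; - $m(sa,b,c)=s\,m(a,b,c)+s\,a\,C(b,c)$ for all $a,b,c\in\mathcal B$; - $m(s^{2i}a,s^jb,s^lc)=s^{2i+j+l}m(a,b,c)$ for all $i,j,l\in\mathbb Z$ and all $a,b,c\in\hat H^*(G)$. This $m$ is a Hochschild $(3,-1)$-cocycle, it represents $\gamma_G$, and $\gamma_G\neq0$ in $HH^{3,-1}\hat H^*(G)$.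 -/

import Mathlib

open CategoryTheory
open scoped TensorProduct

universe u v

noncomputable section

namespace TateQ

/-! ### Differential graded algebras -/

section Sign

variable {k : Type u} [Field k] {A : Type v} [Ring A] [Algebra k A]
  (𝒜 : ℤ → Submodule k A) [GradedAlgebra 𝒜]

/-- The linear map of a graded algebra that multiplies elements of degree `n` by `(-1) ^ n`. -/
def gradeSign : A →ₗ[k] A :=
  (DirectSum.toModule k ℤ A fun n => (n.negOnePow : ℤ) • (𝒜 n).subtype) ∘ₗ
    (DirectSum.decomposeLinearEquiv 𝒜).toLinearMap

theorem gradeSign_of_mem {n : ℤ} {a : A} (ha : a ∈ 𝒜 n) :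
    gradeSign 𝒜 a = (n.negOnePow : ℤ) • a := by
  have h : DirectSum.decomposeLinearEquiv 𝒜 a = DirectSum.lof k ℤ (fun i => 𝒜 i) n ⟨a, ha⟩ :=
    DirectSum.decompose_of_mem 𝒜 ha
  simp only [gradeSign, LinearMap.comp_apply, LinearEquiv.coe_coe, h, DirectSum.toModule_lof,
    LinearMap.smul_apply, Submodule.subtype_apply]

theorem gradeSign_sq (a : A) : gradeSign 𝒜 (gradeSign 𝒜 a) = a := by
  induction a using DirectSum.Decomposition.inductionOn 𝒜 with
  | zero => simp
  | @homogeneous i m =>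
    rw [gradeSign_of_mem 𝒜 m.2, map_zsmul, gradeSign_of_mem 𝒜 m.2, smul_smul,
      ← Units.val_mul, Int.units_mul_self, Units.val_one, one_smul]
  | add a b ha hb => rw [map_add, map_add, ha, hb]

theorem gradeSign_mem {n : ℤ} {a : A} (ha : a ∈ 𝒜 n) : gradeSign 𝒜 a ∈ 𝒜 n := by
  rw [gradeSign_of_mem 𝒜 ha]
  exact zsmul_mem ha _

theorem gradeSign_mul (a b : A) : gradeSign 𝒜 (a * b) = gradeSign 𝒜 a * gradeSign 𝒜 b := by
  induction a using DirectSum.Decomposition.inductionOn 𝒜 with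
  | zero => simp
  | @homogeneous i x =>
    induction b using DirectSum.Decomposition.inductionOn 𝒜 with
    | zero => simp
    | @homogeneous j y =>
      rw [gradeSign_of_mem 𝒜 x.2, gradeSign_of_mem 𝒜 y.2,
        gradeSign_of_mem 𝒜 (SetLike.mul_mem_graded x.2 y.2), Int.negOnePow_add, smul_mul_smul_comm,
        Units.val_mul]
    | add b c hb hc => rw [mul_add, map_add, map_add, mul_add, hb, hc]
  | add a c ha hc => rw [add_mul, map_add, map_add, add_mul, ha, hc]

end Sign

/-- A differential graded algebra over `k`, with a differential of degree `1`. -/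
structure DGAlg (k : Type u) [Field k] where
  carrier : Type v
  [ring : Ring carrier]
  [algebra : Algebra k carrier]
  /-- the homogeneous elements of each degree -/
  deg : ℤ → Submodule k carrier
  [graded : GradedAlgebra deg]
  d : carrier →ₗ[k] carrier
  d_mem : ∀ {n : ℤ} {a : carrier}, a ∈ deg n → d a ∈ deg (n + 1)
  d_d : ∀ a, d (d a) = 0
  leibniz : ∀ {n : ℤ} {a : carrier} (b : carrier), a ∈ deg n →
    d (a * b) = d a * b + (n.negOnePow : ℤ) • (a * d b)

attribute [instance] DGAlg.ring DGAlg.algebra DGAlg.graded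

namespace DGAlg

variable {k : Type u} [Field k] (A : DGAlg.{u, v} k)

theorem leibniz_sign (a b : A.carrier) :
    A.d (a * b) = A.d a * b + gradeSign A.deg a * A.d b := by
  induction a using DirectSum.Decomposition.inductionOn A.deg with
  | zero => simp
  | @homogeneous i x =>
    rw [A.leibniz b x.2, gradeSign_of_mem A.deg x.2, smul_mul_assoc]
  | add a c ha hc => rw [add_mul, map_add, map_add, map_add, add_mul, add_mul, ha, hc]; abel

theorem d_sign (a : A.carrier) : A.d (gradeSign A.deg a) = -gradeSign A.deg (A.d a) := by
  induction a using DirectSum.Decomposition.inductionOn A.deg with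
  | zero => simp
  | @homogeneous i x =>
    rw [gradeSign_of_mem A.deg x.2, gradeSign_of_mem A.deg (A.d_mem x.2), map_zsmul,
      Int.negOnePow_succ, Units.val_neg, neg_smul, neg_neg]
  | add a c ha hc => rw [map_add, map_add, map_add, map_add, ha, hc]; abel

theorem d_one : A.d 1 = 0 := by
  have h := A.leibniz (1 : A.carrier) (SetLike.one_mem_graded A.deg)
  simpa using h

theorem d_sign_eq_zero {a : A.carrier} (ha : A.d a = 0) : A.d (gradeSign A.deg a) = 0 := by
  rw [d_sign, ha, map_zero, neg_zero]

theorem d_mul_eq_zero {a b : A.carrier} (ha : A.d a = 0) (hb : A.d b = 0) :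
    A.d (a * b) = 0 := by
  rw [leibniz_sign, ha, hb, zero_mul, mul_zero, add_zero]

/-- The subalgebra of cocycles. -/
def cycles : Subalgebra k A.carrier where
  carrier := {a | A.d a = 0}
  mul_mem' := fun ha hb => A.d_mul_eq_zero ha hb
  add_mem' := fun {a b} ha hb => by
    change A.d (a + b) = 0
    rw [map_add, show A.d a = 0 from ha, show A.d b = 0 from hb, add_zero]
  algebraMap_mem' := fun r => by
    change A.d (algebraMap k A.carrier r) = 0
    rw [Algebra.algebraMap_eq_smul_one, map_smul, d_one, smul_zero]

theorem mem_cycles {a : A.carrier} : a ∈ A.cycles ↔ A.d a = 0 := Iff.rfl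

/-- The ideal of coboundaries in the algebra of cocycles. -/
def boundaries : Ideal A.cycles where
  carrier := {z | ∃ b, A.d b = z}
  add_mem' := by
    rintro _ _ ⟨b, hb⟩ ⟨c, hc⟩
    exact ⟨b + c, by rw [map_add, hb, hc]; rfl⟩
  zero_mem' := ⟨0, by rw [map_zero]; rfl⟩
  smul_mem' := by
    rintro c z ⟨b, hb⟩
    refine ⟨gradeSign A.deg c * b, ?_⟩
    rw [leibniz_sign, A.d_sign_eq_zero c.2, gradeSign_sq, hb, zero_mul, zero_add]
    rfl

instance : A.boundaries.IsTwoSided where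
  mul_mem_of_left := by
    rintro z c ⟨b, hb⟩
    refine ⟨b * c, ?_⟩
    rw [leibniz_sign, show A.d (c : A.carrier) = 0 from c.2, hb, mul_zero, add_zero]
    rfl

/-- The cohomology algebra of a differential graded algebra. -/
abbrev H : Type v := A.cycles ⧸ A.boundaries

/-- The cohomology class of a cocycle, as a linear map. -/
def classOf : A.cycles →ₗ[k] A.H := (Ideal.Quotient.mkₐ k A.boundaries).toLinearMap

/-- The cohomology classes of degree `n`. -/
def degH (n : ℤ) : Submodule k A.H :=
  ((A.deg n).comap A.cycles.val.toLinearMap).map A.classOf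

theorem classOf_mul (a b : A.cycles) : A.classOf (a * b) = A.classOf a * A.classOf b := rfl

theorem classOf_eq_zero {z : A.cycles} : A.classOf z = 0 ↔ z ∈ A.boundaries :=
  Ideal.Quotient.eq_zero_iff_mem

theorem mul_mem_degH {i j : ℤ} {a b : A.H} (ha : a ∈ A.degH i) (hb : b ∈ A.degH j) :
    a * b ∈ A.degH (i + j) := by
  obtain ⟨a, ha, rfl⟩ := ha
  obtain ⟨b, hb, rfl⟩ := hb
  exact ⟨a * b, SetLike.mul_mem_graded (A := A.deg) (Submodule.mem_comap.1 ha)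
    (Submodule.mem_comap.1 hb), A.classOf_mul a b⟩

end DGAlg

/-! ### Hochschild cohomology in cohomological degree three -/

section Hochschild

variable {k : Type u} [Field k] {R : Type v} [Ring R] [Algebra k R]

/-- Linear maps `R ⊗ R ⊗ R → R`. -/
abbrev Trilin (k : Type u) [Field k] (R : Type v) [Ring R] [Algebra k R] : Type v :=
  R ⊗[k] R ⊗[k] R →ₗ[k] R

variable (𝒢 : ℤ → Submodule k R) (t : ℤ)

/-- The Hochschild `(3, t)`-cochains of the algebra `R` graded by `𝒢`. -/
def cochains3 : Submodule k (Trilin k R) where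
  carrier := {m | ∀ i j l : ℤ, ∀ a ∈ 𝒢 i, ∀ b ∈ 𝒢 j, ∀ c ∈ 𝒢 l, m (a ⊗ₜ b ⊗ₜ c) ∈ 𝒢 (i + j + l + t)}
  add_mem' := fun hm hm' i j l a ha b hb c hc =>
    add_mem (hm i j l a ha b hb c hc) (hm' i j l a ha b hb c hc)
  zero_mem' := fun _ _ _ _ _ _ _ _ _ => zero_mem _
  smul_mem' := fun r _ hm i j l a ha b hb c hc =>
    Submodule.smul_mem _ r (hm i j l a ha b hb c hc)

/-- The Hochschild `(3, t)`-cocycles. -/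
def cocycles3 : Submodule k (Trilin k R) where
  carrier := {m | m ∈ cochains3 𝒢 t ∧ ∀ i : ℤ, ∀ a ∈ 𝒢 i, ∀ b c e : R,
    ((t * i).negOnePow : ℤ) • (a * m (b ⊗ₜ c ⊗ₜ e)) - m ((a * b) ⊗ₜ c ⊗ₜ e)
      + m (a ⊗ₜ (b * c) ⊗ₜ e) - m (a ⊗ₜ b ⊗ₜ (c * e)) + m (a ⊗ₜ b ⊗ₜ c) * e = 0}
  add_mem' := by
    rintro m m' ⟨h, hm⟩ ⟨h', hm'⟩
    refine ⟨add_mem h h', fun i a ha b c e => ?_⟩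
    have := congrArg₂ (· + ·) (hm i a ha b c e) (hm' i a ha b c e)
    simp only [add_zero] at this
    rw [← this]
    simp only [LinearMap.add_apply, mul_add, add_mul, smul_add]
    abel
  zero_mem' := ⟨zero_mem _, fun i a _ b c e => by simp⟩
  smul_mem' := by
    rintro r m ⟨h, hm⟩
    refine ⟨Submodule.smul_mem _ r h, fun i a ha b c e => ?_⟩
    have := congrArg (r • ·) (hm i a ha b c e)
    simp only [smul_zero, smul_add, smul_sub] at this
    rw [← this]
    simp only [LinearMap.smul_apply, mul_smul_comm, smul_mul_assoc]
    rw [smul_comm r]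

/-- The Hochschild `(3, t)`-coboundaries: the images `δ g` of the `(2, t)`-cochains `g`. -/
def coboundaries3 : Submodule k (Trilin k R) where
  carrier := {m | ∃ g : R →ₗ[k] R →ₗ[k] R,
    (∀ i j : ℤ, ∀ a ∈ 𝒢 i, ∀ b ∈ 𝒢 j, g a b ∈ 𝒢 (i + j + t)) ∧
    ∀ i : ℤ, ∀ a ∈ 𝒢 i, ∀ b c : R,
      m (a ⊗ₜ b ⊗ₜ c) = ((t * i).negOnePow : ℤ) • (a * g b c) - g (a * b) c + g a (b * c) - g a b * c}
  add_mem' := by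
    rintro m m' ⟨g, hg, h⟩ ⟨g', hg', h'⟩
    refine ⟨g + g', fun i j a ha b hb => add_mem (hg i j a ha b hb) (hg' i j a ha b hb),
      fun i a ha b c => ?_⟩
    simp only [LinearMap.add_apply, h i a ha, h' i a ha, mul_add, add_mul, smul_add]
    abel
  zero_mem' := ⟨0, fun _ _ _ _ _ _ => zero_mem _, fun _ _ _ _ _ => by simp⟩
  smul_mem' := by
    rintro r m ⟨g, hg, h⟩
    refine ⟨r • g, fun i j a ha b hb => Submodule.smul_mem _ r (hg i j a ha b hb),
      fun i a ha b c => ?_⟩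
    simp only [LinearMap.smul_apply, h i a ha, mul_smul_comm, smul_mul_assoc, smul_add, smul_sub]
    rw [smul_comm r]

/-- The Hochschild cohomology group `HH^{3,t}` of the graded algebra `R`. -/
abbrev HH3 : Type v :=
  cocycles3 𝒢 t ⧸ ((coboundaries3 𝒢 t).submoduleOf (cocycles3 𝒢 t)).toAddSubgroup

/-- The class in `HH^{3,t}` of a Hochschild cocycle. -/
def HH3.mk (m : cocycles3 𝒢 t) : HH3 𝒢 t := QuotientAddGroup.mk m

end Hochschild

/-! ### The canonical class of a differential graded algebra -/

namespace DGAlg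

variable {k : Type u} [Field k]

/-- The choices in the construction of the canonical class: a `k`-linear choice `f₁` of
representing cocycles of degree `0`, and a bilinear map `f₂` of degree `-1` with
`d f₂(a, b) = f₁(a b) - f₁(a) f₁(b)`. -/
structure CanonicalChoice (A : DGAlg.{u, v} k) where
  f₁ : A.H →ₗ[k] A.cycles
  f₁_mem : ∀ {n : ℤ} {a : A.H}, a ∈ A.degH n → (f₁ a : A.carrier) ∈ A.deg n
  class_f₁ : ∀ a, A.classOf (f₁ a) = a
  f₂ : A.H →ₗ[k] A.H →ₗ[k] A.carrier
  f₂_mem : ∀ {i j : ℤ} {a b : A.H}, a ∈ A.degH i → b ∈ A.degH j → f₂ a b ∈ A.deg (i + j - 1)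
  d_f₂ : ∀ a b, A.d (f₂ a b) = (f₁ (a * b) : A.carrier) - f₁ a * f₁ b

namespace CanonicalChoice

variable {A : DGAlg.{u, v} k} (F : CanonicalChoice A)

/-- The element `f₂(a,b) f₁(c) - f₂(a,bc) + f₂(ab,c) - (-1)^|a| f₁(a) f₂(b,c)`. -/
def expr (a b c : A.H) : A.carrier :=
  F.f₂ a b * F.f₁ c - F.f₂ a (b * c) + F.f₂ (a * b) c
    - gradeSign A.deg (F.f₁ a : A.carrier) * F.f₂ b c

theorem d_expr (a b c : A.H) : A.d (F.expr a b c) = 0 := by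
  have h1 : A.d (F.f₁ a : A.carrier) = 0 := (F.f₁ a).2
  have h2 : A.d (F.f₁ c : A.carrier) = 0 := (F.f₁ c).2
  simp only [expr, map_add, map_sub, leibniz_sign, F.d_f₂, h2, d_sign_eq_zero A h1, gradeSign_sq,
    mul_assoc]
  noncomm_ring

/-- The class of the cocycle `expr a b c`. -/
def masseyFun (a b c : A.H) : A.H := A.classOf ⟨F.expr a b c, F.d_expr a b c⟩

theorem masseyFun_add {a b c a' b' c' a'' b'' c'' : A.H}
    (h : F.expr a b c = F.expr a' b' c' + F.expr a'' b'' c'') :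
    F.masseyFun a b c = F.masseyFun a' b' c' + F.masseyFun a'' b'' c'' := by
  unfold masseyFun
  rw [← map_add]
  exact congrArg _ (Subtype.ext h)

theorem masseyFun_smul {r : k} {a b c a' b' c' : A.H}
    (h : F.expr a b c = r • F.expr a' b' c') :
    F.masseyFun a b c = r • F.masseyFun a' b' c' := by
  unfold masseyFun
  rw [← map_smul]
  exact congrArg _ (Subtype.ext h)

/-- The trilinear map `m` that sends `(a, b, c)` to the class of the cocycle `expr a b c`. -/
def massey : Trilin k A.H :=
  TensorProduct.lift (TensorProduct.lift (LinearMap.mk₂ k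
    (fun a b =>
      { toFun := F.masseyFun a b
        map_add' := fun c c' => F.masseyFun_add (by
          simp only [expr, map_add, mul_add, Subalgebra.coe_add]
          abel)
        map_smul' := fun r c => F.masseyFun_smul (by
          simp only [expr, map_smul, mul_smul_comm, Subalgebra.coe_smul, smul_add, smul_sub,
            RingHom.id_apply]) })
    (fun a a' b => LinearMap.ext fun c => F.masseyFun_add (by
      simp only [expr, map_add, add_mul, Subalgebra.coe_add, LinearMap.add_apply]
      abel))
    (fun r a b => LinearMap.ext fun c => F.masseyFun_smul (by
      simp only [expr, map_smul, smul_mul_assoc, Subalgebra.coe_smul, LinearMap.smul_apply,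
        smul_add, smul_sub]))
    (fun a b b' => LinearMap.ext fun c => F.masseyFun_add (by
      simp only [expr, map_add, add_mul, mul_add, LinearMap.add_apply]
      abel))
    (fun r a b => LinearMap.ext fun c => F.masseyFun_smul (by
      simp only [expr, map_smul, smul_mul_assoc, mul_smul_comm, LinearMap.smul_apply,
        smul_add, smul_sub]))))

theorem massey_apply (a b c : A.H) :
    F.massey (a ⊗ₜ b ⊗ₜ c) = A.classOf ⟨F.expr a b c, F.d_expr a b c⟩ := rfl

theorem massey_mem_cochains3 : F.massey ∈ cochains3 A.degH (-1) := by
  intro i j l a ha b hb c hc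
  rw [massey_apply]
  refine Submodule.mem_map_of_mem (Submodule.mem_comap.2 ?_)
  change F.expr a b c ∈ A.deg (i + j + l + -1)
  have hab := A.mul_mem_degH ha hb
  have hbc := A.mul_mem_degH hb hc
  have h1 := SetLike.mul_mem_graded (F.f₂_mem ha hb) (F.f₁_mem hc)
  have h2 := F.f₂_mem ha hbc
  have h3 := F.f₂_mem hab hc
  have h4 := SetLike.mul_mem_graded (gradeSign_mem A.deg (F.f₁_mem ha)) (F.f₂_mem hb hc)
  rw [show i + j - 1 + l = i + j + l + -1 by ring] at h1
  rw [show i + (j + l) - 1 = i + j + l + -1 by ring] at h2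
  rw [show i + j + l - 1 = i + j + l + -1 by ring] at h3
  rw [show i + (j + l - 1) = i + j + l + -1 by ring] at h4
  exact sub_mem (add_mem (sub_mem h1 h2) h3) h4

theorem massey_mem_cocycles3 : F.massey ∈ cocycles3 A.degH (-1) := by
  refine ⟨F.massey_mem_cochains3, fun i a ha b c e => ?_⟩
  have hs : ((-1 * i : ℤ).negOnePow : ℤ) • (a * F.massey (b ⊗ₜ c ⊗ₜ e)) =
      A.classOf (⟨gradeSign A.deg (F.f₁ a : A.carrier), A.d_sign_eq_zero (F.f₁ a).2⟩ *
        ⟨F.expr b c e, F.d_expr b c e⟩) := by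
    have h1 : (⟨gradeSign A.deg (F.f₁ a : A.carrier), A.d_sign_eq_zero (F.f₁ a).2⟩ : A.cycles) =
        (i.negOnePow : ℤ) • F.f₁ a :=
      Subtype.ext (gradeSign_of_mem A.deg (F.f₁_mem ha))
    rw [h1, smul_mul_assoc, map_zsmul, A.classOf_mul, F.class_f₁, neg_one_mul, Int.negOnePow_neg]
    rfl
  have he : F.massey (a ⊗ₜ b ⊗ₜ c) * e =
      A.classOf (⟨F.expr a b c, F.d_expr a b c⟩ * F.f₁ e) := by
    rw [A.classOf_mul, F.class_f₁]
    rfl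
  rw [hs, he]
  simp only [massey_apply, ← map_add, ← map_sub]
  refine A.classOf_eq_zero.2 ⟨-(gradeSign A.deg (F.f₂ a b) * F.f₂ c e), ?_⟩
  change _ = gradeSign A.deg (F.f₁ a : A.carrier) * F.expr b c e - F.expr (a * b) c e +
    F.expr a (b * c) e - F.expr a b (c * e) + F.expr a b c * F.f₁ e
  simp only [expr, map_neg, leibniz_sign, d_sign, gradeSign_sq, F.d_f₂, map_sub, gradeSign_mul,
    mul_assoc]
  noncomm_ring

/-- The class in `HH^{3,-1}` of the Hochschild cocycle `massey`. -/
def hochschildClass : HH3 A.degH (-1) := HH3.mk A.degH (-1) ⟨F.massey, F.massey_mem_cocycles3⟩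

end CanonicalChoice

/-- `γ` is the canonical class of `A`: the construction can be carried out, and every choice
of `f₁` and `f₂` leads to `γ`. -/
def IsCanonicalClass (A : DGAlg.{u, v} k) (γ : HH3 A.degH (-1)) : Prop :=
  Nonempty (CanonicalChoice A) ∧ ∀ F : CanonicalChoice A, F.hochschildClass = γ

end DGAlg

/-! ### The endomorphism algebra of a cochain complex -/

section EndAlgebra

open CochainComplex CochainComplex.HomComplex

variable {k : Type u} [Field k] {C : Type*} [Category.{v} C] [Preadditive C] [Linear k C]
  (K : CochainComplex C ℤ)

/-- The homogeneous endomorphisms of degree `n` of `K`, not necessarily compatible with the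
differential. -/
abbrev EndCochain (n : ℤ) : Type v := Cochain K K n

variable {K} in
theorem mk_eq_mk {m n : ℤ} (h : m = n) {a : EndCochain K m} {b : EndCochain K n}
    (hab : ∀ (p q : ℤ) (hp : p + m = q), a.v p q hp = b.v p q (h ▸ hp)) :
    GradedMonoid.mk (A := EndCochain K) m a = GradedMonoid.mk n b := by
  subst h
  exact congrArg _ (Cochain.ext _ _ hab)

instance : GradedMonoid.GOne (EndCochain K) := ⟨Cochain.ofHom (𝟙 K)⟩

/-- The product of `a` and `b` is the composite `a ∘ b`. -/
instance : GradedMonoid.GMul (EndCochain K) := ⟨fun {i j} a b => Cochain.comp b a (add_comm j i)⟩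

instance : GradedMonoid.GMonoid (EndCochain K) where
  one_mul := by
    rintro ⟨n, a⟩
    change GradedMonoid.mk (0 + n) (Cochain.comp a (Cochain.ofHom (𝟙 K)) (add_comm n 0)) =
      GradedMonoid.mk n a
    refine mk_eq_mk (zero_add n) fun p q hp => ?_
    obtain rfl : q = p + n := by omega
    rw [Cochain.comp_v _ _ _ p (p + n) (p + n) rfl (add_zero _)]
    simp
  mul_one := by
    rintro ⟨n, a⟩
    change GradedMonoid.mk (n + 0) (Cochain.comp (Cochain.ofHom (𝟙 K)) a (add_comm 0 n)) =
      GradedMonoid.mk n a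
    refine mk_eq_mk (add_zero n) fun p q hp => ?_
    rw [Cochain.comp_v _ _ _ p p q (add_zero _) (by omega)]
    simp
  mul_assoc := by
    rintro ⟨l, a⟩ ⟨m, b⟩ ⟨n, c⟩
    change GradedMonoid.mk (l + m + n)
        (Cochain.comp c (Cochain.comp b a (add_comm m l)) (add_comm n (l + m))) =
      GradedMonoid.mk (l + (m + n))
        (Cochain.comp (Cochain.comp c b (add_comm n m)) a (add_comm (m + n) l))
    refine mk_eq_mk (add_assoc l m n) fun p q hp => ?_
    rw [Cochain.comp_v _ _ _ p (p + n) q rfl (by omega),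
      Cochain.comp_v _ _ _ (p + n) (p + n + m) q rfl (by omega),
      Cochain.comp_v _ _ _ p (p + n + m) q (by omega) (by omega),
      Cochain.comp_v _ _ _ p (p + n) (p + n + m) rfl rfl, Category.assoc]

instance : DirectSum.GRing (EndCochain K) where
  mul_zero _ := Cochain.zero_comp _ _
  zero_mul _ := Cochain.comp_zero _ _
  mul_add _ _ _ := Cochain.add_comp _ _ _ _
  add_mul _ _ _ := Cochain.comp_add _ _ _ _
  natCast n := n • Cochain.ofHom (𝟙 K)
  natCast_zero := zero_smul _ _
  natCast_succ _ := succ_nsmul _ _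
  intCast n := n • Cochain.ofHom (𝟙 K)
  intCast_ofNat _ := natCast_zsmul _ _
  intCast_negSucc_ofNat _ := negSucc_zsmul _ _

instance : DirectSum.GAlgebra k (EndCochain K) where
  toFun := (LinearMap.toSpanSingleton k (EndCochain K 0) (Cochain.ofHom (𝟙 K))).toAddMonoidHom
  map_one := one_smul k (Cochain.ofHom (𝟙 K))
  map_mul r s := by
    change GradedMonoid.mk 0 ((r * s) • Cochain.ofHom (𝟙 K)) = GradedMonoid.mk (0 + 0)
      (Cochain.comp (s • Cochain.ofHom (𝟙 K)) (r • Cochain.ofHom (𝟙 K)) (add_comm 0 0))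
    refine mk_eq_mk (add_zero 0).symm fun p q hp => ?_
    obtain rfl : p = q := by omega
    rw [Cochain.comp_v _ _ _ p p p (add_zero _) (add_zero _)]
    simp [mul_smul]
  commutes := by
    rintro r ⟨n, a⟩
    change GradedMonoid.mk (0 + n) (Cochain.comp a (r • Cochain.ofHom (𝟙 K)) (add_comm n 0)) =
      GradedMonoid.mk (n + 0) (Cochain.comp (r • Cochain.ofHom (𝟙 K)) a (add_comm 0 n))
    refine mk_eq_mk (by omega) fun p q hp => ?_
    obtain rfl : q = p + n := by omega
    rw [Cochain.comp_v _ _ _ p (p + n) (p + n) rfl (add_zero _),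
      Cochain.comp_v _ _ _ p p (p + n) (add_zero _) rfl]
    simp
  smul_def := by
    rintro r ⟨n, a⟩
    change GradedMonoid.mk n (r • a) =
      GradedMonoid.mk (0 + n) (Cochain.comp a (r • Cochain.ofHom (𝟙 K)) (add_comm n 0))
    refine mk_eq_mk (zero_add n).symm fun p q hp => ?_
    obtain rfl : q = p + n := by omega
    rw [Cochain.comp_v _ _ _ p (p + n) (p + n) rfl (add_zero _)]
    simp

/-- The differential of the endomorphism algebra. -/
def endD : (DirectSum ℤ (EndCochain K)) →ₗ[k] (DirectSum ℤ (EndCochain K)) :=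
  DirectSum.toModule k ℤ _ fun n =>
    DirectSum.lof k ℤ (EndCochain K) (n + 1) ∘ₗ δ_hom k K K n (n + 1)

/-- The homogeneous elements of degree `n` of the endomorphism algebra. -/
def endDeg (n : ℤ) : Submodule k (DirectSum ℤ (EndCochain K)) :=
  LinearMap.range (DirectSum.lof k ℤ (EndCochain K) n)

theorem lof_mul_lof {i j n : ℤ} (h : j + i = n) (a : EndCochain K i) (b : EndCochain K j) :
    DirectSum.lof k ℤ (EndCochain K) i a * DirectSum.lof k ℤ (EndCochain K) j b =
      DirectSum.lof k ℤ (EndCochain K) n (Cochain.comp b a h) := by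
  obtain rfl : n = i + j := by omega
  exact DirectSum.of_mul_of a b

theorem endD_lof {n n' : ℤ} (h : n + 1 = n') (a : EndCochain K n) :
    endD (k := k) K (DirectSum.lof k ℤ (EndCochain K) n a) =
      DirectSum.lof k ℤ (EndCochain K) n' (δ n n' a) := by
  subst h
  exact DirectSum.toModule_lof ..

instance : SetLike.GradedMonoid (endDeg (k := k) K) where
  one_mem := ⟨Cochain.ofHom (𝟙 K), rfl⟩
  mul_mem := by
    rintro i j _ _ ⟨a, rfl⟩ ⟨b, rfl⟩
    exact ⟨_, (lof_mul_lof K (add_comm j i) a b).symm⟩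

/-- The inclusion of the degree `n` part. -/
def toEndDeg (n : ℤ) : EndCochain K n →ₗ[k] endDeg (k := k) K n :=
  (DirectSum.lof k ℤ (EndCochain K) n).codRestrict _ fun a => ⟨a, rfl⟩

instance : GradedAlgebra (endDeg (k := k) K) where
  toDecomposition := DirectSum.Decomposition.ofLinearMap _
    (DirectSum.toModule k ℤ _ fun n =>
      DirectSum.lof k ℤ (fun n => endDeg (k := k) K n) n ∘ₗ toEndDeg K n)
    (by
      refine DirectSum.linearMap_ext k fun n => LinearMap.ext fun a => ?_
      rw [LinearMap.comp_apply, LinearMap.comp_apply, DirectSum.toModule_lof,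
        LinearMap.comp_apply, DirectSum.coeLinearMap_lof]
      rfl)
    (by
      refine DirectSum.linearMap_ext k fun n => LinearMap.ext ?_
      rintro ⟨_, a, rfl⟩
      rw [LinearMap.comp_apply, LinearMap.comp_apply, DirectSum.coeLinearMap_lof,
        DirectSum.toModule_lof]
      rfl)

theorem endD_endD : endD (k := k) K ∘ₗ endD K = 0 := by
  refine DirectSum.linearMap_ext k fun n => LinearMap.ext fun a => ?_
  rw [LinearMap.comp_apply, LinearMap.comp_apply, endD_lof K rfl, endD_lof K rfl, δ_δ, map_zero]
  rfl

theorem endD_lof_mul {n : ℤ} (a : EndCochain K n) (b : DirectSum ℤ (EndCochain K)) :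
    endD (k := k) K (DirectSum.lof k ℤ (EndCochain K) n a * b) =
      endD (k := k) K (DirectSum.lof k ℤ (EndCochain K) n a) * b +
        (n.negOnePow : ℤ) • (DirectSum.lof k ℤ (EndCochain K) n a * endD (k := k) K b) := by
  induction b using DirectSum.induction_on with
  | zero => simp
  | of j b =>
    rw [← DirectSum.lof_eq_of k, lof_mul_lof K (add_comm j n), endD_lof K rfl, endD_lof K rfl,
      endD_lof K rfl, lof_mul_lof K (show j + (n + 1) = n + j + 1 by ring),
      lof_mul_lof K (show (j + 1) + n = n + j + 1 by ring),
      δ_comp b a (add_comm j n) (j + 1) (n + 1) (n + j + 1) rfl rfl rfl, map_add,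
      Units.smul_def, map_zsmul]
  | add b c hb hc => rw [mul_add, map_add, hb, hc, map_add, mul_add, mul_add, smul_add]; abel

variable (k) in
/-- The endomorphism differential graded algebra of `K`. -/
def endDGA : DGAlg k where
  carrier := DirectSum ℤ (EndCochain K)
  deg := endDeg K
  d := endD K
  d_mem := by
    rintro n _ ⟨a, rfl⟩
    exact ⟨_, (endD_lof K rfl a).symm⟩
  d_d a := LinearMap.congr_fun (endD_endD K) a
  leibniz := by
    rintro n _ b ⟨a, rfl⟩
    exact endD_lof_mul K a b

end EndAlgebra

/-! ### Tate cohomology -/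

section Tate

variable (k : Type u) [Field k] (G : Type) [Group G]

/-- A complete projective resolution of the trivial `kG`-module `k`: an exact complex of
projective modules (`P_n` is in cohomological degree `-n`) whose differential `P_0 → P_{-1}`
factors as a surjection `ε` onto `k` followed by an injection. -/
structure CompleteResolution where
  complex : CochainComplex (Rep.{u} k G) ℤ
  projective : ∀ n, Projective (complex.X n)
  acyclic : complex.Acyclic
  ε : complex.X 0 ⟶ Rep.trivial k G k
  η : Rep.trivial k G k ⟶ complex.X 1
  epi_ε : Epi ε
  mono_η : Mono η
  fac : ε ≫ η = complex.d 0 1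

variable {k G}

namespace CompleteResolution

variable (P : CompleteResolution k G)

/-- The endomorphism differential graded algebra of a complete resolution. -/
abbrev dga : DGAlg.{u, u} k := endDGA k P.complex

/-- The Tate cohomology ring. -/
abbrev tate : Type u := P.dga.H

/-- The class `c` has degree `1`, and the homomorphism `G → k` that corresponds to `c` has the
value `r` at `g`. The homomorphism is computed from a cocycle `z` representing `c`: if
`v ∈ P_1` has boundary `g u - u` with `u ∈ P_0`, `ε u = 1`, then its value at `g` is
`ε (z v)`. -/
def HasValueAt (c : P.tate) (g : G) (r : k) : Prop :=
  ∃ (z : CochainComplex.HomComplex.Cochain P.complex P.complex 1)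
    (hz : DirectSum.lof k ℤ (EndCochain P.complex) 1 z ∈ P.dga.cycles),
    P.dga.classOf ⟨DirectSum.lof k ℤ (EndCochain P.complex) 1 z, hz⟩ = c ∧
    ∀ (u : P.complex.X 0) (v : P.complex.X (-1)),
      (P.complex.d (-1) 0).hom v = (P.complex.X 0).ρ g u - u →
        P.ε.hom ((z.v (-1) 0 (by norm_num)).hom v) = r * P.ε.hom u

end CompleteResolution

end Tate

/-! ### The explicit cocycle for the quaternion group -/

section Explicit

/-- Labels for the elements `1, x, y, x², y², x²y`. -/
inductive Label : Type
  | one | x | y | xx | yy | xxy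

variable {k : Type u} [Field k] {R : Type v} [Ring R] [Algebra k R] (x y : R)

/-- The elements `1, x, y, x², y², x²y`. -/
def Label.elt : Label → R
  | .one => 1
  | .x => x
  | .y => y
  | .xx => x ^ 2
  | .yy => y ^ 2
  | .xxy => x ^ 2 * y

/-- The values of `m` on triples of the elements `1, x, y, x², y², x²y`. -/
def mValue : Label → Label → Label → R
  | .x, .y, .x => x * y
  | .x, .y, .xx => x ^ 2 * y
  | .xx, .y, .x => x ^ 2 * y
  | _, _, _ => 0

/-- The correction table. -/
def corr : Label → Label → R
  | .x, .y => x + y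
  | .x, .xx => x ^ 2
  | .x, .yy => x ^ 2 + y ^ 2
  | .x, .xxy => x ^ 2 * y
  | .y, .x => x + y
  | .y, .yy => y ^ 2
  | .xx, .x => x ^ 2
  | .yy, .x => x ^ 2 + y ^ 2
  | .yy, .y => y ^ 2
  | .xxy, .x => x ^ 2 * y
  | _, _ => 0

/-- The formulas that define the cocycle `m`. -/
structure QuaternionFormula (s : Rˣ) (m : Trilin k R) : Prop where
  basic : ∀ a b c : Label, m (a.elt x y ⊗ₜ b.elt x y ⊗ₜ c.elt x y) = mValue x y a b c
  shift : ∀ a b c : Label, m ((s * a.elt x y) ⊗ₜ b.elt x y ⊗ₜ c.elt x y) =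
    s * m (a.elt x y ⊗ₜ b.elt x y ⊗ₜ c.elt x y) + s * a.elt x y * corr x y b c
  periodic : ∀ (i j l : ℤ) (a b c : R),
    m ((↑(s ^ (2 * i)) * a) ⊗ₜ (↑(s ^ j) * b) ⊗ₜ (↑(s ^ l) * c)) =
      ↑(s ^ (2 * i + j + l)) * m (a ⊗ₜ b ⊗ₜ c)

/-- The standard generators of the Tate cohomology ring of the quaternion group of order `8`
with `g = a 1` and `h = xa 0`: the classes `x, y` of degree `1` with `x(g) = 1`, `x(h) = 0`,
`y(g) = 0`, `y(h) = 1`, and an invertible class `s` of degree `4`. The relations and the basis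
say that the ring is `k[x, y, s, s⁻¹] / (x² + y² = xy, y³ = 0)`. -/
structure StandardGenerators {k : Type u} [Field k]
    (P : CompleteResolution k (QuaternionGroup 2)) (x y : P.tate) (s : P.tateˣ) : Prop where
  x_g : P.HasValueAt x (.a 1) 1
  x_h : P.HasValueAt x (.xa 0) 0
  y_g : P.HasValueAt y (.a 1) 0
  y_h : P.HasValueAt y (.xa 0) 1
  s_mem : (s : P.tate) ∈ P.dga.degH 4
  xy_comm : x * y = y * x
  sx_comm : s * x = x * s
  sy_comm : s * y = y * s
  rel_xy : x ^ 2 + y ^ 2 = x * y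
  rel_y : y ^ 3 = 0
  linearIndependent : LinearIndependent k fun b : Label × ℤ => b.1.elt x y * ↑(s ^ b.2)
  span : Submodule.span k (Set.range fun b : Label × ℤ => b.1.elt x y * ↑(s ^ b.2)) = ⊤

end Explicit

end TateQ
end

/-!
The complex `minimalComplex k` is the `4`-periodic minimal complete resolution of the trivial module
of the quaternion group, with free terms of rank `1, 2, 2, 1`. Its generators are dual to the classes
`b sⁱ`, where `b` is one of `1, x, y, x², y², x²y`; accordingly they carry the labels `b`, and a
homogeneous equivariant endomorphism of the complex that commutes with the periodicity is a matrix
`M` over the group algebra, with rows and columns indexed by the labels. The differential is such a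
matrix too, and its augmentation is zero. Hence the class of a cocycle can be read off from the
augmentation of its matrix in the row `1`.

The canonical class is computed from explicit matrices: cocycles `cocycleMat b` that represent the
elements `b`, and homotopies `homotopyMat p b c` with boundary the difference between the product of
two such cocycles and the cocycle that represents the product. On the basis, `f₁` sends `b sⁱ` to
`cocycleMat b`, and `f₂` sends `(b sⁱ, c sʲ)` to `homotopyMat p b c`, where `p` is the parity of `i`.
For odd `i` the homotopy is changed by the cocycle `b * u c`, with `u x = u y = 1`, `u (x² y) = x²`
and `u = 0` at `1, x², y²`; this produces the correction table
`C(b, c) = b * u c + u (b * c) + u b * c`. The homotopies are selected such that the Hochschild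
cocycle of this choice is equal to `m`, not only cohomologous to it (`MatrixModel.massey_basis`). All
matrices have entries in `𝔽₂[Q₈]`, so the identities between them are finite computations.

For an arbitrary complete resolution `P`, comparison maps show that the minimal resolution is a direct
summand of `P` with contractible complement (`nonempty_splitting`); minimality makes the composite
on the minimal resolution an isomorphism, since it is the identity on fixed vectors. Conjugation with
the splitting turns matrices into endomorphisms of `P`. It is strictly multiplicative and commutes
with the differentials, so the computation carries over to `P`; the values of a cocycle at the
generators of the summand decide whether it is a coboundary (`Splitting.exists_δ_eq_of_value_eq_zero`).
`MatrixModel` records what is needed for the rest.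

That the canonical class does not depend on the choices is a general fact on differential graded
algebras over a field (`DGAlg.CanonicalChoice.massey_sub_mem_coboundaries3`). The class is nonzero
because a linear functional on the values in degree `(1, 1, 1)` annihilates all coboundaries of maps
of degree `-1`, but not `m` (`MatrixModel.massey_notMem_coboundaries3`).
-/

noncomputable section

namespace TateQ

/-! ### Independence of the canonical class of the choices -/

/-- Every linear map over a field has a generalized inverse, which is a section if the map is
surjective and a retraction if it is injective. -/
theorem exists_pseudoinverse {k V W : Type*} [Field k] [AddCommGroup V] [Module k V]
    [AddCommGroup W] [Module k W] (f : V →ₗ[k] W) : ∃ s : W →ₗ[k] V, ∀ v, f (s (f v)) = f v := by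
  obtain ⟨r, hr⟩ := f.rangeRestrict.exists_rightInverse_of_surjective
    (LinearMap.range_eq_top.2 f.surjective_rangeRestrict)
  obtain ⟨s, hs⟩ := LinearMap.exists_extend r
  refine ⟨s, fun v => ?_⟩
  have h1 : s (f v) = r (f.rangeRestrict v) := LinearMap.congr_fun hs (f.rangeRestrict v)
  rw [h1]
  exact congrArg Subtype.val (LinearMap.congr_fun hr (f.rangeRestrict v))

namespace DGAlg

variable {k : Type u} [Field k] (A : DGAlg.{u, v} k)

/-- Over a field the coboundaries of a differential graded algebra have primitives that depend
linearly on them and are homogeneous if they are. -/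
theorem exists_graded_primitive : ∃ σ : A.carrier →ₗ[k] A.carrier,
    (∀ {n : ℤ} {a : A.carrier}, a ∈ A.deg n → σ a ∈ A.deg (n - 1)) ∧
      ∀ b, A.d (σ (A.d b)) = A.d b := by
  have key : ∀ n : ℤ, ∃ s : A.deg n →ₗ[k] A.deg (n - 1),
      ∀ b ∈ A.deg (n - 1), ∀ h : A.d b ∈ A.deg n, A.d (s ⟨A.d b, h⟩ : A.carrier) = A.d b := by
    intro n
    have hd : ∀ b ∈ A.deg (n - 1), A.d b ∈ A.deg n := fun b hb => by
      have := A.d_mem hb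
      rwa [sub_add_cancel] at this
    let dn : A.deg (n - 1) →ₗ[k] A.deg n := A.d.restrict hd
    obtain ⟨s, hs⟩ := exists_pseudoinverse dn
    exact ⟨s, fun b hb _ => congrArg Subtype.val (hs ⟨b, hb⟩)⟩
  choose s hs using key
  let σ : A.carrier →ₗ[k] A.carrier :=
    (DirectSum.toModule k ℤ A.carrier fun n => (A.deg (n - 1)).subtype ∘ₗ s n) ∘ₗ
      (DirectSum.decomposeLinearEquiv A.deg).toLinearMap
  have hσ : ∀ {n : ℤ} {a : A.carrier} (ha : a ∈ A.deg n), σ a = s n ⟨a, ha⟩ := by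
    intro n a ha
    have h : DirectSum.decomposeLinearEquiv A.deg a =
        DirectSum.lof k ℤ (fun i => A.deg i) n ⟨a, ha⟩ := DirectSum.decompose_of_mem A.deg ha
    simp only [σ, LinearMap.comp_apply, LinearEquiv.coe_coe, h, DirectSum.toModule_lof,
      Submodule.subtype_apply]
  refine ⟨σ, fun ha => by rw [hσ ha]; exact Submodule.coe_mem _, fun b => ?_⟩
  induction b using DirectSum.Decomposition.inductionOn A.deg with
  | zero => simp
  | @homogeneous i x =>
    rw [hσ (A.d_mem x.2)]
    exact hs (i + 1) x (by rw [add_sub_cancel_right]; exact x.2) _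
  | add a b ha hb => simp only [map_add, ha, hb]

namespace CanonicalChoice

variable {A} (F F' : CanonicalChoice A)

/-- Two choices give cohomologous Hochschild cocycles. With `u` a homogeneous linear map such that
`d u = f₁' - f₁`, the map `w = f₂' - f₂ - u(ab) + u(a) f₁'(b) + (-1)^|a| f₁(a) u(b)` has
values in cocycles, and the two Hochschild cocycles differ by the coboundary of its class. -/
theorem massey_sub_mem_coboundaries3 :
    F'.massey - F.massey ∈ coboundaries3 A.degH (-1) := by
  obtain ⟨σ, hσ, hd⟩ := A.exists_graded_primitive
  let c₁ : A.H →ₗ[k] A.carrier := A.cycles.val.toLinearMap ∘ₗ F.f₁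
  let c₁' : A.H →ₗ[k] A.carrier := A.cycles.val.toLinearMap ∘ₗ F'.f₁
  let s₁ : A.H →ₗ[k] A.carrier := gradeSign A.deg ∘ₗ c₁
  let U : A.H →ₗ[k] A.carrier := σ ∘ₗ (c₁' - c₁)
  have hU : ∀ a, A.d (U a) = (F'.f₁ a : A.carrier) - F.f₁ a := by
    intro a
    have h0 : F'.f₁ a - F.f₁ a ∈ A.boundaries := by
      rw [← A.classOf_eq_zero, map_sub, F.class_f₁, F'.class_f₁, sub_self]
    obtain ⟨b, hb⟩ := h0
    have hb' : A.d b = c₁' a - c₁ a := hb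
    change A.d (σ (c₁' a - c₁ a)) = c₁' a - c₁ a
    rw [← hb', hd]
  have hUm : ∀ {n : ℤ} {a : A.H}, a ∈ A.degH n → U a ∈ A.deg (n - 1) := fun ha =>
    hσ (sub_mem (F'.f₁_mem ha) (F.f₁_mem ha))
  let w : A.H →ₗ[k] A.H →ₗ[k] A.carrier :=
    F'.f₂ - F.f₂ - (LinearMap.mul k A.H).compr₂ U + (LinearMap.mul k A.carrier).compl₁₂ U c₁' +
      (LinearMap.mul k A.carrier).compl₁₂ s₁ U
  have hw : ∀ a b, w a b = F'.f₂ a b - F.f₂ a b - U (a * b) + U a * F'.f₁ b +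
      gradeSign A.deg (F.f₁ a : A.carrier) * U b := fun a b => rfl
  have hdw : ∀ a b, A.d (w a b) = 0 := by
    intro a b
    have h1 : A.d (F.f₁ a : A.carrier) = 0 := (F.f₁ a).2
    have h2 : A.d (F'.f₁ b : A.carrier) = 0 := (F'.f₁ b).2
    simp only [hw, map_add, map_sub, leibniz_sign, F.d_f₂, F'.d_f₂, h2, d_sign_eq_zero A h1,
      gradeSign_sq, hU]
    noncomm_ring
  have hwm : ∀ i j : ℤ, ∀ a ∈ A.degH i, ∀ b ∈ A.degH j, w a b ∈ A.deg (i + j + -1) := by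
    intro i j a ha b hb
    have h1 := F'.f₂_mem ha hb
    have h2 := F.f₂_mem ha hb
    have h3 := hUm (A.mul_mem_degH ha hb)
    have h4 := SetLike.mul_mem_graded (hUm ha) (F'.f₁_mem hb)
    have h5 := SetLike.mul_mem_graded (gradeSign_mem A.deg (F.f₁_mem ha)) (hUm hb)
    rw [show i - 1 + j = i + j - 1 by ring] at h4
    rw [show i + (j - 1) = i + j - 1 by ring] at h5
    rw [hw, ← sub_eq_add_neg]
    exact add_mem (add_mem (sub_mem (sub_mem h1 h2) h3) h4) h5
  let g₀ : A.H →ₗ[k] A.H →ₗ[k] A.cycles := LinearMap.mk₂ k (fun a b => -⟨w a b, hdw a b⟩)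
    (fun a a' b => Subtype.ext (by simp [map_add]; abel))
    (fun r a b => Subtype.ext (by simp))
    (fun a b b' => Subtype.ext (by simp [map_add]; abel))
    (fun r a b => Subtype.ext (by simp))
  have hg₀ : ∀ a b, g₀ a b = -⟨w a b, hdw a b⟩ := fun a b => rfl
  refine ⟨g₀.compr₂ A.classOf, fun i j a ha b hb => ?_, fun i a ha b c => ?_⟩
  · exact Submodule.mem_map_of_mem (Submodule.mem_comap.2 (neg_mem (hwm i j a ha b hb)))
  · have hs : ((-1 * i : ℤ).negOnePow : ℤ) • (a * A.classOf (g₀ b c)) =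
        A.classOf (⟨gradeSign A.deg (F.f₁ a : A.carrier), A.d_sign_eq_zero (F.f₁ a).2⟩ *
          g₀ b c) := by
      have h1 : (⟨gradeSign A.deg (F.f₁ a : A.carrier), A.d_sign_eq_zero (F.f₁ a).2⟩ :
          A.cycles) = (i.negOnePow : ℤ) • F.f₁ a :=
        Subtype.ext (gradeSign_of_mem A.deg (F.f₁_mem ha))
      rw [h1, smul_mul_assoc, map_zsmul, A.classOf_mul, F.class_f₁, neg_one_mul,
        Int.negOnePow_neg]
    have he : A.classOf (g₀ a b) * c = A.classOf (g₀ a b * F'.f₁ c) := by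
      rw [A.classOf_mul, F'.class_f₁]
    simp only [LinearMap.compr₂_apply]
    rw [hs, he]
    simp only [LinearMap.sub_apply, massey_apply, ← map_add, ← map_sub]
    rw [← sub_eq_zero, ← map_sub, A.classOf_eq_zero]
    have hc : A.d (F.f₁ a : A.carrier) = 0 := (F.f₁ a).2
    have hc' : A.d (F'.f₁ c : A.carrier) = 0 := (F'.f₁ c).2
    refine ⟨gradeSign A.deg (F.f₂ a b) * U c + gradeSign A.deg (U a) * F'.f₂ b c, ?_⟩
    change _ = F'.expr a b c - F.expr a b c -
      (gradeSign A.deg (F.f₁ a : A.carrier) * -w b c - -w (a * b) c + -w a (b * c) -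
        -w a b * F'.f₁ c)
    simp only [expr, hw, map_add, map_sub, leibniz_sign, d_sign, gradeSign_sq, gradeSign_mul,
      F.d_f₂, F'.d_f₂, hU, mul_assoc]
    noncomm_ring

end CanonicalChoice

end DGAlg

/-! ### Homotopies between acyclic complexes of projective and injective objects -/

section Comparison

open CochainComplex CochainComplex.HomComplex

variable {C : Type*} [Category.{v} C] [Abelian C] {K L : CochainComplex C ℤ}

theorem exists_desc_of_acyclic (hK : K.Acyclic) {p q r : ℤ} (hpq : p + 1 = q) (hqr : q + 1 = r)
    {I : C} [Injective I] (f : K.X q ⟶ I) (hf : K.d p q ≫ f = 0) :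
    ∃ c : K.X r ⟶ I, K.d q r ≫ c = f := by
  have h := (K.exactAt_iff' p q r (by simp; omega) (by simp; omega)).1 (hK q)
  exact ⟨h.descToInjective f hf, h.comp_descToInjective f hf⟩

theorem exists_lift_of_acyclic (hL : L.Acyclic) {p q r : ℤ} (hpq : p + 1 = q) (hqr : q + 1 = r)
    {Q : C} [Projective Q] (f : Q ⟶ L.X q) (hf : f ≫ L.d q r = 0) :
    ∃ c : Q ⟶ L.X p, c ≫ L.d p q = f := by
  have h := (L.exactAt_iff' p q r (by simp; omega) (by simp; omega)).1 (hL q)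
  exact ⟨h.liftFromProjective f hf, h.liftFromProjective_comp f hf⟩

/-- A cocycle that vanishes at `p` can be made zero at `p + 1` by a coboundary. -/
theorem exists_homotopy_succ (hK : K.Acyclic) (hI : ∀ i, Injective (L.X i)) {m n : ℤ}
    (hmn : m + 1 = n) (z : Cochain K L n) (hz : δ n (n + 1) z = 0) (p : ℤ)
    (h0 : ∀ q (h : p + n = q), z.v p q h = 0) :
    ∃ w : Cochain K L m, (∀ r s (h : r + m = s), r ≠ p + 2 → w.v r s h = 0) ∧
      ∀ q (h : p + 1 + n = q), (z - δ m n w).v (p + 1) q h = 0 := by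
  have h1 := Cochain.congr_v hz p (p + 1 + n) (by omega)
  rw [δ_v n (n + 1) rfl z p (p + 1 + n) (by omega) (p + n) (p + 1) (by omega) rfl, h0,
    Limits.zero_comp, zero_add, Cochain.zero_v, smul_eq_zero_iff_eq] at h1
  have := hI (p + 1 + n)
  obtain ⟨c, hc⟩ := exists_desc_of_acyclic hK rfl (show p + 1 + 1 = p + 2 by ring) _ h1
  refine ⟨n.negOnePow • Cochain.single c m, fun r s h hr => ?_, fun q h => ?_⟩
  · rw [Cochain.units_smul_v, Cochain.single_v_eq_zero _ _ _ _ _ hr, smul_zero]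
  · obtain rfl : q = p + 1 + n := by omega
    rw [Cochain.sub_v, δ_units_smul, Cochain.units_smul_v,
      Cochain.δ_single c m n hmn (p + 1) (p + 1 + n + 1) (by omega) rfl, Cochain.add_v,
      Cochain.single_v_eq_zero _ _ _ _ _ (by omega), zero_add, Cochain.units_smul_v,
      Cochain.single_v, smul_smul, Int.units_mul_self, one_smul, hc, sub_self]

/-- A cocycle that vanishes at `p` can be made zero at `p - 1` by a coboundary. -/
theorem exists_homotopy_pred (hL : L.Acyclic) (hP : ∀ i, Projective (K.X i)) {m n : ℤ}
    (hmn : m + 1 = n) (z : Cochain K L n) (hz : δ n (n + 1) z = 0) (p : ℤ)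
    (h0 : ∀ q (h : p + n = q), z.v p q h = 0) :
    ∃ w : Cochain K L m, (∀ r s (h : r + m = s), r ≠ p - 1 → w.v r s h = 0) ∧
      ∀ q (h : p - 1 + n = q), (z - δ m n w).v (p - 1) q h = 0 := by
  have h1 := Cochain.congr_v hz (p - 1) (p + n) (by omega)
  rw [δ_v n (n + 1) rfl z (p - 1) (p + n) (by omega) (p - 1 + n) p (by omega) (by omega), h0,
    Limits.comp_zero, smul_zero, add_zero, Cochain.zero_v] at h1
  have := hP (p - 1)
  obtain ⟨c, hc⟩ := exists_lift_of_acyclic hL (show p - 1 + m + 1 = p - 1 + n by omega)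
    (show p - 1 + n + 1 = p + n by omega) _ h1
  refine ⟨Cochain.single c m, fun r s h hr => Cochain.single_v_eq_zero _ _ _ _ _ hr,
    fun q h => ?_⟩
  obtain rfl : q = p - 1 + n := by omega
  rw [Cochain.sub_v, Cochain.δ_single c m n hmn (p - 1 - 1) (p - 1 + n) (by omega) (by omega),
    Cochain.add_v, Cochain.single_v, Cochain.units_smul_v,
    Cochain.single_v_eq_zero _ _ _ _ _ (by omega), smul_zero, add_zero, hc, sub_self]

/-- A cocycle of degree `n` between acyclic complexes, the first one of projective and the second
one of injective objects, is a coboundary if one of its components vanishes. A primitive is built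
outwards from that component, on the right from injectivity and on the left from projectivity, and
the two components of the primitive next to it can be taken to be zero. -/
theorem exists_homotopy (hK : K.Acyclic) (hL : L.Acyclic) (hP : ∀ i, Projective (K.X i))
    (hI : ∀ i, Injective (L.X i)) {m n : ℤ} (hmn : m + 1 = n) (z : Cochain K L n)
    (hz : δ n (n + 1) z = 0) (p₀ : ℤ) (h0 : ∀ q (h : p₀ + n = q), z.v p₀ q h = 0) :
    ∃ w : Cochain K L m, δ m n w = z ∧
      ∀ p q (h : p + m = q), p = p₀ ∨ p = p₀ + 1 → w.v p q h = 0 := by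
  -- `Good N w`: the homotopy relation holds for `w` at the places of distance at most `N`.
  let Good (N : ℕ) (w : Cochain K L m) : Prop :=
    ∀ p q (h : p + n = q), p₀ - N ≤ p → p ≤ p₀ + N → (z - δ m n w).v p q h = 0
  have step : ∀ (N : ℕ) (w : {w : Cochain K L m // Good N w}),
      ∃ w' : {w : Cochain K L m // Good (N + 1) w},
        ∀ p q (h : p + m = q), p₀ - N ≤ p → p ≤ p₀ + N + 1 → w'.1.v p q h = w.1.v p q h := by
    rintro N ⟨w, hw⟩
    have hcoc : ∀ w : Cochain K L m, δ n (n + 1) (z - δ m n w) = 0 := fun w => by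
      rw [δ_sub, hz, δ_δ, sub_zero]
    obtain ⟨a, ha, ha'⟩ := exists_homotopy_succ hK hI hmn (z - δ m n w) (hcoc w) (p₀ + N)
      fun q h => hw _ q h (by omega) (by omega)
    obtain ⟨b, hb, hb'⟩ := exists_homotopy_pred hL hP hmn (z - δ m n w) (hcoc w) (p₀ - N)
      fun q h => hw _ q h (by omega) (by omega)
    have hδ : ∀ (c : Cochain K L m) (p q : ℤ) (h : p + n = q),
        (∀ r s (h : r + m = s), r = p ∨ r = p + 1 → c.v r s h = 0) → (δ m n c).v p q h = 0 := by
      intro c p q h hc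
      rw [δ_v m n hmn c p q h (q - 1) (p + 1) rfl rfl, hc _ _ _ (Or.inl rfl),
        hc _ _ _ (Or.inr rfl), Limits.zero_comp, Limits.comp_zero, smul_zero, add_zero]
    refine ⟨⟨w + a + b, fun p q h h1 h2 => ?_⟩, fun p q h h1 h2 => ?_⟩
    · have e : z - δ m n (w + a + b) = z - δ m n w - δ m n a - δ m n b := by
        rw [δ_add, δ_add]; abel
      push_cast at h1 h2
      rw [e, Cochain.sub_v]
      rcases eq_or_ne p (p₀ + N + 1) with rfl | hp
      · rw [ha' q h, hδ b _ _ _ fun r s h hr => hb r s h (by omega), sub_zero]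
      rcases eq_or_ne p (p₀ - N - 1) with rfl | hp'
      · have := hb' q h
        rw [Cochain.sub_v] at this
        rw [Cochain.sub_v, hδ a _ _ _ fun r s h hr => ha r s h (by omega), sub_zero, this]
      · rw [Cochain.sub_v, hδ a _ _ _ fun r s h hr => ha r s h (by omega),
          hδ b _ _ _ fun r s h hr => hb r s h (by omega), sub_zero, sub_zero]
        exact hw p q h (by omega) (by omega)
    · change (w + a + b).v p q h = w.v p q h
      rw [Cochain.add_v, Cochain.add_v, ha p q h (by omega), hb p q h (by omega), add_zero,
        add_zero]
  -- The components of the successive approximations stabilize, so they have a limit.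
  choose next hnext using step
  let W : ∀ N : ℕ, {w : Cochain K L m // Good N w} := fun N =>
    Nat.rec ⟨0, fun p q h h1 h2 => by
      obtain rfl : p = p₀ := by simp at h1 h2; omega
      rw [δ_zero, sub_zero, h0]⟩ (fun N w => next N w) N
  have hW : ∀ (N M : ℕ), N ≤ M → ∀ p q (h : p + m = q), p₀ - N ≤ p → p ≤ p₀ + N + 1 →
      (W M).1.v p q h = (W N).1.v p q h := by
    intro N M hNM
    induction M, hNM using Nat.le_induction with
    | base => exact fun _ _ _ _ _ => rfl
    | succ M hNM ih =>
      intro p q h h1 h2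
      rw [← ih p q h h1 h2]
      exact hnext M (W M) p q h (by omega) (by omega)
  let w : Cochain K L m := Cochain.mk fun p q h => (W (p - p₀).natAbs).1.v p q h
  have hw : ∀ (N : ℕ) p q (h : p + m = q), p₀ - N ≤ p → p ≤ p₀ + N →
      w.v p q h = (W N).1.v p q h := by
    intro N p q h h1 h2
    exact (hW (p - p₀).natAbs N (by omega) p q h (by omega) (by omega)).symm
  refine ⟨w, ?_, ?_⟩
  · ext p q h
    have h1 := (W ((p - p₀).natAbs + 1)).2 p q h (by omega) (by omega)
    rw [Cochain.sub_v, sub_eq_zero] at h1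
    rw [h1, δ_v m n hmn w p q h (q - 1) (p + 1) rfl rfl,
      δ_v m n hmn _ p q h (q - 1) (p + 1) rfl rfl,
      hw ((p - p₀).natAbs + 1) p _ _ (by omega) (by omega),
      hw ((p - p₀).natAbs + 1) (p + 1) _ _ (by omega) (by omega)]
  · intro p q h hp
    rw [hw 1 p q h (by push_cast; omega) (by push_cast; omega),
      hW 0 1 zero_le_one p q h (by simp; omega) (by simp; omega)]
    exact Cochain.zero_v p q h

end Comparison

/-! ### Projective and injective representations of a finite group -/

section Higman

variable {k : Type u} [Field k] {G : Type} [Group G] [Fintype G]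

/-- The average `∑ g, g ∘ φ ∘ g⁻¹` of a linear map between representations. -/
def average (A B : Rep.{u} k G) (φ : A →ₗ[k] B) : A ⟶ B :=
  Rep.ofHom (LinearMap.intertwiningMap_of_isIntertwiningMap A.ρ B.ρ
    (∑ g : G, B.ρ g ∘ₗ φ ∘ₗ A.ρ g⁻¹) fun x v => by
      simp only [LinearMap.sum_apply, LinearMap.comp_apply, map_sum]
      refine Fintype.sum_equiv (Equiv.mulLeft x⁻¹) _ _ fun g => ?_
      simp only [Equiv.coe_mulLeft, ← Module.End.mul_apply, ← map_mul]
      rw [mul_inv_cancel_left, mul_inv_rev, inv_inv, map_mul])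

theorem average_apply (A B : Rep.{u} k G) (φ : A →ₗ[k] B) (v : A) :
    (average A B φ).hom v = ∑ g : G, B.ρ g (φ (A.ρ g⁻¹ v)) := by
  change (∑ g : G, B.ρ g ∘ₗ φ ∘ₗ A.ρ g⁻¹) v = _
  simp only [LinearMap.sum_apply, LinearMap.comp_apply]

/-- Higman's criterion: the identity of `Q` is the average of a linear map. -/
def HasTraceOne (Q : Rep.{u} k G) : Prop :=
  ∃ θ : Q →ₗ[k] Q, ∀ v, ∑ g : G, Q.ρ g (θ (Q.ρ g⁻¹ v)) = v

/-- The representation on functions `G → V` by translation, which is free. -/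
def funRepresentation (k : Type u) [Field k] (G : Type) [Group G] (V : Type u) [AddCommGroup V]
    [Module k V] : Representation k G (G → V) where
  toFun g := LinearMap.funLeft k V fun x => g⁻¹ * x
  map_one' := by ext; simp [LinearMap.funLeft_apply]
  map_mul' x y := by ext; simp [LinearMap.funLeft_apply, mul_assoc]

omit [Fintype G] in
theorem funRepresentation_apply (V : Type u) [AddCommGroup V] [Module k V] (g : G) (φ : G → V)
    (x : G) : funRepresentation k G V g φ x = φ (g⁻¹ * x) := rfl

/-- The surjection of a free representation onto `Q`. -/
def sumMap (Q : Rep.{u} k G) : Rep.of (funRepresentation k G Q) ⟶ Q :=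
  Rep.ofHom (LinearMap.intertwiningMap_of_isIntertwiningMap
    (funRepresentation k G Q) Q.ρ (∑ g : G, Q.ρ g ∘ₗ LinearMap.proj g) fun x φ => by
      simp only [LinearMap.sum_apply, LinearMap.comp_apply, map_sum, LinearMap.proj_apply]
      refine Fintype.sum_equiv (Equiv.mulLeft x⁻¹) _ _ fun g => ?_
      simp only [Equiv.coe_mulLeft, ← Module.End.mul_apply, ← map_mul, funRepresentation_apply]
      rw [mul_inv_cancel_left])

theorem sumMap_apply (Q : Rep.{u} k G) (φ : G → Q) :
    (sumMap Q).hom φ = ∑ g : G, Q.ρ g (φ g) := by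
  change (∑ g : G, Q.ρ g ∘ₗ LinearMap.proj g : (G → Q) →ₗ[k] Q) φ = _
  simp only [LinearMap.sum_apply, LinearMap.comp_apply, LinearMap.proj_apply]

/-- If `Q` is a direct summand of the functions `G → Q`, the evaluation at `1` followed by the
embedding has average the identity. -/
theorem hasTraceOne_of_projective (Q : Rep.{u} k G) [Projective Q] : HasTraceOne Q := by
  have : Epi (sumMap Q) := (Rep.epi_iff_surjective _).2 fun v => by
    classical
    refine ⟨(Pi.single 1 v : G → Q), ?_⟩
    rw [sumMap_apply, Finset.sum_eq_single 1]
    · simp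
    · intro g _ hg
      rw [Pi.single_eq_of_ne hg, map_zero]
    · simp
  let σ := Projective.factorThru (𝟙 Q) (sumMap Q)
  have hσ : ∀ v, (sumMap Q).hom (σ.hom v) = v := fun v => by
    rw [← Rep.comp_apply, Projective.factorThru_comp, Rep.id_apply]
  let τ : Q → G → Q := fun v => σ.hom v
  have hτ : ∀ (g : G) (v : Q), τ (Q.ρ g v) = funRepresentation k G Q g (τ v) :=
    fun g v => Rep.hom_comm_apply σ g v
  refine ⟨LinearMap.proj (1 : G) ∘ₗ σ.hom.toLinearMap, fun v => ?_⟩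
  change ∑ g : G, Q.ρ g (τ (Q.ρ g⁻¹ v) 1) = v
  simp only [hτ, funRepresentation_apply, inv_inv, mul_one]
  exact (sumMap_apply Q _).symm.trans (hσ v)

/-- The average of a linear lift is an equivariant lift. -/
theorem HasTraceOne.projective {Q : Rep.{u} k G} (hQ : HasTraceOne Q) : Projective Q where
  factors {E X} f e he := by
    obtain ⟨θ, hθ⟩ := hQ
    obtain ⟨s, hs⟩ := exists_pseudoinverse e.hom.toLinearMap
    have hs' : ∀ x, e.hom (s x) = x := fun x => by
      obtain ⟨y, rfl⟩ := (Rep.epi_iff_surjective e).1 he x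
      exact hs y
    refine ⟨average Q E (s ∘ₗ f.hom.toLinearMap ∘ₗ θ), Rep.hom_ext ?_⟩
    refine Representation.IntertwiningMap.ext (LinearMap.ext fun v => ?_)
    change e.hom ((average Q E _).hom v) = f.hom v
    rw [average_apply, map_sum]
    conv_rhs => rw [← hθ v, map_sum]
    refine Finset.sum_congr rfl fun g _ => ?_
    rw [Rep.hom_comm_apply, Rep.hom_comm_apply]
    exact congrArg _ (hs' _)

/-- The average of a linear extension is an equivariant extension. -/
theorem HasTraceOne.injective {Q : Rep.{u} k G} (hQ : HasTraceOne Q) : Injective Q where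
  factors {X E} f i hi := by
    obtain ⟨θ, hθ⟩ := hQ
    obtain ⟨r, hr⟩ := exists_pseudoinverse i.hom.toLinearMap
    have hr' : ∀ x, r (i.hom x) = x := fun x => (Rep.mono_iff_injective i).1 hi (hr x)
    refine ⟨average E Q (θ ∘ₗ f.hom.toLinearMap ∘ₗ r), Rep.hom_ext ?_⟩
    refine Representation.IntertwiningMap.ext (LinearMap.ext fun v => ?_)
    change (average E Q _).hom (i.hom v) = f.hom v
    rw [average_apply]
    conv_rhs => rw [← hθ (f.hom v)]
    refine Finset.sum_congr rfl fun g _ => ?_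
    rw [← Rep.hom_comm_apply, ← Rep.hom_comm_apply]
    exact congrArg (fun y => Q.ρ g (θ (f.hom y))) (hr' _)

end Higman

/-! ### Comparison of complete resolutions -/

namespace CompleteResolution

open CochainComplex CochainComplex.HomComplex

variable {k : Type u} [Field k] {G : Type} [Group G] [Fintype G] (P Q : CompleteResolution k G)

/-- The terms of a complete resolution are injective as well, by Higman's criterion. -/
theorem injective (n : ℤ) : Injective (P.complex.X n) :=
  haveI := P.projective n
  (hasTraceOne_of_projective _).injective

omit [Fintype G] in
theorem d_ε : P.complex.d (-1) 0 ≫ P.ε = 0 := by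
  have := P.mono_η
  rw [← cancel_mono P.η, Category.assoc, P.fac, P.complex.d_comp_d, Limits.zero_comp]

variable {P Q} in
/-- A cocycle between complete resolutions is a coboundary if its component with values in
degree `0` becomes zero after composition with `ε`. -/
theorem exists_homotopy_of_comp_ε {m n : ℤ} (hmn : m + 1 = n)
    (z : Cochain P.complex Q.complex n) (hz : δ n (n + 1) z = 0)
    (h0 : z.v (-n) 0 (by omega) ≫ Q.ε = 0) :
    ∃ w : Cochain P.complex Q.complex m, δ m n w = z := by
  have := P.projective (-n)
  obtain ⟨c, hc⟩ := exists_lift_of_acyclic Q.acyclic (show (-1 : ℤ) + 1 = 0 by rfl)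
    (show (0 : ℤ) + 1 = 1 by rfl) (z.v (-n) 0 (by omega))
    (by rw [← Q.fac, ← Category.assoc, h0, Limits.zero_comp])
  have hδ : ∀ q (h : -n + n = q), (z - δ m n (Cochain.single c m)).v (-n) q h = 0 := by
    intro q h
    obtain rfl : q = 0 := by omega
    rw [Cochain.sub_v, Cochain.δ_single c m n hmn (-n - 1) 0 (by omega) (by omega),
      Cochain.add_v, Cochain.single_v, Cochain.units_smul_v,
      Cochain.single_v_eq_zero _ _ _ _ _ (by omega), smul_zero, add_zero, hc, sub_self]
  obtain ⟨w, hw, -⟩ := exists_homotopy P.acyclic Q.acyclic P.projective Q.injective hmn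
    (z - δ m n (Cochain.single c m)) (by rw [δ_sub, hz, δ_δ, sub_zero]) (-n) hδ
  exact ⟨w + Cochain.single c m, by rw [δ_add, hw, sub_add_cancel]⟩

/-- The identity of `k` lifts to a chain map between complete resolutions. -/
theorem exists_hom : ∃ f : P.complex ⟶ Q.complex, f.f 0 ≫ Q.ε = P.ε := by
  have := P.projective 0
  have := Q.injective 1
  have := Q.epi_ε
  have := P.mono_η
  let φ₀ : P.complex.X 0 ⟶ Q.complex.X 0 := Projective.factorThru P.ε Q.ε
  have h₀ : φ₀ ≫ Q.ε = P.ε := Projective.factorThru_comp _ _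
  let φ₁ : P.complex.X 1 ⟶ Q.complex.X 1 := Injective.factorThru Q.η P.η
  have h₁ : P.η ≫ φ₁ = Q.η := Injective.comp_factorThru _ _
  -- Components in degrees `0` and `1` that commute with the differential extend to a chain map,
  -- because the failure to commute is a cocycle that vanishes at `0`.
  let w₀ : Cochain P.complex Q.complex 0 := Cochain.single φ₀ 0 + Cochain.single φ₁ 0
  have hδ : ∀ q (h : (0 : ℤ) + 1 = q), (-δ 0 1 w₀).v 0 q h = 0 := by
    intro q h
    obtain rfl : q = 1 := by omega
    rw [Cochain.neg_v, δ_v 0 1 rfl w₀ 0 1 rfl 0 1 rfl rfl, Cochain.add_v, Cochain.add_v,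
      Cochain.single_v, Cochain.single_v, Cochain.single_v_eq_zero _ _ _ _ _ (by omega),
      Cochain.single_v_eq_zero _ _ _ _ _ (by omega), add_zero, zero_add, ← P.fac, ← Q.fac,
      Category.assoc, h₁, ← Category.assoc, h₀, Int.negOnePow_one, Units.smul_def]
    simp
  obtain ⟨w, hw, hw0⟩ := exists_homotopy P.acyclic Q.acyclic P.projective Q.injective
    (zero_add 1) (-δ 0 1 w₀) (by rw [δ_neg, δ_δ, neg_zero]) 0 hδ
  refine ⟨Cocycle.homOf (Cocycle.mk (w + w₀) 1 rfl (by rw [δ_add, hw, neg_add_cancel])), ?_⟩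
  change (w + w₀).v 0 0 _ ≫ Q.ε = P.ε
  rw [Cochain.add_v, hw0 _ _ _ (Or.inl rfl), zero_add, Cochain.add_v, Cochain.single_v,
    Cochain.single_v_eq_zero _ _ _ _ _ (by omega), add_zero, h₀]

end CompleteResolution

/-! ### Matrices over the group algebra in binary encoding -/

section Encoding

/-- The position of a label in the list `1, x, y, x², y², x²y`. -/
def Label.num : Label → ℕ
  | .one => 0 | .x => 1 | .y => 2 | .xx => 3 | .yy => 4 | .xxy => 5

/-- The cohomological degree of the element with a given label. -/
def Label.deg : Label → ℤ
  | .one => 0 | .x => 1 | .y => 1 | .xx => 2 | .yy => 2 | .xxy => 3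

theorem Label.num_injective : Function.Injective Label.num := by
  intro a b
  cases a <;> cases b <;> simp [Label.num]

instance : DecidableEq Label := Label.num_injective.decidableEq

instance : Fintype Label where
  elems := {.one, .x, .y, .xx, .yy, .xxy}
  complete a := by cases a <;> decide

theorem Label.sum_univ {M : Type*} [AddCommMonoid M] (f : Label → M) :
    ∑ a, f a = f .one + f .x + f .y + f .xx + f .yy + f .xxy := by
  have h : (Finset.univ : Finset Label) = {.one, .x, .y, .xx, .yy, .xxy} := rfl
  rw [h]
  simp [Finset.sum_insert, add_assoc]

/-- The quaternion group of order `8`. -/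
abbrev Q8 : Type := QuaternionGroup 2

/-- The bit that stands for a group element. -/
def bitOf : Q8 → ℕ
  | .a i => i.val
  | .xa i => 4 + i.val

/-- The elements of the quaternion group. -/
def q8List : List Q8 := [.a 0, .a 1, .a 2, .a 3, .xa 0, .xa 1, .xa 2, .xa 3]

/-- The product of two elements of `𝔽₂[Q₈]`, each encoded by the natural number whose binary
digits are its coefficients. -/
def byteMul (a b : ℕ) : ℕ :=
  if a = 0 then 0 else if b = 0 then 0 else
  (q8List.map fun q => if a.testBit (bitOf q) then (q8List.map fun r =>
    if b.testBit (bitOf r) then 2 ^ bitOf (q * r) else 0).foldr Nat.xor 0 else 0).foldr Nat.xor 0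

/-- The entry of a matrix over `𝔽₂[Q₈]` encoded by a natural number: eight binary digits for each
entry, row by row. -/
def entry (M : ℕ) (i j : Label) : ℕ := (M >>> (8 * (6 * i.num + j.num))) % 256

/-- The entry of a product of matrices over `𝔽₂[Q₈]`. -/
def entryMul (M N : ℕ) (i j : Label) : ℕ :=
  ([Label.one, .x, .y, .xx, .yy, .xxy].map fun l => byteMul (entry M i l) (entry N l j)).foldr
    Nat.xor 0

/-- The differential of the minimal resolution. The terms of the resolution are free of rank `1`,
`2`, `2` and `1` in turn; their generators correspond to the labels, as explained at `Gens`. -/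
def diffCode : ℕ := 0xff030000000000220000000000001203000000002221000000000000110300

/-- Cocycles that represent `1, x, y, x², y², x²y`. They are normalized so that the augmentations
of the entries in the row `1` form the unit vector of the label. -/
def cocycleCode : Label → ℕ
  | .one => 0x10000000000000100000000000001000000000000010000000000000100000000000001
  | .x => 0xaa020000000000000000000000002020000000000020000000000000001000
  | .y => 0xf000000000000020000000000000200000000000220000000000000100000
  | .xx => 0xaa00000000000055000000000000400000000000000000000000000008000000
  | .yy => 0xf0000000000000000000000000000f000000000000400000000000002000000000
  | .xxy => 0x55550000000000005500000000000000000000000000f0000000000000010000000000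

/-- The structure constants of the products of the elements `1, x, y, x², y², x²y`. -/
def prodCoef : Label → Label → Label → Bool
  | .one, c, e => c == e
  | b, .one, e => b == e
  | .x, .x, .xx => true
  | .y, .y, .yy => true
  | .x, .y, .xx => true
  | .x, .y, .yy => true
  | .y, .x, .xx => true
  | .y, .x, .yy => true
  | .x, .yy, .xxy => true
  | .yy, .x, .xxy => true
  | .y, .xx, .xxy => true
  | .xx, .y, .xxy => true
  | _, _, _ => false

/-- Homotopies between the products of the chosen cocycles and the cocycles that represent the
products. They are chosen such that the Hochschild cocycle defined by them has the prescribed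
values on the elements `1, x, y, x², y², x²y`. -/
def homotopyCode : Label → Label → ℕ
  | .x, .x => 0xaa020000000000000000000000002020000000000020000000000000001000
  | .x, .y => 0x3c100000000000000000000000008002000000000040000000000000004000
  | .x, .xx => 0x42280000000000002400000000000c010000000000000000000000000080000000
  | .x, .yy => 0xa38100000000000041000000000021000000000000400000000000002000000000
  | .x, .xxy => 0xc880000000000002e0000000000c000000000000000f0000000000000400000000000
  | .y, .x => 0xc9c20000000000000000000000000100000000002800000000000000000000
  | .y, .xx => 0x55a0000000000000a0000000000000000000000000100000000000008000000000
  | .y, .yy => 0x32100000000000011000000000012000000000000000000000000000000000000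
  | .y, .xxy => 0x50000000000000004888000000000981000000000000000000000000a0010000000000
  | .xx, .x => 0x244400000000000018000000000090010000000000000000000000000080000000
  | .xx, .y => 0xaa00000000000055000000000000400000000000000000000000000008000000
  | .xx, .xx => 0x121400000000000000000000000022000000000006000000000000
  | .xx, .yy => 0xc0820000000000000044000000000c0000000000000028000000000090100000000000
  | .xx, .xxy => 0xa000000001890000000000000002400000000004400000000000000
  | .yy, .x => 0x38e00000000000041000000000024400000000000000000000000000000000000
  | .yy, .y => 0x32100000000000011000000000012000000000000000000000000000000000000
  | .yy, .xx => 0xc9000000000000811100000000034200000000000050000000000000200000000000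
  | .yy, .yy => 0x3210000000000001100000000000c000000000000
  | .yy, .xxy => 0x30000000000000028000000000018000000000000000000000000000a0000000000000a
  | .xxy, .x => 0x447400000000000022000000000012000000000000000a000000000000000000000000
  | .xxy, .y => 0x941000000000000004100000000090000000000000011000000000009000000000000
  | .xxy, .xx => 0xa000000000328000000000000002800000000000900000000000000
  | .xxy, .yy => 0x301800000000000000000000000084
  | .xxy, .xxy => 0x1148000000000000000000000000840000
  | _, _ => 0

/-- Cocycles that represent `b * u c` for the map `u` with `u x = u y = 1`, `u (x² y) = x²` and
the value `0` at `1, x², y²`. -/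
def twistCode : Label → Label → ℕ
  | b, .x => cocycleCode b
  | b, .y => cocycleCode b
  | .one, .xxy => cocycleCode .xx
  | .y, .xxy => cocycleCode .xxy
  | _, _ => 0

/-- The homotopies for the products of `sⁱ b` and `sʲ c`, where `p` is the parity of `i`. The
cocycles `twistCode` added for odd `i` give rise to the correction table, since its entries are
`b * u c + u (b * c) + u b * c`. -/
def homotopy₂Code (p : Bool) (b c : Label) : ℕ :=
  Nat.xor (homotopyCode b c) (if p then twistCode b c else 0)

/-- A contraction of the minimal resolution: the images of the group elements in the summand with
a given label, `48` binary digits for each. -/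
def contractionCode : Label → ℕ
  | .one => 0x11000000000016000000000012000000000010000000000000700000000000300000000000100000000000000
  | .x => 0x111200000000000000000000000000000000000000000000111d000000000000000000000000000000000000000000
  | .y => 0x11100000000107c000000000121000000000101000000001115000000000003000000000001000000000000000000
  | .xx => 0xf0000000000000000000000000000000000000000000000000000000000000000000000000000000000000000000000
  | .yy => 0x1f0000000000600000000000200000000000000000000000080000000000030000000000010000000000000000000000
  | .xxy => 0x1000000000000000000000000000000000000000000000000000000000000000000000000000000000000

/-- The components of the images of the group elements under the contraction. -/
def contractionEntry (b : Label) (q : Q8) (j : Label) : ℕ :=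
  (contractionCode b >>> (48 * bitOf q + 8 * j.num)) % 256

/-- The sum of the coefficients of an element of `𝔽₂[Q₈]`. -/
def parity (a : ℕ) : Bool :=
  if a = 0 then false else (q8List.map fun q => a.testBit (bitOf q)).foldr xor false

/-- The sum of the entries with `c l = true`. -/
def select (c : Label → Bool) (f : Label → ℕ) : ℕ :=
  ([Label.one, .x, .y, .xx, .yy, .xxy].map fun l => if c l then f l else 0).foldr Nat.xor 0

/-- The sum of Boolean values in `𝔽₂` over all labels. -/
def xorSum (f : Label → Bool) : Bool :=
  ([Label.one, .x, .y, .xx, .yy, .xxy].map f).foldr xor false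

/-- The coordinates of the values of `m` on the elements `1, x, y, x², y², x²y`. -/
def basicCoef : Label → Label → Label → Label → Bool
  | .x, .y, .x, .xx => true
  | .x, .y, .x, .yy => true
  | .x, .y, .xx, .xxy => true
  | .xx, .y, .x, .xxy => true
  | _, _, _, _ => false

/-- The coordinates of the products of `a` with the entries of the correction table. -/
def corrCoef (a : Label) : Label → Label → Label → Bool
  | .x, .y, e => xor (prodCoef a .x e) (prodCoef a .y e)
  | .x, .xx, e => prodCoef a .xx e
  | .x, .yy, e => xor (prodCoef a .xx e) (prodCoef a .yy e)
  | .x, .xxy, e => prodCoef a .xxy e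
  | .y, .x, e => xor (prodCoef a .x e) (prodCoef a .y e)
  | .y, .yy, e => prodCoef a .yy e
  | .xx, .x, e => prodCoef a .xx e
  | .yy, .x, e => xor (prodCoef a .xx e) (prodCoef a .yy e)
  | .yy, .y, e => prodCoef a .yy e
  | .xxy, .x, e => prodCoef a .xxy e
  | _, _, _ => false

/-- The coordinates of the values of `m` on `sⁱ a, sʲ b, sˡ c`, where `p` is the parity of `i`,
with respect to the basis shifted by `sⁱ⁺ʲ⁺ˡ`. -/
def mCoef (p : Bool) (a b c e : Label) : Bool :=
  xor (basicCoef a b c e) (p && corrCoef a b c e)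

/-- The matrix has degree `n`: its entries lead from labels of degree `d` to labels of degree
congruent to `d - n` modulo `4`. -/
def CodeHomogeneous (n : ℤ) (M : ℕ) : Prop :=
  ∀ i j : Label, entry M i j = 0 ∨ (j.deg - i.deg - n) % 4 = 0

instance (n : ℤ) (M : ℕ) : Decidable (CodeHomogeneous n M) := by
  unfold CodeHomogeneous; infer_instance

set_option maxRecDepth 100000

theorem diffCode_homogeneous : CodeHomogeneous 1 diffCode := by decide +kernel

theorem cocycleCode_homogeneous : ∀ b, CodeHomogeneous b.deg (cocycleCode b) := by decide +kernel

theorem homotopy₂Code_homogeneous : ∀ p b c,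
    CodeHomogeneous (b.deg + c.deg - 1) (homotopy₂Code p b c) := by decide +kernel

theorem diffCode_sq : ∀ i j, entryMul diffCode diffCode i j = 0 := by decide +kernel

theorem diffCode_cocycleCode : ∀ b i j, Nat.xor (entryMul diffCode (cocycleCode b) i j)
    (entryMul (cocycleCode b) diffCode i j) = 0 := by decide +kernel

/-- The differentials of the homotopies. -/
theorem diffCode_homotopy₂Code : ∀ p b c i j,
    Nat.xor (entryMul diffCode (homotopy₂Code p b c) i j)
        (entryMul (homotopy₂Code p b c) diffCode i j) =
      Nat.xor (select (prodCoef b c) fun l => entry (cocycleCode l) i j)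
        (entryMul (cocycleCode b) (cocycleCode c) i j) := by decide +kernel

/-- The identity `d c + c d = 1` for the contraction `c`, at a group element. -/
theorem diffCode_contraction : ∀ b q j, q ∈ q8List →
    Nat.xor
        (([Label.one, .x, .y, .xx, .yy, .xxy].map fun l =>
          byteMul (entry diffCode j l) (contractionEntry b q l)).foldr Nat.xor 0)
        (([Label.one, .x, .y, .xx, .yy, .xxy].map fun i => (q8List.map fun r =>
          if (byteMul (entry diffCode i b) (2 ^ bitOf q)).testBit (bitOf r) then
            contractionEntry i r j else 0).foldr Nat.xor 0).foldr Nat.xor 0) =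
      if j = b then 2 ^ bitOf q else 0 := by decide +kernel

theorem parity_diffCode : ∀ i j, parity (entry diffCode i j) = false := by decide +kernel

theorem parity_cocycleCode : ∀ b e, parity (entry (cocycleCode b) .one e) = (b == e) := by
  decide +kernel

theorem prodCoef_deg : ∀ b c e, prodCoef b c e = true → e.deg = b.deg + c.deg := by
  decide +kernel

theorem mCoef_deg : ∀ p a b c e, mCoef p a b c e = true →
    e.deg = a.deg + b.deg + c.deg - 1 := by decide +kernel

/-- The augmentation of the matrix of the Hochschild cocycle, in the row `1`. The first summand is
the product of two matrices; in the last one, the row `1` of a cocycle is a unit vector. -/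
theorem parity_massey : ∀ p q a b c e,
    xor (xor (xor
      (xorSum fun l => parity (entry (cocycleCode c) l e) &&
        parity (entry (homotopy₂Code p a b) .one l))
      (xorSum fun l => prodCoef b c l && parity (entry (homotopy₂Code p a l) .one e)))
      (xorSum fun l => prodCoef a b l && parity (entry (homotopy₂Code (xor p q) l c) .one e)))
      (parity (entry (homotopy₂Code q b c) a e)) = mCoef p a b c e := by decide +kernel

end Encoding

/-! ### Matrices over the group algebra -/

section GroupAlgebra

variable (k : Type u) [Field k]

/-- The image in `k` of an element of `𝔽₂`. -/
def bit (b : Bool) : k := if b then 1 else 0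

@[simp] theorem bit_true : bit k true = 1 := rfl

@[simp] theorem bit_false : bit k false = 0 := rfl

theorem bit_and (a b : Bool) : bit k (a && b) = bit k a * bit k b := by
  cases a <;> cases b <;> simp

/-- The group algebra of the quaternion group. -/
abbrev KQ8 : Type u := MonoidAlgebra k Q8

/-- The element of the group algebra with the binary digits of `n` as coefficients. -/
def elt (n : ℕ) : KQ8 k :=
  (q8List.map fun q => if n.testBit (bitOf q) then MonoidAlgebra.single q (1 : k) else 0).sum

/-- The matrix over the group algebra encoded by `M`. -/
def codeMat (M : ℕ) : Matrix Label Label (KQ8 k) := Matrix.of fun i j => elt k (entry M i j)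

/-- The differential of the minimal resolution. -/
def diffMat : Matrix Label Label (KQ8 k) := codeMat k diffCode

/-- Cocycles that represent `1, x, y, x², y², x²y`. -/
def cocycleMat (b : Label) : Matrix Label Label (KQ8 k) := codeMat k (cocycleCode b)

/-- Null homotopies of the differences between products of the cocycles `cocycleMat` and their
linear combinations. -/
def homotopyMat (p : Bool) (b c : Label) : Matrix Label Label (KQ8 k) :=
  codeMat k (homotopy₂Code p b c)

/-- The augmentation of the group algebra. -/
def aug : KQ8 k →ₐ[k] k := MonoidAlgebra.lift k k Q8 1

theorem aug_single (q : Q8) (r : k) : aug k (MonoidAlgebra.single q r) = r := by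
  simp [aug, MonoidAlgebra.lift_single]

theorem sum_q8List {M : Type*} [AddCommMonoid M] (f : Q8 → M) :
    (q8List.map f).sum = ∑ q, f q := by
  have h : (Finset.univ : Finset Q8) = q8List.toFinset := by decide
  rw [h, List.sum_toFinset f (by decide)]

theorem mem_q8List (q : Q8) : q ∈ q8List := by
  revert q; decide

theorem elt_zero : elt k 0 = 0 := by simp [elt]

theorem elt_two_pow (q : Q8) : elt k (2 ^ bitOf q) = MonoidAlgebra.single q 1 := by
  have h : ∀ q r : Q8, (2 ^ bitOf q).testBit (bitOf r) = decide (q = r) := by decide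
  rw [elt, sum_q8List]
  simp [h]

/-- The matrix has degree `n`: its entries lead from labels of degree `d` to labels of degree
congruent to `d - n` modulo `4`. -/
def Homogeneous {k : Type u} [Field k] (n : ℤ) (M : Matrix Label Label (KQ8 k)) : Prop :=
  ∀ i j : Label, M i j = 0 ∨ (j.deg - i.deg - n) % 4 = 0

variable {k}

theorem Homogeneous.add {n : ℤ} {M N : Matrix Label Label (KQ8 k)} (hM : Homogeneous n M)
    (hN : Homogeneous n N) : Homogeneous n (M + N) := by
  intro i j
  rcases hM i j with h | h
  · rcases hN i j with h' | h'
    · left; rw [Matrix.add_apply, h, h', add_zero]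
    · exact Or.inr h'
  · exact Or.inr h

theorem Homogeneous.mul {m n : ℤ} {M N : Matrix Label Label (KQ8 k)}
    (hM : Homogeneous m M) (hN : Homogeneous n N) : Homogeneous (m + n) (M * N) := by
  intro i j
  by_cases h : (j.deg - i.deg - (m + n)) % 4 = 0
  · exact Or.inr h
  · left
    rw [Matrix.mul_apply]
    refine Finset.sum_eq_zero fun l _ => ?_
    rcases hM i l with h₁ | h₁
    · rw [h₁, zero_mul]
    · rcases hN l j with h₂ | h₂
      · rw [h₂, mul_zero]
      · omega

theorem Homogeneous.sum {ι : Type*} {n : ℤ} (s : Finset ι)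
    {M : ι → Matrix Label Label (KQ8 k)} (hM : ∀ e, Homogeneous n (M e)) :
    Homogeneous n (∑ e ∈ s, M e) := by
  intro i j
  by_cases h : (j.deg - i.deg - n) % 4 = 0
  · exact Or.inr h
  · left
    rw [Matrix.sum_apply]
    exact Finset.sum_eq_zero fun e _ => (hM e i j).resolve_right h

theorem Homogeneous.congr {n n' : ℤ} {M : Matrix Label Label (KQ8 k)} (hM : Homogeneous n M)
    (h : (n - n') % 4 = 0) : Homogeneous n' M :=
  fun i j => (hM i j).imp id fun h' => by omega

variable (k) in
theorem Homogeneous.codeMat {n : ℤ} {M : ℕ} (hM : CodeHomogeneous n M) :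
    Homogeneous n (codeMat k M) := by
  intro i j
  refine (hM i j).imp (fun h => ?_) id
  rw [TateQ.codeMat, Matrix.of_apply, h, elt_zero]

variable (k)

theorem diffMat_homogeneous : Homogeneous 1 (diffMat k) := .codeMat k diffCode_homogeneous

theorem cocycleMat_homogeneous (b : Label) : Homogeneous b.deg (cocycleMat k b) :=
  .codeMat k (cocycleCode_homogeneous b)

theorem homotopyMat_homogeneous (p : Bool) (b c : Label) :
    Homogeneous (b.deg + c.deg - 1) (homotopyMat k p b c) :=
  .codeMat k (homotopy₂Code_homogeneous p b c)

variable [CharP k 2]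

theorem bit_xor (a b : Bool) : bit k (xor a b) = bit k a + bit k b := by
  cases a <;> cases b <;> simp [CharTwo.add_self_eq_zero]

theorem add_self_eq_zero_of_module {V : Type*} [AddCommGroup V] [Module k V] (v : V) :
    v + v = 0 := by
  rw [← two_smul k v, CharTwo.two_eq_zero, zero_smul]

theorem units_smul_of_charTwo {V : Type*} [AddCommGroup V] [Module k V] (c : ℤˣ) (v : V) :
    c • v = v := by
  rcases Int.units_eq_one_or c with rfl | rfl
  · exact one_smul _ v
  · rw [Units.smul_def, Units.val_neg, Units.val_one, neg_one_smul]
    exact neg_eq_of_add_eq_zero_left (add_self_eq_zero_of_module k v)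

theorem elt_xor (a b : ℕ) : elt k (Nat.xor a b) = elt k a + elt k b := by
  rw [elt, elt, elt, ← List.sum_map_add]
  congr 2
  funext q
  have h : (Nat.xor a b).testBit (bitOf q) = (a.testBit (bitOf q) ^^ b.testBit (bitOf q)) :=
    Nat.testBit_xor _ _ _
  rw [h]
  cases a.testBit (bitOf q) <;> cases b.testBit (bitOf q) <;>
    simp [add_self_eq_zero_of_module k]

theorem elt_foldr_xor (l : List ℕ) : elt k (l.foldr Nat.xor 0) = (l.map (elt k)).sum := by
  induction l with
  | nil => exact elt_zero k
  | cons a l ih => rw [List.foldr_cons, elt_xor, ih, List.map_cons, List.sum_cons]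

theorem elt_foldr_map {ι : Type*} (l : List ι) (f : ι → ℕ) :
    elt k ((l.map f).foldr Nat.xor 0) = (l.map fun i => elt k (f i)).sum := by
  rw [elt_foldr_xor, List.map_map]; rfl

theorem elt_byteMul (a b : ℕ) : elt k (byteMul a b) = elt k a * elt k b := by
  unfold byteMul
  split_ifs with ha hb
  · rw [ha, elt_zero, zero_mul]
  · rw [hb, elt_zero, mul_zero]
  rw [elt_foldr_map]
  conv_rhs => rw [elt, ← List.sum_map_mul_right]
  congr 2
  funext q
  split_ifs
  · rw [elt_foldr_map, elt, ← List.sum_map_mul_left]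
    congr 2
    funext r
    split_ifs
    · rw [elt_two_pow, MonoidAlgebra.single_mul_single, one_mul]
    · rw [elt_zero, mul_zero]
  · rw [elt_zero, zero_mul]

theorem elt_labels (f : Label → ℕ) :
    elt k (([Label.one, .x, .y, .xx, .yy, .xxy].map f).foldr Nat.xor 0) = ∑ l, elt k (f l) := by
  rw [elt_foldr_map, Label.sum_univ]
  simp [add_assoc]

theorem elt_entryMul (M N : ℕ) (i j : Label) :
    elt k (entryMul M N i j) = (codeMat k M * codeMat k N) i j := by
  rw [entryMul, elt_labels, Matrix.mul_apply]
  exact Finset.sum_congr rfl fun l _ => elt_byteMul k _ _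

theorem elt_select (c : Label → Bool) (f : Label → ℕ) :
    elt k (select c f) = ∑ l, bit k (c l) • elt k (f l) := by
  rw [select, elt_labels]
  refine Finset.sum_congr rfl fun l _ => ?_
  cases c l <;> simp [elt_zero]

theorem aug_elt (n : ℕ) : aug k (elt k n) = bit k (parity n) := by
  unfold parity
  split_ifs with h
  · rw [h, elt_zero, map_zero, bit_false]
  rw [elt]
  generalize q8List = l
  induction l with
  | nil => simp
  | cons q l ih =>
    rw [List.map_cons, List.sum_cons, map_add, ih, List.map_cons, List.foldr_cons, bit_xor]
    congr 1
    cases n.testBit (bitOf q) <;> simp [aug_single]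

theorem bit_xorSum (f : Label → Bool) : bit k (xorSum f) = ∑ l, bit k (f l) := by
  rw [xorSum, Label.sum_univ]
  simp [bit_xor, add_assoc]

theorem diffMat_mul_diffMat : diffMat k * diffMat k = 0 := by
  ext1 i j
  rw [diffMat, ← elt_entryMul, diffCode_sq, elt_zero, Matrix.zero_apply]

theorem diffMat_cocycleMat (b : Label) :
    diffMat k * cocycleMat k b + cocycleMat k b * diffMat k = 0 := by
  ext1 i j
  rw [diffMat, cocycleMat, Matrix.add_apply, ← elt_entryMul, ← elt_entryMul, ← elt_xor,
    diffCode_cocycleCode, elt_zero, Matrix.zero_apply]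

theorem diffMat_homotopyMat (p : Bool) (b c : Label) :
    diffMat k * homotopyMat k p b c + homotopyMat k p b c * diffMat k =
      ∑ e, bit k (prodCoef b c e) • cocycleMat k e + cocycleMat k b * cocycleMat k c := by
  ext1 i j
  rw [diffMat, homotopyMat, Matrix.add_apply, ← elt_entryMul, ← elt_entryMul, ← elt_xor,
    diffCode_homotopy₂Code, elt_xor, elt_select, elt_entryMul, Matrix.add_apply,
    Matrix.sum_apply]
  rfl

theorem aug_diffMat (i j : Label) : aug k (diffMat k i j) = 0 := by
  rw [diffMat, codeMat, Matrix.of_apply, aug_elt, parity_diffCode, bit_false]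

theorem aug_cocycleMat (b e : Label) : aug k (cocycleMat k b .one e) = bit k (b == e) := by
  rw [cocycleMat, codeMat, Matrix.of_apply, aug_elt, parity_cocycleCode]

omit [CharP k 2] in
theorem aug_mul_apply (M N : Matrix Label Label (KQ8 k)) (i j : Label) :
    aug k ((M * N) i j) = ∑ l, aug k (M i l) * aug k (N l j) := by
  rw [Matrix.mul_apply, map_sum]
  simp only [map_mul]

/-- The augmentation of the matrix of the Hochschild cocycle, which determines its class. -/
theorem aug_massey (p q : Bool) (a b c e : Label) :
    aug k ((homotopyMat k p a b * cocycleMat k c +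
      ∑ l, bit k (prodCoef b c l) • homotopyMat k p a l +
      ∑ l, bit k (prodCoef a b l) • homotopyMat k (xor p q) l c +
      cocycleMat k a * homotopyMat k q b c) .one e) = bit k (mCoef p a b c e) := by
  have h : ∀ M i j, aug k (codeMat k M i j) = bit k (parity (entry M i j)) := fun M i j => by
    rw [codeMat, Matrix.of_apply, aug_elt]
  rw [← parity_massey p q a b c e]
  simp only [bit_xor, bit_xorSum, bit_and, Matrix.add_apply, map_add, aug_mul_apply,
    Matrix.sum_apply, map_sum, Matrix.smul_apply, map_smul, smul_eq_mul, aug_cocycleMat]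
  simp only [cocycleMat, homotopyMat, h]
  congr 1
  · congr 2
    exact Finset.sum_congr rfl fun l _ => mul_comm _ _
  · rw [Finset.sum_eq_single a]
    · simp
    · intro l _ hl
      rw [beq_eq_false_iff_ne.2 hl.symm, bit_false, zero_mul]
    · simp

end GroupAlgebra

/-! ### The minimal complete resolution -/

section MinimalResolution

variable (k : Type u) [Field k]

/-- The labels of the generators of the minimal resolution in cohomological degree `p`. A label of
degree `n` is used in all degrees congruent to `-n` modulo `4`, where the generator is dual to the
class `b sⁱ` of degree `-p`. -/
abbrev Gens (p : ℤ) : Type := {b : Label // (b.deg + p) % 4 = 0}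

theorem sum_gens {M : Type*} [AddCommMonoid M] (p : ℤ) (f : Label → M)
    (hf : ∀ b : Label, (b.deg + p) % 4 ≠ 0 → f b = 0) : ∑ b : Gens p, f b = ∑ b, f b := by
  rw [← Finset.sum_subtype (Finset.univ.filter fun b : Label => (b.deg + p) % 4 = 0) (by simp)]
  exact Finset.sum_subset (Finset.filter_subset _ _) fun b _ hb => hf b (by simpa using hb)

/-- The free module on the generators of degree `p`. The group acts through right multiplication
by the inverse, so that equivariant maps are given by left multiplication with matrices. -/
def freeRepr (p : ℤ) : Representation k Q8 (Gens p → KQ8 k) where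
  toFun q :=
    { toFun v i := v i * MonoidAlgebra.single q⁻¹ 1
      map_add' v w := by ext1 i; simp [add_mul]
      map_smul' r v := by ext1 i; simp }
  map_one' := LinearMap.ext fun v => by ext1 i; simp [← MonoidAlgebra.one_def]
  map_mul' q r := LinearMap.ext fun v => by
    ext1 i; simp [mul_assoc, MonoidAlgebra.single_mul_single]

theorem freeRepr_apply (p : ℤ) (q : Q8) (v : Gens p → KQ8 k) (i : Gens p) :
    freeRepr k p q v i = v i * MonoidAlgebra.single q⁻¹ 1 := rfl

variable {k} in
/-- Multiplication by the block of a matrix that leads from the generators of degree `p` to those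
of degree `q`. -/
def blockMap (p q : ℤ) (M : Matrix Label Label (KQ8 k)) :
    (Gens p → KQ8 k) →ₗ[k] (Gens q → KQ8 k) where
  toFun v j := ∑ i : Gens p, M j i * v i
  map_add' v w := by ext1 j; simp [mul_add, Finset.sum_add_distrib]
  map_smul' r v := by ext1 j; simp [Finset.smul_sum]

variable {k} in
theorem blockMap_apply (p q : ℤ) (M : Matrix Label Label (KQ8 k)) (v : Gens p → KQ8 k)
    (j : Gens q) : blockMap p q M v j = ∑ i : Gens p, M j i * v i := rfl

variable {k} in
/-- The block of a matrix as an equivariant map. -/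
def blockHom (p q : ℤ) (M : Matrix Label Label (KQ8 k)) :
    Rep.of (freeRepr k p) ⟶ Rep.of (freeRepr k q) :=
  Rep.ofHom (LinearMap.intertwiningMap_of_isIntertwiningMap _ _ (blockMap p q M) fun g v => by
    ext1 j
    simp only [blockMap_apply, freeRepr_apply, Finset.sum_mul, mul_assoc])

theorem blockHom_add (p q : ℤ) (M N : Matrix Label Label (KQ8 k)) :
    blockHom p q (M + N) = blockHom p q M + blockHom p q N := by
  refine Rep.hom_ext (Representation.IntertwiningMap.ext (LinearMap.ext fun v => ?_))
  change blockMap p q (M + N) v = blockMap p q M v + blockMap p q N v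
  ext1 j
  simp [blockMap_apply, add_mul, Finset.sum_add_distrib]

theorem blockHom_smul (p q : ℤ) (r : k) (M : Matrix Label Label (KQ8 k)) :
    blockHom p q (r • M) = r • blockHom p q M := by
  refine Rep.hom_ext (Representation.IntertwiningMap.ext (LinearMap.ext fun v => ?_))
  change blockMap p q (r • M) v = r • blockMap p q M v
  ext1 j
  simp [blockMap_apply, Finset.smul_sum]

theorem blockMap_blockMap (p q r : ℤ) (M N : Matrix Label Label (KQ8 k))
    (hN : Homogeneous (q - p) N) (v : Gens p → KQ8 k) :
    blockMap q r M (blockMap p q N v) = blockMap p r (M * N) v := by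
  ext1 l
  simp only [blockMap_apply, Matrix.mul_apply, Finset.mul_sum, Finset.sum_mul]
  rw [Finset.sum_comm]
  refine Finset.sum_congr rfl fun i _ => ?_
  simp only [← mul_assoc]
  refine sum_gens q (fun j => M l j * N j i * v i) fun j hj => ?_
  rcases hN j i with h | h
  · rw [h, mul_zero, zero_mul]
  · have := i.2
    omega

theorem blockHom_comp (p q r : ℤ) (M N : Matrix Label Label (KQ8 k))
    (hN : Homogeneous (q - p) N) :
    blockHom p q N ≫ blockHom q r M = blockHom p r (M * N) := by
  refine Rep.hom_ext (Representation.IntertwiningMap.ext (LinearMap.ext fun v => ?_))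
  exact blockMap_blockMap k p q r M N hN v

/-- The generator with the label `b`, which is zero unless `b` is a label of degree `p`. -/
def gen (p : ℤ) (b : Label) : Gens p → KQ8 k := fun i => if i.1 = b then 1 else 0

/-- An equivariant map to `k` is determined by its values at the generators. -/
theorem hom_trivial_apply {p : ℤ} (l : Rep.of (freeRepr k p) ⟶ Rep.trivial k Q8 k)
    (v : Gens p → KQ8 k) : l.hom v = ∑ i : Gens p, aug k (v i) * l.hom (gen k p i) := by
  let l₁ : (Gens p → KQ8 k) →ₗ[k] k := l.hom.toLinearMap
  let l₂ : (Gens p → KQ8 k) →ₗ[k] k :=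
    ∑ i : Gens p, l₁ (gen k p i) • ((aug k).toLinearMap ∘ₗ LinearMap.proj i)
  have h : l₁ = l₂ := by
    refine LinearMap.pi_ext' fun i => MonoidAlgebra.lhom_ext' fun q => LinearMap.ext_ring ?_
    have hρ : freeRepr k p q⁻¹ (gen k p i) = Pi.single i (MonoidAlgebra.single q 1) := by
      ext1 j
      rw [freeRepr_apply, inv_inv, gen]
      by_cases hj : j = i
      · subst hj; simp
      · rw [if_neg fun h => hj (Subtype.ext h), zero_mul, Pi.single_eq_of_ne hj]
    change l₁ (Pi.single i (MonoidAlgebra.single q 1)) =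
      l₂ (Pi.single i (MonoidAlgebra.single q 1))
    have h1 : l₁ (Pi.single i (MonoidAlgebra.single q 1)) = l₁ (gen k p i) := by
      rw [← hρ]
      exact Rep.hom_comm_apply l q⁻¹ (gen k p i)
    rw [h1]
    simp only [l₂, LinearMap.sum_apply, LinearMap.smul_apply, LinearMap.comp_apply,
      LinearMap.proj_apply, smul_eq_mul]
    rw [Finset.sum_eq_single i]
    · simp [aug_single]
    · intro j _ hj
      rw [Pi.single_eq_of_ne hj, map_zero, mul_zero]
    · simp
  refine (LinearMap.congr_fun h v).trans ?_
  simp only [l₂, LinearMap.sum_apply, LinearMap.smul_apply, LinearMap.comp_apply,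
    LinearMap.proj_apply, smul_eq_mul]
  exact Finset.sum_congr rfl fun i _ => mul_comm _ _

/-- The coordinate of the label `b` followed by the augmentation. -/
def augAt (p : ℤ) (b : Label) : Rep.of (freeRepr k p) ⟶ Rep.trivial k Q8 k :=
  Rep.ofHom (LinearMap.intertwiningMap_of_isIntertwiningMap _ _
    (∑ i : Gens p, if i.1 = b then (aug k).toLinearMap ∘ₗ LinearMap.proj i else 0) fun g v => by
      simp only [LinearMap.sum_apply, Representation.trivial_apply]
      refine Finset.sum_congr rfl fun i _ => ?_
      split_ifs
      · change aug k (freeRepr k p g v i) = aug k (v i)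
        rw [freeRepr_apply, map_mul, aug_single, mul_one]
      · rfl)

theorem augAt_apply (p : ℤ) (b : Label) (v : Gens p → KQ8 k) :
    (augAt k p b).hom v = ∑ i : Gens p, if i.1 = b then aug k (v i) else 0 := by
  change (∑ i : Gens p, if i.1 = b then (aug k).toLinearMap ∘ₗ LinearMap.proj i else 0 :
    (Gens p → KQ8 k) →ₗ[k] k) v = _
  rw [LinearMap.sum_apply]
  refine Finset.sum_congr rfl fun i _ => ?_
  split_ifs <;> rfl

theorem augAt_apply_coe (p : ℤ) (b : Gens p) (v : Gens p → KQ8 k) :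
    (augAt k p b).hom v = aug k (v b) := by
  rw [augAt_apply, Finset.sum_eq_single b]
  · simp
  · intro i _ hi
    rw [if_neg fun h => hi (Subtype.ext h)]
  · simp

/-- The identity of a free module is the average of the projection to the coefficients of the
neutral element. -/
theorem hasTraceOne_freeRepr (p : ℤ) : HasTraceOne (Rep.of (freeRepr k p)) := by
  let c : KQ8 k →ₗ[k] KQ8 k := MonoidAlgebra.lsingle 1 ∘ₗ Finsupp.lapply 1 ∘ₗ
    (MonoidAlgebra.coeffLinearEquiv k).toLinearMap
  have hc : ∀ x, c x = MonoidAlgebra.single 1 (x.coeff 1) := fun x => rfl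
  let θ : (Gens p → KQ8 k) →ₗ[k] (Gens p → KQ8 k) := LinearMap.pi fun i => c ∘ₗ LinearMap.proj i
  refine ⟨θ, fun v => ?_⟩
  have hsum : ∀ x : KQ8 k, ∑ g : Q8, c (x * MonoidAlgebra.single g 1) *
      MonoidAlgebra.single g⁻¹ 1 = x := by
    intro x
    induction x using MonoidAlgebra.induction_linear with
    | zero => simp
    | add x y hx hy => simp only [add_mul, map_add, Finset.sum_add_distrib, hx, hy]
    | single q r =>
      rw [Finset.sum_eq_single q⁻¹]
      · simp [hc]
      · intro g _ hg
        have : q * g ≠ 1 := fun h => hg (eq_inv_of_mul_eq_one_right h)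
        simp [hc, this]
      · simp
  change ∑ g : Q8, freeRepr k p g (θ (freeRepr k p g⁻¹ v)) = v
  ext1 i
  rw [Finset.sum_apply]
  refine Eq.trans ?_ (hsum (v i))
  refine Finset.sum_congr rfl fun g _ => ?_
  rw [freeRepr_apply]
  change c (freeRepr k p g⁻¹ v i) * _ = _
  rw [freeRepr_apply, inv_inv]

/-- The sum of the group elements. -/
def normElt : KQ8 k := ∑ q : Q8, MonoidAlgebra.single q 1

theorem mul_normElt (x : KQ8 k) : x * normElt k = aug k x • normElt k := by
  induction x using MonoidAlgebra.induction_linear with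
  | zero => simp
  | add x y hx hy => rw [add_mul, hx, hy, map_add, add_smul]
  | single q r =>
    rw [aug_single, normElt, Finset.mul_sum, Finset.smul_sum]
    refine Fintype.sum_equiv (Equiv.mulLeft q) _ _ fun g => ?_
    simp

theorem normElt_mul_single (q : Q8) : normElt k * MonoidAlgebra.single q 1 = normElt k := by
  rw [normElt, Finset.sum_mul]
  refine Fintype.sum_equiv (Equiv.mulRight q) _ _ fun g => ?_
  simp

variable {k} in
/-- Elements fixed by the group are multiples of the norm element. -/
theorem eq_smul_normElt {x : KQ8 k} (hx : ∀ q : Q8, x * MonoidAlgebra.single q⁻¹ 1 = x) :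
    x = x.coeff 1 • normElt k := by
  have h : ∀ q : Q8, x.coeff q = x.coeff 1 := by
    intro q
    conv_rhs => rw [← hx q]
    rw [MonoidAlgebra.coeff_mul_single_eq_coeff_mul q, mul_one]
    intro q' _
    rw [mul_inv_eq_one]
  apply MonoidAlgebra.coeff_injective
  ext q
  rw [h, normElt, Finset.smul_sum, MonoidAlgebra.coeff_sum, Finset.sum_apply',
    Finset.sum_eq_single q]
  · simp
  · intro r _ hr
    simp [hr]
  · simp

variable [CharP k 2]

/-- The differential kills the fixed vectors, since its matrix has augmentation zero. -/
theorem blockMap_diffMat_of_fixed {p : ℤ} (q : ℤ) {v : Gens p → KQ8 k}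
    (hv : ∀ g, freeRepr k p g v = v) : blockMap p q (diffMat k) v = 0 := by
  ext1 j
  rw [blockMap_apply]
  refine Finset.sum_eq_zero fun i _ => ?_
  rw [eq_smul_normElt fun g => congrFun (hv g) i, mul_smul_comm, mul_normElt, aug_diffMat,
    zero_smul, smul_zero]

/-- Equivariant maps to `k` vanish on the image of the differential. -/
theorem hom_trivial_blockMap_diffMat {p q : ℤ} (l : Rep.of (freeRepr k q) ⟶ Rep.trivial k Q8 k)
    (v : Gens p → KQ8 k) : l.hom (blockMap p q (diffMat k) v) = 0 := by
  rw [hom_trivial_apply]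
  refine Finset.sum_eq_zero fun j _ => ?_
  rw [blockMap_apply, map_sum, Finset.sum_eq_zero, zero_mul]
  intro i _
  rw [map_mul, aug_diffMat, zero_mul]

/-- The `k`-linear contraction of the minimal resolution. -/
def contraction : (Label → KQ8 k) →ₗ[k] (Label → KQ8 k) where
  toFun v j := ∑ b, ∑ q, (v b).coeff q • elt k (contractionEntry b q j)
  map_add' v w := by ext1 j; simp [add_smul, Finset.sum_add_distrib]
  map_smul' r v := by ext1 j; simp [Finset.smul_sum, mul_smul]

omit [CharP k 2] in
theorem coeff_elt (n : ℕ) (q : Q8) : (elt k n).coeff q = bit k (n.testBit (bitOf q)) := by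
  rw [elt, sum_q8List, MonoidAlgebra.coeff_sum, Finset.sum_apply', Finset.sum_eq_single q]
  · cases n.testBit (bitOf q) <;> simp
  · intro r _ hr
    cases n.testBit (bitOf r) <;> simp [hr]
  · simp

/-- The contraction `c` satisfies `d c + c d = 1`. -/
theorem diffMat_contraction (v : Label → KQ8 k) (j : Label) :
    ∑ l, diffMat k j l * contraction k v l +
      contraction k (fun i => ∑ b, diffMat k i b * v b) j = v j := by
  let m : (Label → KQ8 k) →ₗ[k] (Label → KQ8 k) :=
    { toFun v i := ∑ b, diffMat k i b * v b
      map_add' v w := by ext1 j; simp [mul_add, Finset.sum_add_distrib]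
      map_smul' r v := by ext1 j; simp [Finset.smul_sum] }
  have hm : ∀ v i, m v i = ∑ b, diffMat k i b * v b := fun _ _ => rfl
  have hc : ∀ v j, contraction k v j =
    ∑ b, ∑ q, (v b).coeff q • elt k (contractionEntry b q j) := fun _ _ => rfl
  have h : m ∘ₗ contraction k + contraction k ∘ₗ m = LinearMap.id := by
    refine LinearMap.pi_ext' fun b => MonoidAlgebra.lhom_ext' fun q => LinearMap.ext_ring ?_
    ext1 j
    have hC : ∀ l, contraction k (Pi.single b (MonoidAlgebra.single q 1)) l =
        elt k (contractionEntry b q l) := by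
      intro l
      rw [hc, Finset.sum_eq_single b, Finset.sum_eq_single q]
      · simp
      · intro r _ hr
        simp [hr.symm]
      · simp
      · intro i _ hi
        simp [hi]
      · simp
    have hM : ∀ i, m (Pi.single b (MonoidAlgebra.single q 1)) i =
        elt k (byteMul (entry diffCode i b) (2 ^ bitOf q)) := by
      intro i
      rw [hm, Finset.sum_eq_single b, elt_byteMul, elt_two_pow]
      · simp [diffMat, codeMat]
      · intro i _ hi
        simp [hi]
      · simp
    change m (contraction k (Pi.single b (MonoidAlgebra.single q 1))) j +
      contraction k (m (Pi.single b (MonoidAlgebra.single q 1))) j =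
      (Pi.single b (MonoidAlgebra.single q 1) : Label → KQ8 k) j
    have key := congrArg (elt k) (diffCode_contraction b q j (mem_q8List q))
    rw [elt_xor, elt_labels, elt_labels] at key
    refine Eq.trans (congrArg₂ (· + ·) ?_ ?_) (key.trans ?_)
    · rw [hm]
      refine Finset.sum_congr rfl fun l _ => ?_
      rw [hC, elt_byteMul]; rfl
    · rw [hc]
      refine Finset.sum_congr rfl fun i _ => ?_
      rw [elt_foldr_map, sum_q8List]
      refine Finset.sum_congr rfl fun r _ => ?_
      rw [hM, coeff_elt]
      cases (byteMul (entry diffCode i b) (2 ^ bitOf q)).testBit (bitOf r) <;> simp [elt_zero]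
    · by_cases hj : j = b
      · subst hj; simp [elt_two_pow]
      · simp [hj, elt_zero]
  exact congrFun (LinearMap.congr_fun h v) j

/-- The minimal resolution is exact. -/
theorem exists_blockMap_diffMat_eq {p q r : ℤ} (hpq : p + 1 = q) (hqr : q + 1 = r)
    (v : Gens q → KQ8 k) (hv : blockMap q r (diffMat k) v = 0) :
    ∃ w : Gens p → KQ8 k, blockMap p q (diffMat k) w = v := by
  let v' : Label → KQ8 k := fun b => if h : (b.deg + q) % 4 = 0 then v ⟨b, h⟩ else 0
  have hv' : ∀ i : Gens q, v' i = v i := fun i => dif_pos i.2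
  have h0 : ∀ i, ∑ b, diffMat k i b * v' b = 0 := by
    intro i
    rw [← sum_gens q fun b => diffMat k i b * v' b]
    · by_cases hi : (i.deg + r) % 4 = 0
      · have := congrFun hv ⟨i, hi⟩
        rw [blockMap_apply] at this
        refine Eq.trans (Finset.sum_congr rfl fun j _ => ?_) this
        rw [hv']
      · refine Finset.sum_eq_zero fun j _ => ?_
        rcases diffMat_homogeneous k i j with h | h
        · rw [h, zero_mul]
        · have := j.2
          omega
    · intro b hb
      simp only [v']
      rw [dif_neg hb, mul_zero]
  refine ⟨fun i => contraction k v' i, ?_⟩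
  ext1 j
  have h1 := diffMat_contraction k v' j
  simp only [h0] at h1
  change _ + contraction k 0 _ = _ at h1
  rw [map_zero, Pi.zero_apply, add_zero, hv'] at h1
  rw [blockMap_apply, ← h1]
  refine sum_gens p (fun i => diffMat k j i * contraction k v' i) fun b hb => ?_
  rcases diffMat_homogeneous k j b with h | h
  · rw [h, zero_mul]
  · have := j.2
    omega

/-- The minimal resolution. -/
def minimalComplex : CochainComplex (Rep.{u} k Q8) ℤ where
  X p := Rep.of (freeRepr k p)
  d p q := if p + 1 = q then blockHom p q (diffMat k) else 0
  shape p q h := if_neg h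
  d_comp_d' p q r hpq hqr := by
    have hpq : p + 1 = q := hpq
    have hqr : q + 1 = r := hqr
    rw [if_pos hpq, if_pos hqr, blockHom_comp k p q r _ _
      ((diffMat_homogeneous k).congr (by omega)), diffMat_mul_diffMat]
    refine Rep.hom_ext (Representation.IntertwiningMap.ext (LinearMap.ext fun v => ?_))
    change blockMap p r 0 v = 0
    ext1 j
    simp [blockMap_apply]

theorem minimalComplex_d {p q : ℤ} (h : p + 1 = q) :
    (minimalComplex k).d p q = blockHom p q (diffMat k) := if_pos h

theorem minimalComplex_acyclic : (minimalComplex k).Acyclic := by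
  intro q
  rw [(minimalComplex k).exactAt_iff' (q - 1) q (q + 1) (by simp) (by simp)]
  apply (forget₂ (Rep.{u} k Q8) (ModuleCat k)).reflects_exact_of_faithful
  rw [ShortComplex.moduleCat_exact_iff]
  intro v hv
  obtain ⟨w, hw⟩ := exists_blockMap_diffMat_eq k (sub_add_cancel q 1) rfl v (by
    have : ((minimalComplex k).d q (q + 1)).hom v = 0 := hv
    rw [minimalComplex_d k rfl] at this
    exact this)
  refine ⟨w, ?_⟩
  change ((minimalComplex k).d (q - 1) q).hom w = v
  rw [minimalComplex_d k (sub_add_cancel q 1)]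
  exact hw

omit [CharP k 2] in
theorem diffMat_xxy_one : diffMat k .xxy .one = normElt k := by
  have h : ∀ q, (entry diffCode .xxy .one).testBit (bitOf q) = true := by decide +kernel
  rw [diffMat, codeMat, Matrix.of_apply, elt, sum_q8List, normElt]
  simp [h]

/-- The embedding of `k` as the multiples of the norm element. -/
def normHom : Rep.trivial k Q8 k ⟶ Rep.of (freeRepr k 1) :=
  Rep.ofHom (LinearMap.intertwiningMap_of_isIntertwiningMap _ _
    (LinearMap.toSpanSingleton k (Gens 1 → KQ8 k) fun _ => normElt k) fun g r => by
      ext1 i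
      rw [freeRepr_apply]
      simp only [LinearMap.toSpanSingleton_apply, Representation.trivial_apply, Pi.smul_apply,
        smul_mul_assoc, normElt_mul_single])

omit [CharP k 2] in
theorem normElt_mul (x : KQ8 k) : normElt k * x = aug k x • normElt k := by
  induction x using MonoidAlgebra.induction_linear with
  | zero => simp
  | add x y hx hy => rw [mul_add, hx, hy, map_add, add_smul]
  | single q r =>
    rw [show MonoidAlgebra.single q r = r • MonoidAlgebra.single q (1 : k) by simp,
      mul_smul_comm, normElt_mul_single, map_smul, aug_single, smul_eq_mul, mul_one]

omit [CharP k 2] in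
theorem augAt_comp_normHom : augAt k 0 .one ≫ normHom k = blockHom 0 1 (diffMat k) := by
  refine Rep.hom_ext (Representation.IntertwiningMap.ext (LinearMap.ext fun v => ?_))
  have h : ∀ v : Gens 0 → KQ8 k,
      (fun _ => (augAt k 0 .one).hom v • normElt k) = blockMap 0 1 (diffMat k) v := by
    intro v
    ext1 ⟨j, hj⟩
    obtain rfl : j = .xxy := by revert j; decide
    rw [blockMap_apply, augAt_apply, Finset.sum_smul]
    refine Finset.sum_congr rfl fun i _ => ?_
    obtain ⟨i, hi⟩ := i
    obtain rfl : i = .one := by revert i; decide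
    rw [if_pos rfl, diffMat_xxy_one, normElt_mul]
  exact h v

/-- The minimal complete resolution. -/
def minimalResolution : CompleteResolution k Q8 where
  complex := minimalComplex k
  projective p := (hasTraceOne_freeRepr k p).projective
  acyclic := minimalComplex_acyclic k
  ε := augAt k 0 .one
  η := normHom k
  epi_ε := (Rep.epi_iff_surjective _).2 fun r => by
    refine ⟨(fun _ => MonoidAlgebra.single 1 r : Gens 0 → KQ8 k), ?_⟩
    refine (augAt_apply_coe k 0 ⟨.one, rfl⟩ _).trans ?_
    rw [aug_single]
  mono_η := (Rep.mono_iff_injective _).2 fun r s h => by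
    have h1 : r • normElt k = s • normElt k := congrFun h ⟨.xxy, rfl⟩
    have h2 := congrArg (fun x : KQ8 k => x.coeff 1) h1
    have h3 : (normElt k).coeff 1 = 1 := by
      rw [normElt, MonoidAlgebra.coeff_sum, Finset.sum_apply', Finset.sum_eq_single 1]
      · simp
      · intro q _ hq
        simp [hq]
      · simp
    simpa [h3] using h2
  fac := by
    rw [minimalComplex_d k (zero_add 1)]
    exact augAt_comp_normHom k

end MinimalResolution

/-! ### The minimal resolution as a direct summand of a complete resolution -/

section Splitting

open CochainComplex CochainComplex.HomComplex

variable {k : Type u} [Field k] [CharP k 2]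

/-- A nonzero representation of the quaternion group in characteristic `2` has a nonzero fixed
vector: the central involution, then `g` and then `h` act by involutions on the vectors fixed so
far, and an involution `T` fixes `v` or the nonzero vector `T v + v`. -/
theorem exists_fixed_ne_zero {V : Type*} [AddCommGroup V] [Module k V]
    (ρ : Representation k Q8 V) (W : Submodule k V) (hW : ∀ q, ∀ w ∈ W, ρ q w ∈ W) (hW0 : W ≠ ⊥) :
    ∃ w ∈ W, w ≠ 0 ∧ ∀ q, ρ q w = w := by
  have hmul : ∀ (q r : Q8) (w : V), ρ q (ρ r w) = ρ (q * r) w := fun q r w => by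
    rw [map_mul, Module.End.mul_apply]
  have step : ∀ (q : Q8) (w : V), w ∈ W → w ≠ 0 → ρ (q * q) w = w →
      ∃ w' ∈ W, w' ≠ 0 ∧ ρ q w' = w' ∧ (w' = w ∨ w' = ρ q w + w) := by
    intro q w hw hw0 hq
    by_cases h : ρ q w = w
    · exact ⟨w, hw, hw0, h, Or.inl rfl⟩
    · refine ⟨ρ q w + w, add_mem (hW q w hw) hw, fun h0 => h ?_, ?_, Or.inr rfl⟩
      · rw [eq_neg_of_add_eq_zero_left h0, neg_eq_of_add_eq_zero_left
          (add_self_eq_zero_of_module k w)]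
      · rw [map_add, hmul, hq, add_comm]
  obtain ⟨w₀, hw₀, h₀⟩ := (Submodule.ne_bot_iff W).1 hW0
  obtain ⟨w₁, hw₁, h₁, hz₁, -⟩ := step (.a 2) w₀ hw₀ h₀ (by
    rw [show (QuaternionGroup.a 2 * QuaternionGroup.a 2 : Q8) = 1 by decide, map_one]; rfl)
  obtain ⟨w₂, hw₂, h₂, hg₂, e₂⟩ := step (.a 1) w₁ hw₁ h₁ (by
    rw [show (QuaternionGroup.a 1 * QuaternionGroup.a 1 : Q8) = .a 2 by decide, hz₁])
  have hz₂ : ρ (.a 2) w₂ = w₂ := by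
    rw [show (QuaternionGroup.a 2 : Q8) = .a 1 * .a 1 by decide, ← hmul, hg₂, hg₂]
  obtain ⟨w₃, hw₃, h₃, hh₃, e₃⟩ := step (.xa 0) w₂ hw₂ h₂ (by
    rw [show (QuaternionGroup.xa 0 * QuaternionGroup.xa 0 : Q8) = .a 2 by decide, hz₂])
  have hg₃ : ρ (.a 1) w₃ = w₃ := by
    have hg' : ρ (.a 3) w₂ = w₂ := by
      rw [show (QuaternionGroup.a 3 : Q8) = .a 1 * .a 2 by decide, ← hmul, hz₂, hg₂]
    rcases e₃ with rfl | rfl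
    · exact hg₂
    · rw [map_add, hmul, hg₂, show (QuaternionGroup.a 1 * QuaternionGroup.xa 0 : Q8) =
        .xa 0 * .a 3 by decide, ← hmul, hg']
  refine ⟨w₃, hw₃, h₃, fun q => ?_⟩
  have ha : ∀ n : ℕ, ρ (.a 1 ^ n) w₃ = w₃ := by
    intro n
    induction n with
    | zero => rw [pow_zero, map_one]; rfl
    | succ n ih => rw [pow_succ, ← hmul, hg₃, ih]
  have hq : ∀ q : Q8, ∃ n : Fin 4, q = .a 1 ^ (n : ℕ) ∨ q = .xa 0 * .a 1 ^ (n : ℕ) := by decide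
  obtain ⟨n, rfl | rfl⟩ := hq q
  · exact ha n
  · rw [← hmul, ha, hh₃]

/-- A chain map that is homotopic to the identity of the minimal resolution is an isomorphism: it
is the identity on fixed vectors, because the differential kills them. -/
theorem isIso_of_homotopic_id (φ : minimalComplex k ⟶ minimalComplex k)
    (w : Cochain (minimalComplex k) (minimalComplex k) (-1))
    (hw : δ (-1) 0 w = Cochain.ofHom φ - Cochain.ofHom (𝟙 _)) : IsIso φ := by
  have : ∀ p, IsIso (φ.f p) := by
    intro p
    let φp : Rep.of (freeRepr k p) ⟶ Rep.of (freeRepr k p) := φ.f p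
    let T : (Gens p → KQ8 k) →ₗ[k] (Gens p → KQ8 k) := φp.hom.toLinearMap
    have hT : ∀ q v, T (freeRepr k p q v) = freeRepr k p q (T v) := fun q v =>
      Rep.hom_comm_apply φp q v
    have hfix : ∀ v : Gens p → KQ8 k, (∀ q, freeRepr k p q v = v) → T v = v := by
      intro v hv
      let w₁ : Rep.of (freeRepr k p) ⟶ Rep.of (freeRepr k (p - 1)) := w.v p (p - 1) (by omega)
      let w₂ : Rep.of (freeRepr k (p + 1)) ⟶ Rep.of (freeRepr k p) := w.v (p + 1) p (by omega)
      have h1 := Cochain.congr_v hw p p (add_zero p)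
      rw [δ_v (-1) 0 (by omega) w p p (add_zero p) (p - 1) (p + 1) rfl rfl, Cochain.sub_v,
        Cochain.ofHom_v, Cochain.ofHom_v, minimalComplex_d k (sub_add_cancel p 1),
        minimalComplex_d k rfl, Int.negOnePow_zero, one_smul] at h1
      have h2 : blockMap (p - 1) p (diffMat k) (w₁.hom v) +
          w₂.hom (blockMap p (p + 1) (diffMat k) v) = T v - v :=
        congrArg (fun l : Rep.of (freeRepr k p) ⟶ Rep.of (freeRepr k p) => l.hom v) h1
      rw [blockMap_diffMat_of_fixed k _ hv, map_zero, add_zero,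
        blockMap_diffMat_of_fixed k p fun q => ?_] at h2
      · exact (sub_eq_zero.1 h2.symm)
      · have h3 : w₁.hom (freeRepr k p q v) = freeRepr k (p - 1) q (w₁.hom v) :=
          Rep.hom_comm_apply w₁ q v
        rw [← h3, hv]
    have hker : LinearMap.ker T = ⊥ := by
      by_contra hne
      obtain ⟨v, hv, hv0, hfixed⟩ := exists_fixed_ne_zero (freeRepr k p) (LinearMap.ker T)
        (fun q v hv => by
          rw [LinearMap.mem_ker] at hv ⊢
          rw [hT, hv, map_zero]) hne
      rw [LinearMap.mem_ker, hfix v hfixed] at hv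
      exact hv0 hv
    have hinj : Function.Injective T := LinearMap.ker_eq_bot.1 hker
    have hsurj : Function.Surjective T := LinearMap.injective_iff_surjective.1 hinj
    have : IsIso φp := by
      have : IsIso ((forget (Rep.{u} k Q8)).map φp) :=
        (isIso_iff_bijective _).2 ⟨hinj, hsurj⟩
      exact isIso_of_reflects_iso φp (forget (Rep.{u} k Q8))
    exact this
  exact HomologicalComplex.Hom.isIso_of_components φ

variable (k) in
/-- The augmentation of the minimal resolution. -/
abbrev minimalε : (minimalComplex k).X 0 ⟶ Rep.trivial k Q8 k := augAt k 0 .one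

/-- The minimal resolution is a direct summand of every complete resolution, and the complement
is contractible. -/
structure Splitting (P : CompleteResolution k Q8) where
  f : P.complex ⟶ minimalComplex k
  g : minimalComplex k ⟶ P.complex
  g_f : g ≫ f = 𝟙 _
  f_ε : f.f 0 ≫ minimalε k = P.ε
  g_ε : g.f 0 ≫ P.ε = minimalε k
  h : Cochain P.complex P.complex (-1)
  δ_h : δ (-1) 0 h = Cochain.ofHom (f ≫ g) - Cochain.ofHom (𝟙 _)

/-- Comparison maps in both directions exist, and their composite on the minimal resolution is an
isomorphism, so it can be made the identity. -/
theorem nonempty_splitting (P : CompleteResolution k Q8) : Nonempty (Splitting P) := by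
  have homotopic_id : ∀ (Q : CompleteResolution k Q8) (φ : Q.complex ⟶ Q.complex),
      φ.f 0 ≫ Q.ε = Q.ε →
      ∃ w : Cochain Q.complex Q.complex (-1),
        δ (-1) 0 w = Cochain.ofHom φ - Cochain.ofHom (𝟙 _) := by
    intro Q φ hφ
    refine CompleteResolution.exists_homotopy_of_comp_ε (by omega) _ (by simp) ?_
    change (Cochain.ofHom φ - Cochain.ofHom (𝟙 _)).v 0 0 (add_zero 0) ≫ Q.ε = 0
    rw [Cochain.sub_v, Cochain.ofHom_v, Cochain.ofHom_v, Preadditive.sub_comp, hφ,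
      HomologicalComplex.id_f, Category.id_comp, sub_self]
  obtain ⟨f, hf⟩ : ∃ f : P.complex ⟶ minimalComplex k,
    f.f 0 ≫ minimalε k = P.ε := P.exists_hom (minimalResolution k)
  obtain ⟨g, hg⟩ : ∃ g : minimalComplex k ⟶ P.complex,
    g.f 0 ≫ P.ε = minimalε k := (minimalResolution k).exists_hom P
  have hu : (g ≫ f).f 0 ≫ minimalε k = minimalε k := by
    rw [HomologicalComplex.comp_f, Category.assoc, hf, hg]
  obtain ⟨w, hw⟩ := homotopic_id (minimalResolution k) (g ≫ f) hu
  have hiso : IsIso (g ≫ f) := isIso_of_homotopic_id (g ≫ f) w hw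
  have hinv : (inv (g ≫ f)).f 0 ≫ minimalε k = minimalε k := by
    conv_lhs => rw [← hu]
    rw [← Category.assoc, ← HomologicalComplex.comp_f, IsIso.inv_hom_id,
      HomologicalComplex.id_f, Category.id_comp]
  have hf' : (f ≫ inv (g ≫ f)).f 0 ≫ minimalε k = P.ε := by
    rw [HomologicalComplex.comp_f, Category.assoc, hinv, hf]
  obtain ⟨h, hh⟩ := homotopic_id P ((f ≫ inv (g ≫ f)) ≫ g) (by
    rw [HomologicalComplex.comp_f, Category.assoc, hg, hf'])
  exact ⟨⟨f ≫ inv (g ≫ f), g, by rw [← Category.assoc, IsIso.hom_inv_id], hf', hg, h, hh⟩⟩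

end Splitting

/-! ### Matrices and coordinates in the endomorphism algebra -/

section MatrixModel

open CochainComplex CochainComplex.HomComplex

variable {k : Type u} [Field k] [CharP k 2]

/-- The block of a matrix as a map between the terms of the minimal resolution. -/
def minimalHom (p q : ℤ) (M : Matrix Label Label (KQ8 k)) :
    (minimalComplex k).X p ⟶ (minimalComplex k).X q := blockHom p q M

theorem minimalHom_add (p q : ℤ) (M N : Matrix Label Label (KQ8 k)) :
    minimalHom p q (M + N) = minimalHom p q M + minimalHom p q N := blockHom_add k p q M N

theorem minimalHom_smul (p q : ℤ) (r : k) (M : Matrix Label Label (KQ8 k)) :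
    minimalHom p q (r • M) = r • minimalHom p q M := blockHom_smul k p q r M

theorem minimalHom_comp (p q r : ℤ) (M N : Matrix Label Label (KQ8 k))
    (hN : Homogeneous (q - p) N) :
    minimalHom p q N ≫ minimalHom q r M = minimalHom p r (M * N) := blockHom_comp k p q r M N hN

theorem minimalComplex_d_eq {p q : ℤ} (h : p + 1 = q) :
    (minimalComplex k).d p q = minimalHom p q (diffMat k) := minimalComplex_d k h

variable (k) in
omit [CharP k 2] in
theorem gen_eq_zero {p : ℤ} {b : Label} (h : (b.deg + p) % 4 ≠ 0) : gen k p b = 0 := by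
  ext1 i
  exact if_neg fun hi : i.1 = b => h (hi ▸ i.2)

namespace Splitting

variable {P : CompleteResolution k Q8} (S : Splitting P)

/-- The endomorphism of degree `n` of `P` given by a matrix. -/
def matCochain (n : ℤ) : Matrix Label Label (KQ8 k) →ₗ[k] EndCochain P.complex n where
  toFun M := Cochain.mk fun p q _ => S.f.f p ≫ minimalHom p q M ≫ S.g.f q
  map_add' M N := by
    refine Cochain.ext _ _ fun p q hpq => ?_
    rw [Cochain.add_v, Cochain.mk_v, Cochain.mk_v, Cochain.mk_v, minimalHom_add,
      Preadditive.add_comp, Preadditive.comp_add]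
  map_smul' r M := by
    refine Cochain.ext _ _ fun p q hpq => ?_
    rw [RingHom.id_apply, Cochain.smul_v, Cochain.mk_v, Cochain.mk_v, minimalHom_smul,
      Linear.smul_comp, Linear.comp_smul]

theorem matCochain_v (n : ℤ) (M : Matrix Label Label (KQ8 k)) (p q : ℤ) (h : p + n = q) :
    (S.matCochain n M).v p q h = S.f.f p ≫ minimalHom p q M ≫ S.g.f q := rfl

/-- The equivariant map from the minimal resolution to `k` given by a cochain and `ε`. -/
def valueHom (n : ℤ) (a : EndCochain P.complex n) :
    (minimalComplex k).X (-n) ⟶ Rep.trivial k Q8 k :=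
  S.g.f (-n) ≫ a.v (-n) 0 (neg_add_cancel n) ≫ P.ε

/-- The value of `ε` after a cochain of degree `n`, at a generator of the minimal resolution. -/
def value (n : ℤ) (b : Label) : EndCochain P.complex n →ₗ[k] k where
  toFun a := (S.valueHom n a).hom (gen k (-n) b)
  map_add' a a' := by
    rw [valueHom, Cochain.add_v, Preadditive.add_comp, Preadditive.comp_add]
    rfl
  map_smul' r a := by
    rw [valueHom, Cochain.smul_v, Linear.smul_comp, Linear.comp_smul]
    rfl

theorem value_apply (n : ℤ) (b : Label) (a : EndCochain P.complex n) :
    S.value n b a = (S.valueHom n a).hom (gen k (-n) b) := rfl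

theorem value_eq_zero_of_deg {n : ℤ} {b : Label} (h : (b.deg - n) % 4 ≠ 0)
    (a : EndCochain P.complex n) : S.value n b a = 0 := by
  rw [value_apply, gen_eq_zero k h]
  exact map_zero (S.valueHom n a).hom.toLinearMap

/-- The value of the endomorphism given by a matrix at the generator `b` is the augmentation of the
entry in the row `1` and the column `b`. -/
theorem value_matCochain {n : ℤ} (b : Label) {M : Matrix Label Label (KQ8 k)}
    (hM : Homogeneous n M) : S.value n b (S.matCochain n M) = aug k (M .one b) := by
  have h : S.valueHom n (S.matCochain n M) = minimalHom (-n) 0 M ≫ minimalε k := by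
    rw [valueHom, matCochain_v, Category.assoc, Category.assoc, S.g_ε, ← Category.assoc,
      ← HomologicalComplex.comp_f, S.g_f, HomologicalComplex.id_f, Category.id_comp]
  rw [value_apply, h]
  change (augAt k 0 .one).hom (blockMap (-n) 0 M (gen k (-n) b)) = _
  refine (augAt_apply_coe k 0 ⟨.one, rfl⟩ _).trans ?_
  rw [blockMap_apply]
  by_cases hb : (b.deg + -n) % 4 = 0
  · rw [Finset.sum_eq_single ⟨b, hb⟩]
    · simp [gen]
    · intro i _ hi
      rw [gen, if_neg fun h => hi (Subtype.ext h), mul_zero]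
    · simp
  · rw [gen_eq_zero k hb]
    rcases hM .one b with h | h
    · simp [h]
    · exact absurd h fun h => hb (by simpa [Label.deg, Label.num, sub_eq_add_neg] using h)

/-- The value of a coboundary is zero, since equivariant maps to `k` kill the differential of the
minimal resolution. -/
theorem value_δ (n : ℤ) (b : Label) (a : EndCochain P.complex n) :
    S.value (n + 1) b (δ n (n + 1) a) = 0 := by
  have h : S.valueHom (n + 1) (δ n (n + 1) a) =
      minimalHom (-(n + 1)) (-n) (diffMat k) ≫ S.valueHom n a := by
    rw [valueHom, δ_v n (n + 1) rfl a (-(n + 1)) 0 (neg_add_cancel _) (-1) (-n) (by omega)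
      (by omega), units_smul_of_charTwo k, Preadditive.add_comp, Category.assoc, P.d_ε,
      Limits.comp_zero, zero_add, Category.assoc, ← Category.assoc, S.g.comm, Category.assoc,
      minimalComplex_d_eq (by omega)]
    rfl
  rw [value_apply, h]
  exact hom_trivial_blockMap_diffMat k (S.valueHom n a) (gen k _ b)

/-- A cocycle `z` all of whose values vanish is a coboundary: its composite with the embedding `g` of
the minimal resolution is a coboundary, hence so is the composite with `f ≫ g`, which is homotopic
to the identity. -/
theorem exists_δ_eq_of_value_eq_zero {m n : ℤ} (hmn : m + 1 = n) (z : EndCochain P.complex n)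
    (hz : δ n (n + 1) z = 0) (h0 : ∀ b, S.value n b z = 0) : ∃ w, δ m n w = z := by
  let zg : Cochain (minimalComplex k) P.complex n := (Cochain.ofHom S.g).comp z (zero_add n)
  have hzg : δ n (n + 1) zg = 0 := by
    rw [δ_ofHom_comp, hz, Cochain.comp_zero]
  obtain ⟨w, hw⟩ : ∃ w : Cochain (minimalComplex k) P.complex m, δ m n w = zg := by
    refine CompleteResolution.exists_homotopy_of_comp_ε (P := minimalResolution k) (Q := P) hmn
      zg hzg ?_
    change zg.v (-n) 0 _ ≫ P.ε = 0
    rw [Cochain.zero_cochain_comp_v, Cochain.ofHom_v, Category.assoc]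
    change S.valueHom n z = 0
    refine Rep.hom_ext (Representation.IntertwiningMap.ext (LinearMap.ext fun v => ?_))
    refine (hom_trivial_apply k (S.valueHom n z) v).trans (Finset.sum_eq_zero fun i _ => ?_)
    exact mul_eq_zero_of_right _ (h0 i)
  refine ⟨(Cochain.ofHom S.f).comp w (zero_add m) - S.h.comp z (by omega), ?_⟩
  rw [δ_sub, δ_ofHom_comp, hw, δ_comp S.h z (by omega) 0 (n + 1) n hmn (by omega) rfl, hz,
    Cochain.comp_zero, zero_add, units_smul_of_charTwo k, S.δ_h, Cochain.sub_comp,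
    Cochain.id_comp, Cochain.ofHom_comp]
  refine Cochain.ext _ _ fun p q hpq => ?_
  simp [zg]

end Splitting

end MatrixModel

/-! ### Differential graded algebras modelled on matrices -/

section MatrixModel

open CochainComplex CochainComplex.HomComplex

variable {k : Type u} [Field k] [CharP k 2]

/-- A differential graded algebra with a multiplicative map from the matrices over the group
algebra, and with coordinates that detect the cohomology class of a cocycle. -/
structure MatrixModel (E : DGAlg.{u, v} k) where
  /-- the element of degree `n` given by a matrix -/
  mat : ℤ → Matrix Label Label (KQ8 k) →ₗ[k] E.carrier
  mat_mem : ∀ n M, mat n M ∈ E.deg n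
  mat_mul_mat : ∀ m {n : ℤ} (M) {N}, Homogeneous n N → mat m M * mat n N = mat (m + n) (M * N)
  d_mat : ∀ {n : ℤ} {M}, Homogeneous n M →
    E.d (mat n M) = mat (n + 1) (diffMat k * M + M * diffMat k)
  /-- the coordinates with respect to the classes `b sⁱ` of degree `b.deg + 4 * i` -/
  coord : E.carrier →ₗ[k] (Label × ℤ →₀ k)
  coord_of_mem : ∀ {n : ℤ} {a}, a ∈ E.deg n → ∀ b i, b.deg + 4 * i ≠ n → coord a (b, i) = 0
  coord_d : ∀ a, coord (E.d a) = 0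
  coord_mat : ∀ {n : ℤ} {M}, Homogeneous n M →
    coord (mat n M) = ∑ b, Finsupp.single (b, (n - b.deg) / 4) (aug k (M .one b))
  exists_d_eq : ∀ z, E.d z = 0 → coord z = 0 → ∃ w, E.d w = z

namespace Splitting

variable {P : CompleteResolution k Q8} (S : Splitting P)

/-- The coordinates of an endomorphism: for the label `b` and the exponent `i`, the value at the
generator `b` of the component of degree `b.deg + 4 * i`. -/
def coord : P.dga.carrier →ₗ[k] (Label × ℤ →₀ k) :=
  DirectSum.toModule k ℤ _ fun n =>
    -- The value is zero at the labels for which the division has a remainder.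
    ∑ b : Label, Finsupp.lsingle (b, (n - b.deg) / 4) ∘ₗ S.value n b

theorem coord_lof (n : ℤ) (a : EndCochain P.complex n) :
    S.coord (DirectSum.lof k ℤ (EndCochain P.complex) n a) =
      ∑ b : Label, Finsupp.single (b, (n - b.deg) / 4) (S.value n b a) := by
  refine (DirectSum.toModule_lof k n a).trans ?_
  rw [LinearMap.sum_apply]
  rfl

theorem coord_apply (z : DirectSum ℤ (EndCochain P.complex)) (b : Label) (i : ℤ) :
    S.coord z (b, i) = S.value (b.deg + 4 * i) b (z (b.deg + 4 * i)) := by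
  induction z using DirectSum.induction_on with
  | zero =>
    rw [DirectSum.zero_apply, map_zero]
    exact DFunLike.congr_fun (map_zero S.coord) _
  | of n a =>
    refine (DFunLike.congr_fun (S.coord_lof n a) (b, i)).trans ?_
    rw [Finsupp.finsetSum_apply, Finset.sum_eq_single b]
    · by_cases hn : n = b.deg + 4 * i
      · subst hn
        rw [DirectSum.of_eq_same, add_sub_cancel_left, Int.mul_ediv_cancel_left _ (by norm_num),
          Finsupp.single_eq_same]
      · rw [DirectSum.of_eq_of_ne _ _ _ (Ne.symm hn), map_zero, Finsupp.single_apply]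
        split_ifs with h
        · have h := congrArg Prod.snd h
          exact S.value_eq_zero_of_deg (by intro h'; apply hn; simp only at h; omega) a
        · rfl
    · intro c _ hc
      exact Finsupp.single_eq_of_ne fun h => hc (congrArg Prod.fst h).symm
    · simp
  | add z w hz hw =>
    rw [DirectSum.add_apply, map_add, ← hz, ← hw]
    exact DFunLike.congr_fun (map_add S.coord z w) _

omit [CharP k 2] in
theorem endD_apply (z : DirectSum ℤ (EndCochain P.complex)) (n : ℤ) :
    (endD (k := k) P.complex z) (n + 1) = δ n (n + 1) (z n) := by
  induction z using DirectSum.induction_on with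
  | zero => rw [map_zero, DirectSum.zero_apply, DirectSum.zero_apply, δ_zero]
  | of m a =>
    rw [← DirectSum.lof_eq_of k, endD_lof P.complex rfl, DirectSum.lof_eq_of, DirectSum.lof_eq_of]
    by_cases h : m = n
    · subst h
      rw [DirectSum.of_eq_same, DirectSum.of_eq_same]
    · rw [DirectSum.of_eq_of_ne _ _ _ (Ne.symm h), DirectSum.of_eq_of_ne _ _ _ (by omega), δ_zero]
  | add z w hz hw => rw [map_add, DirectSum.add_apply, DirectSum.add_apply, δ_add, hz, hw]

theorem coord_endD (a : DirectSum ℤ (EndCochain P.complex)) :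
    S.coord (endD (k := k) P.complex a) = 0 := by
  refine Finsupp.ext fun ⟨b, i⟩ => ?_
  refine (S.coord_apply _ b i).trans ?_
  have h := S.value_δ (b.deg + 4 * i - 1) b (a (b.deg + 4 * i - 1))
  rw [← endD_apply, sub_add_cancel] at h
  exact h

theorem exists_endD_eq (z : DirectSum ℤ (EndCochain P.complex))
    (hz : endD (k := k) P.complex z = 0) (h0 : S.coord z = 0) :
    ∃ w, endD (k := k) P.complex w = z := by
  have hδ : ∀ n, δ n (n + 1) (z n) = 0 := fun n => by
    rw [← endD_apply, hz, DirectSum.zero_apply]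
  have hv : ∀ n b, S.value n b (z n) = 0 := by
    intro n b
    by_cases h : (b.deg - n) % 4 = 0
    · obtain ⟨i, rfl⟩ : ∃ i, n = b.deg + 4 * i := ⟨(n - b.deg) / 4, by omega⟩
      rw [← coord_apply, h0]
      rfl
    · exact S.value_eq_zero_of_deg h _
  choose w hw using fun n =>
    S.exists_δ_eq_of_value_eq_zero (sub_add_cancel n 1) (z n) (hδ n) (hv n)
  classical
  refine ⟨∑ n ∈ DFinsupp.support z, DirectSum.lof k ℤ (EndCochain P.complex) (n - 1) (w n), ?_⟩
  rw [map_sum]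
  refine Eq.trans (Finset.sum_congr rfl fun n _ => ?_) (DirectSum.sum_support_of z)
  rw [endD_lof P.complex (sub_add_cancel n 1), hw]
  rfl

/-- The endomorphism algebra of a complete resolution is modelled on matrices. -/
def matrixModel : MatrixModel P.dga where
  mat n := DirectSum.lof k ℤ (EndCochain P.complex) n ∘ₗ S.matCochain n
  mat_mem n M := ⟨S.matCochain n M, rfl⟩
  mat_mul_mat m {n} M {N} hN := by
    refine (lof_mul_lof (k := k) P.complex (add_comm n m) _ _).trans ?_
    refine congrArg (DirectSum.lof k ℤ (EndCochain P.complex) (m + n)) ?_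
    refine Cochain.ext _ _ fun p q hpq => ?_
    rw [Cochain.comp_v _ _ _ p (p + n) q rfl (by omega), matCochain_v, matCochain_v,
      matCochain_v, ← minimalHom_comp p (p + n) q M N (hN.congr (by omega))]
    simp only [Category.assoc]
    rw [← Category.assoc (S.g.f _) (S.f.f _), ← HomologicalComplex.comp_f, S.g_f,
      HomologicalComplex.id_f, Category.id_comp]
  d_mat {n M} hM := by
    refine (endD_lof P.complex rfl _).trans ?_
    refine congrArg (DirectSum.lof k ℤ (EndCochain P.complex) (n + 1)) ?_
    refine Cochain.ext _ _ fun p q hpq => ?_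
    rw [δ_v n (n + 1) rfl _ p q hpq (p + n) (p + 1) (by omega) rfl,
      units_smul_of_charTwo k, matCochain_v, matCochain_v, matCochain_v, minimalHom_add,
      ← minimalHom_comp p (p + n) q _ _ (hM.congr (by omega)),
      ← minimalHom_comp p (p + 1) q _ _ ((diffMat_homogeneous k).congr (by omega)),
      ← minimalComplex_d_eq rfl, ← minimalComplex_d_eq (show p + n + 1 = q by omega),
      Preadditive.add_comp, Preadditive.comp_add]
    simp only [Category.assoc, HomologicalComplex.Hom.comm, HomologicalComplex.Hom.comm_assoc]
  coord := S.coord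
  coord_of_mem {n _} := by
    rintro ⟨a, rfl⟩ b i h
    refine (S.coord_apply _ b i).trans ?_
    rw [DirectSum.lof_eq_of, DirectSum.of_eq_of_ne _ _ _ h, map_zero]
  coord_d := S.coord_endD
  coord_mat {n M} hM := by
    refine (S.coord_lof n _).trans ?_
    simp only [S.value_matCochain _ hM]
  exists_d_eq := S.exists_endD_eq

end Splitting

end MatrixModel

/-! ### The cohomology ring -/

namespace MatrixModel

variable {k : Type u} [Field k] [CharP k 2] {E : DGAlg.{u, v} k} (T : MatrixModel E)

omit [CharP k 2] in
theorem mat_congr {m n : ℤ} (h : m = n) (M : Matrix Label Label (KQ8 k)) :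
    T.mat m M = T.mat n M := by rw [h]

theorem d_mat_cocycleMat (n : ℤ) (b : Label) (hn : (b.deg - n) % 4 = 0) :
    E.d (T.mat n (cocycleMat k b)) = 0 := by
  rw [T.d_mat ((cocycleMat_homogeneous k b).congr hn), diffMat_cocycleMat, map_zero]

/-- The cocycle that represents `b sⁱ`. -/
def cocycle (p : Label × ℤ) : E.cycles :=
  ⟨T.mat (p.1.deg + 4 * p.2) (cocycleMat k p.1), T.d_mat_cocycleMat _ _ (by omega)⟩

theorem coord_cocycle (p : Label × ℤ) : T.coord (T.cocycle p) = Finsupp.single p 1 := by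
  refine (T.coord_mat ((cocycleMat_homogeneous k p.1).congr (by omega))).trans ?_
  rw [Finset.sum_eq_single p.1]
  · rw [aug_cocycleMat, beq_self_eq_true, bit_true, add_sub_cancel_left,
      Int.mul_ediv_cancel_left _ (by norm_num)]
  · intro b _ hb
    rw [aug_cocycleMat, beq_eq_false_iff_ne.2 hb.symm, bit_false, Finsupp.single_zero]
  · simp

omit [CharP k 2] in
theorem classOf_eq_iff (z w : E.cycles) :
    E.classOf z = E.classOf w ↔ T.coord z = T.coord w := by
  rw [← sub_eq_zero, ← map_sub, E.classOf_eq_zero]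
  constructor
  · rintro ⟨b, hb⟩
    have h : T.coord (z - w : E.carrier) = 0 := by
      rw [← T.coord_d b, hb]
      rfl
    rwa [map_sub, sub_eq_zero] at h
  · intro h
    exact T.exists_d_eq _ (z - w).2 (by
      change T.coord (z - w : E.carrier) = 0
      rw [map_sub, h, sub_self])

theorem coord_linearCombination (c : Label × ℤ →₀ k) :
    T.coord (Finsupp.linearCombination k T.cocycle c : E.cycles) = c := by
  have h : T.coord ∘ₗ E.cycles.val.toLinearMap ∘ₗ Finsupp.linearCombination k T.cocycle =
      LinearMap.id := by
    refine Finsupp.lhom_ext' fun p => LinearMap.ext_ring ?_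
    change T.coord (Finsupp.linearCombination k T.cocycle (Finsupp.single p 1) : E.cycles) =
      Finsupp.single p 1
    rw [Finsupp.linearCombination_single, one_smul, coord_cocycle]
  exact LinearMap.congr_fun h c

/-- The basis of the cohomology that consists of the classes `b sⁱ`. -/
def basis : Module.Basis (Label × ℤ) k E.H :=
  Module.Basis.ofRepr (LinearEquiv.ofBijective
    (E.classOf ∘ₗ Finsupp.linearCombination k T.cocycle) (by
      constructor
      · intro c c' h
        have h := (T.classOf_eq_iff _ _).1 h
        rwa [coord_linearCombination, coord_linearCombination] at h
      · intro a
        obtain ⟨z, rfl⟩ := Ideal.Quotient.mk_surjective a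
        exact ⟨T.coord z, (T.classOf_eq_iff _ _).2 (T.coord_linearCombination _)⟩)).symm

theorem basis_apply (p : Label × ℤ) : T.basis p = E.classOf (T.cocycle p) := by
  change E.classOf (Finsupp.linearCombination k T.cocycle (Finsupp.single p 1)) = _
  rw [Finsupp.linearCombination_single, one_smul]

theorem repr_classOf (z : E.cycles) : T.basis.repr (E.classOf z) = T.coord z := by
  have h : T.basis.repr.symm (T.coord z) = E.classOf z :=
    (T.classOf_eq_iff _ _).2 (T.coord_linearCombination _)
  rw [← h, LinearEquiv.apply_symm_apply]

/-- The class of the cocycle given by a matrix is read off from the augmentation of the row with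
the label `1`. -/
theorem classOf_eq_of_mat {i n d : ℤ} {M : Matrix Label Label (KQ8 k)} (hM : Homogeneous n M)
    (hn : n = d + 4 * i) {z : E.cycles} (hz : (z : E.carrier) = T.mat n M) (c : Label → Bool)
    (hc : ∀ e, aug k (M .one e) = bit k (c e)) (hd : ∀ e, c e = true → e.deg = d) :
    E.classOf z = ∑ e, bit k (c e) • T.basis (e, i) := by
  apply T.basis.repr.injective
  rw [repr_classOf, hz, T.coord_mat hM, map_sum]
  refine Finset.sum_congr rfl fun e _ => ?_
  rw [hc, map_smul, Module.Basis.repr_self, Finsupp.smul_single, smul_eq_mul, mul_one]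
  cases h : c e
  · simp
  · have := hd e h
    rw [show (n - e.deg) / 4 = i by omega]

theorem basis_mem_degH (p : Label × ℤ) : T.basis p ∈ E.degH (p.1.deg + 4 * p.2) := by
  rw [basis_apply]
  exact ⟨T.cocycle p, Submodule.mem_comap.2 (T.mat_mem _ _), rfl⟩

theorem degH_le_span (n : ℤ) :
    E.degH n ≤ Submodule.span k (T.basis '' {p | p.1.deg + 4 * p.2 = n}) := by
  rintro _ ⟨z, hz, rfl⟩
  rw [Module.Basis.mem_span_image, repr_classOf]
  intro p hp
  by_contra h
  exact Finsupp.mem_support_iff.1 hp (T.coord_of_mem hz p.1 p.2 h)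

/-- A linear map sends `degH n` to a submodule if it does so on the basis. -/
theorem apply_mem_of_mem_degH {V : Type*} [AddCommGroup V] [Module k V] (L : E.H →ₗ[k] V)
    (N : Submodule k V) {n : ℤ} (h : ∀ p : Label × ℤ, p.1.deg + 4 * p.2 = n → L (T.basis p) ∈ N)
    {a : E.H} (ha : a ∈ E.degH n) : L a ∈ N := by
  have h1 : Submodule.span k (T.basis '' {p | p.1.deg + 4 * p.2 = n}) ≤ N.comap L := by
    rw [Submodule.span_le]
    rintro _ ⟨p, hp, rfl⟩
    exact h p hp
  exact h1 (T.degH_le_span n ha)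

/-- The products of the basis elements. The structure constants can be read off from the
augmentation of `diffMat_homotopyMat`, because the differential has augmentation zero. -/
theorem basis_mul_basis (b c : Label) (i j : ℤ) :
    T.basis (b, i) * T.basis (c, j) = ∑ e, bit k (prodCoef b c e) • T.basis (e, i + j) := by
  have hmul : ∀ e, aug k ((cocycleMat k b * cocycleMat k c) .one e) = bit k (prodCoef b c e) := by
    intro e
    have h := congrArg (fun M : Matrix Label Label (KQ8 k) => aug k (M .one e))
      (diffMat_homotopyMat k false b c)
    simp only [Matrix.add_apply, map_add, aug_mul_apply, aug_diffMat, zero_mul, mul_zero,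
      Finset.sum_const_zero, add_zero, Matrix.sum_apply, map_sum, Matrix.smul_apply, map_smul,
      aug_cocycleMat, smul_eq_mul] at h
    rw [aug_mul_apply]
    simp only [aug_cocycleMat]
    rw [eq_neg_of_add_eq_zero_right h.symm, neg_eq_of_add_eq_zero_left
      (add_self_eq_zero_of_module k _), Finset.sum_eq_single e]
    · simp
    · intro l _ hl
      rw [beq_eq_false_iff_ne.2 hl, bit_false, mul_zero]
    · simp
  rw [basis_apply, basis_apply, ← E.classOf_mul]
  refine T.classOf_eq_of_mat (d := b.deg + c.deg) (n := b.deg + 4 * i + (c.deg + 4 * j))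
    (M := cocycleMat k b * cocycleMat k c) ?_ (by ring) ?_ _ hmul
    (fun e => prodCoef_deg b c e)
  · exact ((cocycleMat_homogeneous k b).mul (cocycleMat_homogeneous k c)).congr (by omega)
  · exact T.mat_mul_mat _ _ ((cocycleMat_homogeneous k c).congr (by simp only; omega))

theorem basis_mul_basis_of_eq {b c e : Label} (h : ∀ l, prodCoef b c l = (e == l)) (i j : ℤ) :
    T.basis (b, i) * T.basis (c, j) = T.basis (e, i + j) := by
  rw [basis_mul_basis, Finset.sum_eq_single e]
  · rw [h, beq_self_eq_true, bit_true, one_smul]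
  · intro l _ hl
    rw [h, beq_eq_false_iff_ne.2 hl.symm, bit_false, zero_smul]
  · exact fun h => absurd (Finset.mem_univ _) h

theorem basis_one_mul (b : Label) (i j : ℤ) :
    T.basis (.one, i) * T.basis (b, j) = T.basis (b, i + j) :=
  T.basis_mul_basis_of_eq (fun _ => rfl) i j

theorem basis_mul_one (b : Label) (i j : ℤ) :
    T.basis (b, i) * T.basis (.one, j) = T.basis (b, i + j) :=
  T.basis_mul_basis_of_eq (by revert b; decide) i j

/-- The class of the matrix with the label `1` is the neutral element, since multiplication by it
fixes the basis. -/
theorem basis_one_zero : T.basis (.one, 0) = 1 := by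
  have h : LinearMap.mulLeft k (T.basis (.one, 0)) = LinearMap.id :=
    T.basis.ext fun p => by
      rw [LinearMap.mulLeft_apply, basis_one_mul, zero_add, LinearMap.id_apply]
  simpa using LinearMap.congr_fun h 1

/-- The invertible class of degree `4`. -/
def periodUnit : E.Hˣ where
  val := T.basis (.one, 1)
  inv := T.basis (.one, -1)
  val_inv := by rw [basis_one_mul, ← basis_one_zero]; rfl
  inv_val := by rw [basis_one_mul, ← basis_one_zero]; rfl

theorem periodUnit_zpow (i : ℤ) : ((T.periodUnit ^ i : E.Hˣ) : E.H) = T.basis (.one, i) := by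
  induction i with
  | zero => rw [zpow_zero, Units.val_one, basis_one_zero]
  | succ i h =>
    rw [zpow_add_one, Units.val_mul, h]
    exact T.basis_one_mul _ _ _
  | pred i h =>
    rw [zpow_sub_one, Units.val_mul, h]
    exact T.basis_one_mul _ _ _

theorem x_mul_x : T.basis (.x, 0) * T.basis (.x, 0) = T.basis (.xx, 0) :=
  T.basis_mul_basis_of_eq (by decide) 0 0

theorem y_mul_y : T.basis (.y, 0) * T.basis (.y, 0) = T.basis (.yy, 0) :=
  T.basis_mul_basis_of_eq (by decide) 0 0

theorem x_mul_y : T.basis (.x, 0) * T.basis (.y, 0) = T.basis (.xx, 0) + T.basis (.yy, 0) := by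
  rw [basis_mul_basis, Label.sum_univ]
  simp [prodCoef]

theorem y_mul_x : T.basis (.y, 0) * T.basis (.x, 0) = T.basis (.xx, 0) + T.basis (.yy, 0) := by
  rw [basis_mul_basis, Label.sum_univ]
  simp [prodCoef]

theorem elt_eq_basis (b : Label) : b.elt (T.basis (.x, 0)) (T.basis (.y, 0)) = T.basis (b, 0) := by
  cases b
  · exact T.basis_one_zero.symm
  · rfl
  · rfl
  · exact (pow_two _).trans T.x_mul_x
  · exact (pow_two _).trans T.y_mul_y
  · refine (congrArg (· * _) ((pow_two _).trans T.x_mul_x)).trans ?_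
    exact T.basis_mul_basis_of_eq (by decide) 0 0

theorem zpow_mul_basis (b : Label) (i j : ℤ) :
    ((T.periodUnit ^ i : E.Hˣ) : E.H) * T.basis (b, j) = T.basis (b, i + j) := by
  rw [periodUnit_zpow, basis_one_mul]

theorem basis_mul_zpow (b : Label) (i j : ℤ) :
    T.basis (b, j) * ((T.periodUnit ^ i : E.Hˣ) : E.H) = T.basis (b, j + i) := by
  rw [periodUnit_zpow, basis_mul_one]

end MatrixModel

/-! ### The Hochschild cocycle -/

theorem trilin_ext {k : Type u} [Field k] {R : Type v} [Ring R] [Algebra k R] {ι : Type*}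
    (B : Module.Basis ι k R) {m m' : Trilin k R}
    (h : ∀ p q r, m (B p ⊗ₜ B q ⊗ₜ B r) = m' (B p ⊗ₜ B q ⊗ₜ B r)) : m = m' :=
  ((B.tensorProduct B).tensorProduct B).ext fun ⟨⟨p, q⟩, r⟩ => by
    simpa only [Module.Basis.tensorProduct_apply] using h p q r

section Table

variable (k : Type u) [Field k] {R : Type v} [Ring R] [Algebra k R] {x y : R} {f : Label → R}

theorem mValue_eq_sum (hxy : x * y = f .xx + f .yy) (hxxy : x ^ 2 * y = f .xxy)
    (a b c : Label) : mValue x y a b c = ∑ e, bit k (basicCoef a b c e) • f e := by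
  rw [Label.sum_univ]
  cases a <;> cases b <;> cases c <;> simp [mValue, basicCoef, hxy, hxxy]

/-- The products with the correction table in terms of a basis `f`. -/
theorem mul_corr_eq_sum [CharP k 2] {u : R} (a : Label)
    (h : ∀ b : Label, u * b.elt x y = ∑ e, bit k (prodCoef a b e) • f e) (b c : Label) :
    u * corr x y b c = ∑ e, bit k (corrCoef a b c e) • f e := by
  have hx := h .x
  have hy := h .y
  have hxx := h .xx
  have hyy := h .yy
  have hxxy := h .xxy
  simp only [Label.elt] at hx hy hxx hyy hxxy
  cases b <;> cases c <;>
    simp only [corr, corrCoef, mul_add, mul_zero, hx, hy, hxx, hyy, hxxy, bit_xor, add_smul,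
      Finset.sum_add_distrib, bit_false, zero_smul, Finset.sum_const_zero]

end Table

namespace MatrixModel

variable {k : Type u} [Field k] [CharP k 2] {E : DGAlg.{u, v} k} (T : MatrixModel E)

/-- The map that sends the class `b sⁱ` to the representing cocycle. -/
def representative : E.H →ₗ[k] E.cycles := T.basis.constr k T.cocycle

theorem representative_basis (p : Label × ℤ) : T.representative (T.basis p) = T.cocycle p :=
  T.basis.constr_basis k _ p

/-- The homotopy for the product of `b sⁱ` and `c sʲ`. -/
def homotopyElt (p q : Label × ℤ) : E.carrier :=
  T.mat (p.1.deg + q.1.deg - 1 + 4 * (p.2 + q.2)) (homotopyMat k p.2.bodd p.1 q.1)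

/-- The bilinear map given by the homotopies. -/
def homotopy : E.H →ₗ[k] E.H →ₗ[k] E.carrier :=
  T.basis.constr k fun p => T.basis.constr k fun q => T.homotopyElt p q

theorem homotopy_basis (p q : Label × ℤ) :
    T.homotopy (T.basis p) (T.basis q) = T.homotopyElt p q := by
  rw [homotopy, Module.Basis.constr_basis, Module.Basis.constr_basis]

theorem representative_mul (b c : Label) (i j : ℤ) :
    (T.representative (T.basis (b, i) * T.basis (c, j)) : E.carrier) =
      T.mat (b.deg + c.deg + 4 * (i + j)) (∑ e, bit k (prodCoef b c e) • cocycleMat k e) := by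
  have h : ∀ e, (bit k (prodCoef b c e) • T.cocycle (e, i + j) : E.carrier) =
      bit k (prodCoef b c e) • T.mat (b.deg + c.deg + 4 * (i + j)) (cocycleMat k e) := by
    intro e
    cases he : prodCoef b c e
    · rw [bit_false, zero_smul, zero_smul]
    · rw [← prodCoef_deg b c e he]
      rfl
  rw [basis_mul_basis]
  simp only [map_sum, map_smul, representative_basis]
  rw [← Finset.sum_congr rfl fun e _ => h e]
  simp

theorem cocycle_mul_cocycle (b c : Label) (i j : ℤ) :
    (T.cocycle (b, i) : E.carrier) * T.cocycle (c, j) =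
      T.mat (b.deg + c.deg + 4 * (i + j)) (cocycleMat k b * cocycleMat k c) := by
  refine (T.mat_mul_mat _ _ ((cocycleMat_homogeneous k c).congr (by simp only; omega))).trans ?_
  exact T.mat_congr (by simp only; ring) _

theorem d_homotopy (a b : E.H) : E.d (T.homotopy a b) =
    (T.representative (a * b) : E.carrier) - T.representative a * T.representative b := by
  have hsub : ∀ A B : Matrix Label Label (KQ8 k), A - B = A + B := fun A B => by
    rw [sub_eq_add_neg, neg_eq_of_add_eq_zero_left (add_self_eq_zero_of_module k B)]
  let ρ : E.H →ₗ[k] E.carrier := E.cycles.val.toLinearMap ∘ₗ T.representative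
  have h : T.homotopy.compr₂ E.d =
      (LinearMap.mul k E.H).compr₂ ρ - (LinearMap.mul k E.carrier).compl₁₂ ρ ρ := by
    refine T.basis.ext fun ⟨b, i⟩ => T.basis.ext fun ⟨c, j⟩ => ?_
    change E.d (T.homotopy (T.basis (b, i)) (T.basis (c, j))) =
      (T.representative (T.basis (b, i) * T.basis (c, j)) : E.carrier) -
        T.representative (T.basis (b, i)) * T.representative (T.basis (c, j))
    rw [homotopy_basis, representative_mul, representative_basis, representative_basis,
      cocycle_mul_cocycle, ← map_sub, homotopyElt,
      T.d_mat ((homotopyMat_homogeneous k _ b c).congr (by simp only; omega)),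
      diffMat_homotopyMat, hsub]
    exact T.mat_congr (by simp only; ring) _
  exact LinearMap.congr_fun (LinearMap.congr_fun h a) b

/-- The choices given by the matrices. -/
def canonicalChoice : DGAlg.CanonicalChoice E where
  f₁ := T.representative
  f₁_mem {n a} ha := by
    refine T.apply_mem_of_mem_degH (E.cycles.val.toLinearMap ∘ₗ T.representative) (E.deg n)
      (fun p hp => ?_) ha
    change (T.representative (T.basis p) : E.carrier) ∈ E.deg n
    rw [representative_basis, ← hp]
    exact T.mat_mem _ _
  class_f₁ a := by
    have h : E.classOf ∘ₗ T.representative = LinearMap.id := T.basis.ext fun p => by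
      rw [LinearMap.comp_apply, representative_basis, ← basis_apply, LinearMap.id_apply]
    exact LinearMap.congr_fun h a
  f₂ := T.homotopy
  f₂_mem {i j a b} ha hb := by
    refine T.apply_mem_of_mem_degH (T.homotopy.flip b) _ (fun p hp => ?_) ha
    refine T.apply_mem_of_mem_degH (T.homotopy (T.basis p)) _ (fun q hq => ?_) hb
    rw [homotopy_basis, homotopyElt, T.mat_congr (show _ = i + j - 1 by rw [← hp, ← hq]; ring)]
    exact T.mat_mem _ _
  d_f₂ := T.d_homotopy

/-- There are no signs in characteristic `2`. -/
theorem gradeSign_eq (a : E.carrier) : gradeSign E.deg a = a := by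
  induction a using DirectSum.Decomposition.inductionOn E.deg with
  | zero => rw [map_zero]
  | homogeneous x =>
    rw [gradeSign_of_mem E.deg x.2, ← Units.smul_def, units_smul_of_charTwo k]
  | add a b ha hb => rw [map_add, ha, hb]

/-- The values of the Hochschild cocycle on the basis. Each of the four summands of the cocycle
that represents the value is given by a matrix, and the augmentation of their sum is
`aug_massey`. -/
theorem massey_basis (a b c : Label) (i j l : ℤ) :
    T.canonicalChoice.massey (T.basis (a, i) ⊗ₜ T.basis (b, j) ⊗ₜ T.basis (c, l)) =
      ∑ e, bit k (mCoef i.bodd a b c e) • T.basis (e, i + j + l) := by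
  have hn : ∀ {m : ℤ} (_ : m = a.deg + b.deg + c.deg - 1 + 4 * (i + j + l)) M,
    T.mat m M = T.mat (a.deg + b.deg + c.deg - 1 + 4 * (i + j + l)) M := fun h M =>
      T.mat_congr h M
  have h₁ : T.homotopyElt (a, i) (b, j) * (T.cocycle (c, l) : E.carrier) =
      T.mat (a.deg + b.deg + c.deg - 1 + 4 * (i + j + l))
        (homotopyMat k i.bodd a b * cocycleMat k c) := by
    refine (T.mat_mul_mat _ _ ((cocycleMat_homogeneous k c).congr (by simp only; omega))).trans ?_
    exact hn (by simp only; ring) _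
  have h₂ : T.homotopy (T.basis (a, i)) (T.basis (b, j) * T.basis (c, l)) =
      T.mat (a.deg + b.deg + c.deg - 1 + 4 * (i + j + l))
        (∑ e, bit k (prodCoef b c e) • homotopyMat k i.bodd a e) := by
    rw [basis_mul_basis]
    simp only [map_sum, map_smul, homotopy_basis]
    refine Finset.sum_congr rfl fun e _ => ?_
    cases he : prodCoef b c e
    · rw [bit_false, zero_smul, zero_smul]
    · exact congrArg _ (hn (by have := prodCoef_deg b c e he; simp only; omega) _)
  have h₃ : T.homotopy (T.basis (a, i) * T.basis (b, j)) (T.basis (c, l)) =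
      T.mat (a.deg + b.deg + c.deg - 1 + 4 * (i + j + l))
        (∑ e, bit k (prodCoef a b e) • homotopyMat k (xor i.bodd j.bodd) e c) := by
    rw [basis_mul_basis]
    simp only [map_sum, map_smul, LinearMap.sum_apply, LinearMap.smul_apply, homotopy_basis]
    refine Finset.sum_congr rfl fun e _ => ?_
    cases he : prodCoef a b e
    · rw [bit_false, zero_smul, zero_smul]
    · rw [← Int.bodd_add]
      exact congrArg _ (hn (by have := prodCoef_deg a b e he; simp only; omega) _)
  have h₄ : (T.cocycle (a, i) : E.carrier) * T.homotopyElt (b, j) (c, l) =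
      T.mat (a.deg + b.deg + c.deg - 1 + 4 * (i + j + l))
        (cocycleMat k a * homotopyMat k j.bodd b c) := by
    refine (T.mat_mul_mat _ _
      ((homotopyMat_homogeneous k _ b c).congr (by simp only; omega))).trans ?_
    exact hn (by simp only; ring) _
  have hneg : ∀ v : E.carrier, -v = v := fun v =>
    neg_eq_of_add_eq_zero_left (add_self_eq_zero_of_module k v)
  rw [DGAlg.CanonicalChoice.massey_apply]
  refine T.classOf_eq_of_mat (d := a.deg + b.deg + c.deg - 1) (i := i + j + l)
    (M := homotopyMat k i.bodd a b * cocycleMat k c +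
      ∑ l, bit k (prodCoef b c l) • homotopyMat k i.bodd a l +
      ∑ l, bit k (prodCoef a b l) • homotopyMat k (xor i.bodd j.bodd) l c +
      cocycleMat k a * homotopyMat k j.bodd b c) ?_ rfl ?_ _
    (aug_massey k i.bodd j.bodd a b c) (mCoef_deg i.bodd a b c)
  · have hsum : ∀ (s : Label → Bool) (M : Label → Matrix Label Label (KQ8 k)) (n : ℤ),
        (∀ e, s e = true → Homogeneous n (M e)) → Homogeneous n (∑ e, bit k (s e) • M e) := by
      intro s M n h
      refine Homogeneous.sum _ fun e => ?_
      cases he : s e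
      · exact fun _ _ => Or.inl (by simp)
      · rw [bit_true, one_smul]
        exact h e he
    refine (((?_ : Homogeneous _ _).add ?_).add ?_).add ?_
    · exact ((homotopyMat_homogeneous k _ a b).mul (cocycleMat_homogeneous k c)).congr (by omega)
    · refine hsum _ _ _ fun e he => (homotopyMat_homogeneous k _ a e).congr ?_
      have := prodCoef_deg b c e he
      omega
    · refine hsum _ _ _ fun e he => (homotopyMat_homogeneous k _ e c).congr ?_
      have := prodCoef_deg a b e he
      omega
    · exact ((cocycleMat_homogeneous k a).mul (homotopyMat_homogeneous k _ b c)).congr (by omega)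
  · change T.canonicalChoice.expr _ _ _ = _
    change T.homotopy _ _ * (T.representative _ : E.carrier) - T.homotopy _ _ + T.homotopy _ _ -
      gradeSign E.deg (T.representative _ : E.carrier) * T.homotopy _ _ = _
    rw [gradeSign_eq, h₂, h₃]
    simp only [homotopy_basis, representative_basis]
    rw [h₁, h₄, sub_eq_add_neg, sub_eq_add_neg, hneg, hneg, map_add, map_add, map_add]

theorem quaternionFormula : QuaternionFormula (T.basis (.x, 0)) (T.basis (.y, 0)) T.periodUnit
    T.canonicalChoice.massey := by
  have hs : (T.periodUnit : E.H) = T.basis (.one, 1) := rfl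
  have hsum : ∀ (i : ℤ) (c : Label → Bool),
      T.basis (.one, i) * ∑ e, bit k (c e) • T.basis (e, 0) =
        ∑ e, bit k (c e) • T.basis (e, i) := by
    intro i c
    rw [Finset.mul_sum]
    simp only [mul_smul_comm, basis_one_mul, add_zero]
  constructor
  · intro a b c
    rw [elt_eq_basis, elt_eq_basis, elt_eq_basis, massey_basis]
    refine Eq.trans (Finset.sum_congr rfl fun e _ => ?_) (mValue_eq_sum k
      (f := fun e => T.basis (e, 0)) T.x_mul_y (T.elt_eq_basis .xxy) a b c).symm
    simp [mCoef]
  · intro a b c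
    have hcorr := mul_corr_eq_sum k (f := fun e => T.basis (e, 1)) (u := T.basis (a, 1)) a
      (fun b => by rw [elt_eq_basis, basis_mul_basis, add_zero]) b c
    rw [elt_eq_basis, elt_eq_basis, elt_eq_basis, hs, basis_one_mul, massey_basis, massey_basis,
      add_zero, add_zero, add_zero, add_zero, add_zero, hcorr, hsum, ← Finset.sum_add_distrib]
    refine Finset.sum_congr rfl fun e _ => ?_
    rw [← add_smul, mCoef, mCoef, bit_xor]
    simp
  · intro i j l a b c
    let μ := fun n : ℤ => LinearMap.mulLeft k ((T.periodUnit ^ n : E.Hˣ) : E.H)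
    have h : T.canonicalChoice.massey ∘ₗ
        TensorProduct.map (TensorProduct.map (μ (2 * i)) (μ j)) (μ l) =
        μ (2 * i + j + l) ∘ₗ T.canonicalChoice.massey := by
      refine trilin_ext T.basis fun ⟨a, i'⟩ ⟨b, j'⟩ ⟨c, l'⟩ => ?_
      simp only [LinearMap.comp_apply, TensorProduct.map_tmul, μ, LinearMap.mulLeft_apply,
        zpow_mul_basis, massey_basis]
      rw [periodUnit_zpow, Finset.mul_sum]
      refine Finset.sum_congr rfl fun e _ => ?_
      rw [mul_smul_comm, basis_one_mul, Int.bodd_add, Int.bodd_mul]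
      simp only [Int.bodd_two, Bool.false_and, Bool.false_xor]
      rw [show 2 * i + i' + (j + j') + (l + l') = 2 * i + j + l + (i' + j' + l') by ring]
    exact LinearMap.congr_fun h (a ⊗ₜ b ⊗ₜ c)

end MatrixModel

/-! ### Uniqueness and nontriviality -/

/-- The formulas determine the map: the exponent of `s` in the first argument can be reduced to `0`
or `1` by periodicity. -/
theorem QuaternionFormula.eq_of_basis {k : Type u} [Field k] {R : Type v} [Ring R] [Algebra k R]
    {x y : R} {s : Rˣ} {m m' : Trilin k R} (h : QuaternionFormula x y s m)
    (h' : QuaternionFormula x y s m') (B : Module.Basis (Label × ℤ) k R)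
    (hB : ∀ p, B p = ↑(s ^ p.2) * p.1.elt x y) : m = m' := by
  refine trilin_ext B fun ⟨a, i⟩ ⟨b, j⟩ ⟨c, l⟩ => ?_
  simp only [hB]
  obtain ⟨i, rfl | rfl⟩ := Int.even_or_odd' i
  · rw [h.periodic, h'.periodic, h.basic, h'.basic]
  · rw [zpow_add_one, Units.val_mul, mul_assoc, h.periodic, h'.periodic, h.shift, h'.shift,
      h.basic, h'.basic]

theorem HH3.mk_eq_zero_iff {k : Type u} [Field k] {R : Type v} [Ring R] [Algebra k R]
    (𝒢 : ℤ → Submodule k R) (t : ℤ) (m : cocycles3 𝒢 t) :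
    HH3.mk 𝒢 t m = 0 ↔ (m : Trilin k R) ∈ coboundaries3 𝒢 t :=
  QuotientAddGroup.eq_zero_iff m

theorem HH3.mk_eq_mk_iff {k : Type u} [Field k] {R : Type v} [Ring R] [Algebra k R]
    (𝒢 : ℤ → Submodule k R) (t : ℤ) (m m' : cocycles3 𝒢 t) :
    HH3.mk 𝒢 t m = HH3.mk 𝒢 t m' ↔ (m' : Trilin k R) - m ∈ coboundaries3 𝒢 t := by
  rw [← sub_eq_zero, ← neg_sub, neg_eq_zero]
  exact HH3.mk_eq_zero_iff 𝒢 t (m' - m)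

namespace MatrixModel

variable {k : Type u} [Field k] [CharP k 2] {E : DGAlg.{u, v} k} (T : MatrixModel E)

theorem exists_eq_add_of_mem_degH_one {a : E.H} (ha : a ∈ E.degH 1) :
    ∃ r t : k, a = r • T.basis (.x, 0) + t • T.basis (.y, 0) := by
  have h := T.degH_le_span 1 ha
  have hs : T.basis '' {p | p.1.deg + 4 * p.2 = 1} ⊆ {T.basis (.x, 0), T.basis (.y, 0)} := by
    rintro _ ⟨⟨b, i⟩, hp, rfl⟩
    have hp : b.deg + 4 * i = 1 := hp
    obtain rfl : i = 0 := by cases b <;> simp only [Label.deg] at hp <;> omega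
    cases b <;> simp [Label.deg] at hp ⊢
  obtain ⟨r, t, h⟩ := Submodule.mem_span_pair.1 (Submodule.span_mono hs h)
  exact ⟨r, t, h.symm⟩

/-- The Hochschild cocycle is not a coboundary. With the coordinates `u` of `x²` and `w` of `y²`, the
sum of `u + w` at `(x, x, x)`, `(x, y, y)`, `(y, y, x)`, of `u` at `(x, x, y)`, `(y, x, x)`,
`(y, y, y)` and of `w` at `(x, y, x)`, `(y, x, y)` vanishes for coboundaries, but it is `1` here. -/
theorem massey_notMem_coboundaries3 :
    T.canonicalChoice.massey ∉ coboundaries3 E.degH (-1) := by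
  rintro ⟨g, hg, h⟩
  set X := T.basis (.x, 0) with hX
  set Y := T.basis (.y, 0) with hY
  set X₂ := T.basis (.xx, 0) with hX₂
  set Y₂ := T.basis (.yy, 0) with hY₂
  have hXm : X ∈ E.degH 1 := T.basis_mem_degH (.x, 0)
  have hYm : Y ∈ E.degH 1 := T.basis_mem_degH (.y, 0)
  have hm := T.quaternionFormula.basic
  have key : ∀ a ∈ E.degH 1, ∀ b c, T.canonicalChoice.massey (a ⊗ₜ b ⊗ₜ c) =
      a * g b c + g (a * b) c + g a (b * c) + g a b * c := by
    intro a ha b c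
    rw [h 1 a ha b c, ← Units.smul_def, units_smul_of_charTwo k, sub_eq_add_neg,
      sub_eq_add_neg, neg_eq_of_add_eq_zero_left (add_self_eq_zero_of_module k (g (a * b) c)),
      neg_eq_of_add_eq_zero_left (add_self_eq_zero_of_module k (g a b * c))]
  obtain ⟨r₁, t₁, h₁⟩ := T.exists_eq_add_of_mem_degH_one (hg 1 1 X hXm X hXm)
  obtain ⟨r₂, t₂, h₂⟩ := T.exists_eq_add_of_mem_degH_one (hg 1 1 X hXm Y hYm)
  obtain ⟨r₃, t₃, h₃⟩ := T.exists_eq_add_of_mem_degH_one (hg 1 1 Y hYm X hXm)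
  obtain ⟨r₄, t₄, h₄⟩ := T.exists_eq_add_of_mem_degH_one (hg 1 1 Y hYm Y hYm)
  let u : E.H →ₗ[k] k := T.basis.coord (.xx, 0)
  let w : E.H →ₗ[k] k := T.basis.coord (.yy, 0)
  have e₁ := (hm .x .x .x).symm.trans (key X hXm X X)
  have e₂ := (hm .x .x .y).symm.trans (key X hXm X Y)
  have e₃ := (hm .x .y .x).symm.trans (key X hXm Y X)
  have e₄ := (hm .x .y .y).symm.trans (key X hXm Y Y)
  have e₅ := (hm .y .x .x).symm.trans (key Y hYm X X)
  have e₆ := (hm .y .x .y).symm.trans (key Y hYm X Y)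
  have e₇ := (hm .y .y .x).symm.trans (key Y hYm Y X)
  have e₈ := (hm .y .y .y).symm.trans (key Y hYm Y Y)
  have hu : u X₂ = 1 := by simp [u, hX₂]
  have hu' : u Y₂ = 0 := by simp [u, hY₂]
  have hw : w X₂ = 0 := by simp [w, hX₂]
  have hw' : w Y₂ = 1 := by simp [w, hY₂]
  have xx : X * X = X₂ := T.x_mul_x
  have xy : X * Y = X₂ + Y₂ := T.x_mul_y
  have yx : Y * X = X₂ + Y₂ := T.y_mul_x
  have yy : Y * Y = Y₂ := T.y_mul_y
  simp only [mValue, h₁, h₂, h₃, h₄, ← hX, ← hY, mul_add, add_mul, mul_smul_comm, smul_mul_assoc,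
    xx, xy, yx, yy, map_add, LinearMap.add_apply] at e₁ e₂ e₃ e₄ e₅ e₆ e₇ e₈
  -- The functional is applied to the equations that express `m` as the coboundary of `g`.
  have f₁ := congrArg (u + w) e₁
  have f₂ := congrArg u e₂
  have f₃ := congrArg w e₃
  have f₄ := congrArg (u + w) e₄
  have f₅ := congrArg u e₅
  have f₆ := congrArg w e₆
  have f₇ := congrArg (u + w) e₇
  have f₈ := congrArg u e₈
  simp only [map_add, map_smul, map_zero, LinearMap.add_apply, hu, hu', hw, hw', smul_eq_mul]
    at f₁ f₂ f₃ f₄ f₅ f₆ f₇ f₈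
  have h2 : (2 : k) = 0 := CharTwo.two_eq_zero
  -- Every value of `g` and every coordinate occurs an even number of times in the sum.
  refine one_ne_zero (α := k) ?_
  linear_combination f₁ + f₂ + f₃ + f₄ + f₅ + f₆ + f₇ + f₈ +
    (2 * (r₁ + t₁ + r₂ + t₂ + r₃ + t₃ + r₄ + t₄) + u (g X₂ X) + w (g X₂ X) + u (g X X₂) +
      w (g X X₂) + u (g X₂ Y) + w (g X₂ Y) + u (g X Y₂) + w (g X Y₂) + u (g Y₂ X) + w (g Y₂ X) +
      u (g Y₂ Y) + w (g Y₂ Y) + u (g Y X₂) + w (g Y X₂) + u (g Y Y₂) + w (g Y Y₂)) * h2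

end MatrixModel

/-! ### The generators of degree one -/

section DegreeOne

variable (k : Type u) [Field k]

/-- The homomorphisms from the quaternion group to `ℤ/2` with `x (a 1) = 1`, `x (xa 0) = 0` and
`y (a 1) = 0`, `y (xa 0) = 1`. -/
def character : Label → Q8 → Bool
  | .x, .a i => i.val.bodd
  | .x, .xa i => i.val.bodd
  | .y, .xa _ => true
  | _, _ => false

theorem character_mul : ∀ b q r, character b (q * r) = xor (character b q) (character b r) := by
  decide

theorem character_inv : ∀ b q, character b q⁻¹ = character b q := by
  decide

/-- The linear extension of a homomorphism to the group algebra. -/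
def characterMap (b : Label) : KQ8 k →ₗ[k] k :=
  Finsupp.linearCombination k (fun q => bit k (character b q)) ∘ₗ
    (MonoidAlgebra.coeffLinearEquiv k).toLinearMap

theorem characterMap_single (b : Label) (q : Q8) (r : k) :
    characterMap k b (MonoidAlgebra.single q r) = r * bit k (character b q) := by
  change Finsupp.linearCombination k _ (Finsupp.single q r) = _
  rw [Finsupp.linearCombination_single, smul_eq_mul]

variable [CharP k 2]

/-- The linear extension of a homomorphism is a derivation along the augmentation. -/
theorem characterMap_mul (b : Label) (v w : KQ8 k) : characterMap k b (v * w) =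
    characterMap k b v * aug k w + aug k v * characterMap k b w := by
  induction v using MonoidAlgebra.induction_linear with
  | zero => simp
  | add v v' h h' => simp only [add_mul, map_add, h, h']; ring
  | single q r =>
    induction w using MonoidAlgebra.induction_linear with
    | zero => simp
    | add w w' h h' => simp only [mul_add, map_add, h, h']; ring
    | single q' r' =>
      rw [MonoidAlgebra.single_mul_single, characterMap_single, characterMap_single,
        characterMap_single, aug_single, aug_single, character_mul, bit_xor]
      ring

/-- The differential sends the generators of degree `-1` to `1 + g` and `1 + h`, where the two
homomorphisms take the values of a dual basis. -/
theorem characterMap_diffMat : ∀ b i : Label, b.deg = 1 → i.deg = 1 →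
    characterMap k b (diffMat k .one i) = bit k (b == i) := by
  have hx : diffMat k .one .x = MonoidAlgebra.single (.a 0) 1 + MonoidAlgebra.single (.a 1) 1 := by
    rw [diffMat, codeMat, Matrix.of_apply, show entry diffCode .one .x =
      Nat.xor (2 ^ bitOf (.a 0)) (2 ^ bitOf (.a 1)) by decide +kernel, elt_xor, elt_two_pow,
      elt_two_pow]
  have hy : diffMat k .one .y = MonoidAlgebra.single (.a 0) 1 + MonoidAlgebra.single (.xa 0) 1 := by
    rw [diffMat, codeMat, Matrix.of_apply, show entry diffCode .one .y =
      Nat.xor (2 ^ bitOf (.a 0)) (2 ^ bitOf (.xa 0)) by decide +kernel, elt_xor, elt_two_pow,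
      elt_two_pow]
  have hval : (ZMod.val (1 : ZMod (2 * 2))).bodd = true := by decide
  intro b i hb hi
  cases i <;> simp only [Label.deg] at hi <;> try omega
  · rw [hx, map_add, characterMap_single, characterMap_single]
    cases b <;> simp only [Label.deg] at hb <;> first | omega | simp [character, bit, hval]
  · rw [hy, map_add, characterMap_single, characterMap_single]
    cases b <;> simp only [Label.deg] at hb <;> first | omega | simp [character, bit]

/-- The value of a cocycle of degree one at a group element, computed in the minimal
resolution. -/
theorem aug_blockMap_cocycleMat {b : Label} (hb : b.deg = 1) (q : Q8) (w : Gens 0 → KQ8 k)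
    (v : Gens (-1) → KQ8 k) (h : blockMap (-1) 0 (diffMat k) v = freeRepr k 0 q w - w) :
    (augAt k 0 .one).hom (blockMap (-1) 0 (cocycleMat k b) v) =
      bit k (character b q) * (augAt k 0 .one).hom w := by
  have hdeg : ∀ i : Gens (-1), i.1.deg = 1 := by decide
  have h1 := congrArg (characterMap k b) (congrFun h ⟨.one, rfl⟩)
  rw [Pi.sub_apply, map_sub, freeRepr_apply, characterMap_mul, aug_single, characterMap_single,
    mul_one, one_mul, add_sub_cancel_left, blockMap_apply, map_sum, character_inv] at h1
  refine (augAt_apply_coe k 0 ⟨.one, rfl⟩ _).trans ?_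
  refine Eq.trans ?_ ((congrArg _ (augAt_apply_coe k 0 ⟨.one, rfl⟩ w)).trans (mul_comm _ _)).symm
  rw [← h1, blockMap_apply, map_sum]
  refine Finset.sum_congr rfl fun i _ => ?_
  change aug k (cocycleMat k b .one i * v i) = characterMap k b (diffMat k .one i * v i)
  rw [map_mul, characterMap_mul, aug_diffMat, zero_mul, add_zero,
    characterMap_diffMat k b i hb (hdeg i), aug_cocycleMat]

end DegreeOne

namespace Splitting

open CochainComplex CochainComplex.HomComplex

variable {k : Type u} [Field k] [CharP k 2] {P : CompleteResolution k Q8} (S : Splitting P)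

/-- The classes `x` and `y` correspond to the homomorphisms `character`. -/
theorem hasValueAt_basis {b : Label} (hb : b.deg = 1) (q : Q8) :
    P.HasValueAt (S.matrixModel.basis (b, 0)) q (bit k (character b q)) := by
  have hmat : S.matrixModel.mat (b.deg + 4 * 0) (cocycleMat k b) =
      DirectSum.lof k ℤ (EndCochain P.complex) 1 (S.matCochain 1 (cocycleMat k b)) :=
    S.matrixModel.mat_congr (show b.deg + 4 * 0 = 1 by omega) _
  have hz : DirectSum.lof k ℤ (EndCochain P.complex) 1 (S.matCochain 1 (cocycleMat k b)) ∈
      P.dga.cycles := by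
    rw [← hmat]
    exact (S.matrixModel.cocycle (b, 0)).2
  refine ⟨S.matCochain 1 (cocycleMat k b), hz, ?_, fun w v h => ?_⟩
  · rw [MatrixModel.basis_apply]
    exact congrArg P.dga.classOf (Subtype.ext hmat.symm)
  · let w' : Gens 0 → KQ8 k := (S.f.f 0).hom w
    let v' : Gens (-1) → KQ8 k := (S.f.f (-1)).hom v
    have hd : blockMap (-1) 0 (diffMat k) v' = freeRepr k 0 q w' - w' := by
      have h1 : S.f.f (-1) ≫ minimalHom (-1) 0 (diffMat k) = P.complex.d (-1) 0 ≫ S.f.f 0 := by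
        rw [← minimalComplex_d_eq (neg_add_cancel 1), S.f.comm]
      have h2 : blockMap (-1) 0 (diffMat k) v' = (S.f.f 0).hom ((P.complex.d (-1) 0).hom v) :=
        congrArg (fun l : P.complex.X (-1) ⟶ (minimalComplex k).X 0 => l.hom v) h1
      rw [h2, h]
      refine (map_sub (S.f.f 0).hom.toLinearMap _ _).trans ?_
      exact congrArg (· - w') (Rep.hom_comm_apply (S.f.f 0) q w)
    have hε : P.ε.hom w = (augAt k 0 .one).hom w' :=
      (congrArg (fun l : P.complex.X 0 ⟶ Rep.trivial k Q8 k => l.hom w) S.f_ε).symm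
    have hv : P.ε.hom (((S.matCochain 1 (cocycleMat k b)).v (-1) 0 (by norm_num)).hom v) =
        (augAt k 0 .one).hom (blockMap (-1) 0 (cocycleMat k b) v') := by
      have h3 : (S.matCochain 1 (cocycleMat k b)).v (-1) 0 (by norm_num) ≫ P.ε =
          S.f.f (-1) ≫ minimalHom (-1) 0 (cocycleMat k b) ≫ minimalε k := by
        rw [matCochain_v, Category.assoc, Category.assoc, S.g_ε]
      exact congrArg (fun l : P.complex.X (-1) ⟶ Rep.trivial k Q8 k => l.hom v) h3
    rw [hε, hv]
    exact aug_blockMap_cocycleMat k hb q w' v' hd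

theorem standardGenerators : StandardGenerators P (S.matrixModel.basis (.x, 0))
    (S.matrixModel.basis (.y, 0)) S.matrixModel.periodUnit := by
  set T := S.matrixModel
  have hbasis : (fun p : Label × ℤ => p.1.elt (T.basis (.x, 0)) (T.basis (.y, 0)) *
      ((T.periodUnit ^ p.2 : P.tateˣ) : P.tate)) = T.basis := by
    funext p
    rw [T.elt_eq_basis, T.basis_mul_zpow, zero_add]
  exact
    { x_g := S.hasValueAt_basis (b := .x) rfl (.a 1)
      x_h := S.hasValueAt_basis (b := .x) rfl (.xa 0)
      y_g := S.hasValueAt_basis (b := .y) rfl (.a 1)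
      y_h := S.hasValueAt_basis (b := .y) rfl (.xa 0)
      s_mem := T.basis_mem_degH (.one, 1)
      xy_comm := T.x_mul_y.trans T.y_mul_x.symm
      sx_comm := (T.basis_one_mul .x 1 0).trans (T.basis_mul_one .x 0 1).symm
      sy_comm := (T.basis_one_mul .y 1 0).trans (T.basis_mul_one .y 0 1).symm
      rel_xy := by rw [pow_two, pow_two, T.x_mul_x, T.y_mul_y, T.x_mul_y]
      rel_y := by
        rw [pow_succ, pow_two, T.y_mul_y, T.basis_mul_basis]
        exact Finset.sum_eq_zero fun e _ => by
          rw [show prodCoef .yy .y e = false by revert e; decide, bit_false, zero_smul]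
      linearIndependent := by rw [hbasis]; exact T.basis.linearIndependent
      span := by rw [hbasis]; exact T.basis.span_eq }

end Splitting

end TateQ

end

theorem mainTheorem2 {k : Type u} [Field k] [CharP k 2] :
    Nonempty (TateQ.CompleteResolution k (QuaternionGroup 2)) ∧
    ∀ P : TateQ.CompleteResolution k (QuaternionGroup 2),
      ∃ (x y : P.tate) (s : P.tateˣ), TateQ.StandardGenerators P x y s ∧
        ∃ m : TateQ.cocycles3 P.dga.degH (-1),
          TateQ.QuaternionFormula x y s (m : TateQ.Trilin k P.tate) ∧
          (∀ m' : TateQ.Trilin k P.tate, TateQ.QuaternionFormula x y s m' → m' = m) ∧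
          P.dga.IsCanonicalClass (TateQ.HH3.mk P.dga.degH (-1) m) ∧
          TateQ.HH3.mk P.dga.degH (-1) m ≠ 0 := by
  refine ⟨⟨TateQ.minimalResolution k⟩, fun P => ?_⟩
  obtain ⟨S⟩ := TateQ.nonempty_splitting P
  let T := S.matrixModel
  let F := T.canonicalChoice
  refine ⟨_, _, _, S.standardGenerators, ⟨F.massey, F.massey_mem_cocycles3⟩, T.quaternionFormula,
    fun m' hm' => ?_, ⟨⟨F⟩, fun F' => ?_⟩, fun h => ?_⟩
  · refine hm'.eq_of_basis T.quaternionFormula T.basis fun p => ?_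
    rw [T.elt_eq_basis, T.zpow_mul_basis, add_zero]
  · exact (TateQ.HH3.mk_eq_mk_iff _ _ _ _).2 (F'.massey_sub_mem_coboundaries3 F)
  · exact T.massey_notMem_coboundaries3 ((TateQ.HH3.mk_eq_zero_iff _ _ _).1 h)
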